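/- **Setting.** Let $A\in\mathbb R^{n\times n}$ be symmetric with zero diagonal and let $\mathcal D(A,0)$ be the zero-field Ising model on $\{-1,1\}^n$, $\Pr[Z=z]\propto\exp\big(\sum_{i<j}A_{ij}z_iz_j\big)$, with dependency graph $G$ ($i\sim j$ iff $A_{ij}\neq0$). Let $\lambda>0$ satisfy $\sum_j|A_{ij}|\le\lambda$ for all $i$, and let the known numbers $p_i$ satisfy $0\le p_i\le p_{\max}<1$. A corrupted sample $X$ is obtained from $Z\sim\mathcal D(A,0)$ by erasing every entry $Z_i$ independently with probability $p_i$; an erased entry is recorded as $X_i=0$, otherwise $X_i=Z_i$. **Algorithm for a vertex $u$.** Weights $w\in\mathbb R^{2n-1}$ have coordinates $w_{+j},w_{-j}$ ($j\ne u$) and one slack coordinate; put $\Pi(w)_j=w_{+j}-w_{-j}$. For $i\neq u$ let $$g^i(w;X)=-\frac{X_u}{1-p_u}\cdot\frac{e^{-\Pi(w)_iX_uX_i}X_i}{1-p_i}\prod_{j\ne i,u}\frac{e^{-\Pi(w)_jX_uX_j}-p_j}{1-p_j},$$ and let $G_{\mathsf{miss}}(w;X)$ have coordinates $g^i$ at $+i$,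 $-g^i$ at $-i$ and $0$ at the slack coordinate. Given independent corrupted samples $X^1,\dots,X^T$, start with $w^1_c=\lambda/(2n-1)$ for all $c$, iterate $$w^{t+1}_c=w^t_c\Big(1-\eta\,G_{\mathsf{miss}}(w^t;X^t)_c+\tfrac{\eta}{\lambda}\langle w^t,G_{\mathsf{miss}}(w^t;X^t)\rangle\Big),$$ and output $\bar w=\bar w^{(u)}=\frac1T\sum_{t=1}^Tw^t$. The step size is $\eta=\min\big\{\frac1{8B},\frac1{2B}\sqrt{\log(2n-1)/T}\big\}$, where $B=(1-p_{\max})^{-2}e^{\lambda/(1-p_{\max})}$. **Theorem.** There is an absolute constant $K>0$, and for all $p_{\max}\in[0,1)$ and $\lambda_0>0$ there is a constant $C>0$ depending only on $p_{\max}$ and $\lambda_0$, such that the following holds for all $n,T,A,p,\lambda$ as above and all $\delta\in(0,1)$. For $L,\epsilon>0$ call $T$ *sufficient for $(L,\epsilon)$* if $$\lambda\ge\lambda_0\ \text{ and }\ T\ge\lambda^4\,L\,e^{C\lambda}\,\epsilon^{-4},\qquad\text{or}\qquad T\ge K\,\frac{\lambda^2(1+\lambda)^2}{(1-p_{\max})^4}\,e^{\left(\frac2{1-p_{\max}}+6\right)\lambda}\,L\,\epsilon^{-4}.$$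 1. For every vertex $u$ and every $\epsilon>0$, if $T$ is sufficient for $(\log(n/\delta),\epsilon)$, then with probability at least $1-\delta$, $|\Pi(\bar w)_i-A_{ui}|\le\epsilon$ for all $i\neq u$. 2. Let $\beta>0$ satisfy $|A_{ij}|\ge\beta$ for every edge. If $T$ is sufficient for $(\log(n^2/\delta),\beta/2)$, then, running the algorithm for every vertex on the same samples, with probability at least $1-\delta$ the sets $\{i\ne u:|\Pi(\bar w^{(u)})_i|\ge\beta/2\}$ are exactly the neighbourhoods in $G$ of all vertices $u$. 3. There is one program for the real random access machine (unit-cost arithmetic, exponential and comparison of reals) which, for all $n,T\ge1$, computes the sets in part 2 from $(n,T,\lambda,\eta,\beta,p,X^1,\dots,X^T)$ in $O(n^2T)$ steps with an absolute constant. In particular, for $n\ge2$, $\lambda\ge\lambda_0$ and $T=\lceil\lambda^4\log(n^2/\delta)e^{C\lambda}(\beta/2)^{-4}\rceil$, it outputs the graph $G$ with probability at least $1-\delta$, and it always takes at most $M\,n^2\log(n/\delta)$ steps, i.e. $\widetilde O(n^2)$, where $M$ depends only on $p_{\max},\lambda_0,\lambda,\beta$. -/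

import Mathlib

open MeasureTheory

noncomputable section

namespace IsingMissing

/-! ### Ising models and missing data -/

/-- A spin `±1`, coded by a Boolean (`true` is `+1`). -/
def spin (b : Bool) : ℝ := if b then 1 else -1

/-- The exponent `∑_{i<j} A i j z_i z_j + ∑ i, θ_i z_i`. For symmetric `A` every unordered pair is
counted once, and pairs that are not edges contribute `0`. -/
def isingExponent {n : ℕ} (A : Matrix (Fin n) (Fin n) ℝ) (θ : Fin n → ℝ) (z : Fin n → Bool) : ℝ :=
  (∑ i, ∑ j, if i < j then A i j * spin (z i) * spin (z j) else 0) + ∑ i, θ i * spin (z i)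

/-- The normalizing factor. -/
def partitionFn {n : ℕ} (A : Matrix (Fin n) (Fin n) ℝ) (θ : Fin n → ℝ) : ℝ :=
  ∑ z : Fin n → Bool, Real.exp (isingExponent A θ z)

/-- The Ising model `D(A, θ)` as a measure on spin configurations. -/
def isingLaw {n : ℕ} (A : Matrix (Fin n) (Fin n) ℝ) (θ : Fin n → ℝ) : Measure (Fin n → Bool) :=
  ∑ z : Fin n → Bool,
    ENNReal.ofReal (Real.exp (isingExponent A θ z) / partitionFn A θ) • Measure.dirac z

/-- The dependency graph: `i ~ j` iff `A i j ≠ 0` (for symmetric `A` with zero diagonal). -/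
def depGraph {n : ℕ} (A : Matrix (Fin n) (Fin n) ℝ) : SimpleGraph (Fin n) :=
  SimpleGraph.fromRel fun i j => A i j ≠ 0

/-- An observed entry: `none` is a missing entry, `some b` an observed spin. -/
abbrev Entry : Type := Option Bool

instance instMeasurableSpaceEntry : MeasurableSpace Entry := ⊤

instance instDiscreteMeasurableSpaceEntry : DiscreteMeasurableSpace Entry := ⟨fun _ => trivial⟩

/-- Numerical value of an observed entry, a missing entry being replaced by `0`. -/
def entryVal : Entry → ℝ
  | none => 0
  | some b => spin b

/-- The Bernoulli law on `Bool` with `P(true) = r`. -/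
def bernoulliLaw (r : ℝ) : Measure Bool :=
  ENNReal.ofReal r • Measure.dirac true + ENNReal.ofReal (1 - r) • Measure.dirac false

/-- The law of one corrupted sample: draw `Z ∼ D(A, θ)` and, independently, independent
`C_i ∼ Ber(1 - p_i)`; the entry `Z_i` is observed if `C_i` holds and is missing otherwise. -/
def missLaw {n : ℕ} (A : Matrix (Fin n) (Fin n) ℝ) (θ p : Fin n → ℝ) : Measure (Fin n → Entry) :=
  ((isingLaw A θ).prod (Measure.pi fun i => bernoulliLaw (1 - p i))).map
    fun zc i => if zc.2 i then some (zc.1 i) else none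

/-- The law of `T` independent corrupted samples. -/
def sampleLaw {n : ℕ} (A : Matrix (Fin n) (Fin n) ℝ) (θ p : Fin n → ℝ) (T : ℕ) :
    Measure (Fin T → Fin n → Entry) :=
  Measure.pi fun _ => missLaw A θ p

/-! ### Stochastic multiplicative gradient descent for the neighbourhood of a vertex -/

/-- The vertices other than `u`. -/
abbrev Others {n : ℕ} (u : Fin n) : Type := {j : Fin n // j ≠ u}

/-- The `2 (n - 1) + 1 = 2 n - 1` coordinates of the simplex: a positive and a negative copy of
every vertex other than `u`, and one slack coordinate. -/
inductive Coord {n : ℕ} (u : Fin n) : Type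
  | pos (j : Others u)
  | neg (j : Others u)
  | slack
  deriving DecidableEq, Fintype

/-- The map from the simplex to the `ℓ¹` ball. -/
def simplexToBall {n : ℕ} {u : Fin n} (w : Coord u → ℝ) (j : Others u) : ℝ :=
  w (.pos j) - w (.neg j)

/-- The estimator of the `i`-th partial derivative of the interaction screening objective. -/
def gMiss {n : ℕ} {u : Fin n} (p : Fin n → ℝ) (w : Coord u → ℝ) (x : Fin n → Entry)
    (i : Others u) : ℝ :=
  -(entryVal (x u) / (1 - p u)) *
    (Real.exp (-(simplexToBall w i) * entryVal (x u) * entryVal (x i)) * entryVal (x i) /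
      (1 - p i)) *
    ∏ j ∈ Finset.univ.erase i,
      (Real.exp (-(simplexToBall w j) * entryVal (x u) * entryVal (x j)) - p j) / (1 - p j)

/-- The gradient estimator on the simplex. -/
def GMiss {n : ℕ} {u : Fin n} (p : Fin n → ℝ) (w : Coord u → ℝ) (x : Fin n → Entry) :
    Coord u → ℝ
  | .pos i => gMiss p w x i
  | .neg i => -gMiss p w x i
  | .slack => 0

/-- One multiplicative update, with `l1` bound `lam` and step size `η`. -/
def smgStep {n : ℕ} {u : Fin n} (p : Fin n → ℝ) (lam η : ℝ) (w : Coord u → ℝ)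
    (x : Fin n → Entry) (c : Coord u) : ℝ :=
  w c * (1 - η * GMiss p w x c + η * ((∑ d, w d * GMiss p w x d) / lam))

/-- The iterates; `smgIter … t` is the iterate after `t` updates (so index `0` is the uniform
starting point), and it uses the first `t` samples. -/
def smgIter {n T : ℕ} (u : Fin n) (p : Fin n → ℝ) (lam η : ℝ) (X : Fin T → Fin n → Entry) :
    ℕ → Coord u → ℝ
  | 0 => fun _ => lam / (2 * (n : ℝ) - 1)
  | t + 1 =>
    if h : t < T then smgStep p lam η (smgIter u p lam η X t) (X ⟨t, h⟩)
    else smgIter u p lam η X t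

/-- The output of the algorithm: the average of the first `T` iterates. -/
def smgOutput {n T : ℕ} (u : Fin n) (p : Fin n → ℝ) (lam η : ℝ) (X : Fin T → Fin n → Entry)
    (c : Coord u) : ℝ :=
  (∑ t ∈ Finset.range T, smgIter u p lam η X t c) / T

/-- The sup-norm bound for the gradient estimator, for missing probabilities at most `q`. -/
def gradBound (q lam : ℝ) : ℝ := Real.exp (lam / (1 - q)) / (1 - q) ^ 2

/-- The step size `min (1 / (8 B)) ((1 / (2 B)) √(log (2 n - 1) / T))`. -/
def stepSize (q lam : ℝ) (n T : ℕ) : ℝ :=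
  min (1 / (8 * gradBound q lam))
    (1 / (2 * gradBound q lam) * Real.sqrt (Real.log (2 * (n : ℝ) - 1) / T))

/-- The estimated neighbourhood of `u`: threshold the estimated weights at `β / 2`. -/
def estNeighbors {n T : ℕ} (p : Fin n → ℝ) (lam η β : ℝ) (X : Fin T → Fin n → Entry)
    (u : Fin n) : Set (Fin n) :=
  {i | ∃ h : i ≠ u, β / 2 ≤ |simplexToBall (smgOutput u p lam η X) ⟨i, h⟩|}

/-! ### Numbers of samples -/

/-- `lam⁴ · L · exp (C lam) · ε⁻⁴`. -/
def sampleBound (C lam L ε : ℝ) : ℝ := lam ^ 4 * L * Real.exp (C * lam) * (ε ^ 4)⁻¹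

/-- `K · lam² (1 + lam)² / (1 - q)⁴ · exp ((2 / (1 - q) + 6) lam) · L · ε⁻⁴`. -/
def explicitBound (K q lam L ε : ℝ) : ℝ :=
  K * (lam ^ 2 * (1 + lam) ^ 2 / (1 - q) ^ 4) * Real.exp ((2 / (1 - q) + 6) * lam) * L * (ε ^ 4)⁻¹

/-! ### A real random access machine with a step count -/

/-- Memory: index registers holding natural numbers, and two-dimensional real arrays
(`mem a i j` is the entry `(i, j)` of the array with name `a`). -/
structure RAMState where
  idx : ℕ → ℕ
  mem : ℕ → ℕ → ℕ → ℝ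

/-- A reference to an array entry: the name of the array and the names of the two index registers
that hold the row and the column. -/
structure Ref where
  arr : ℕ
  row : ℕ
  col : ℕ

/-- The binary arithmetic operations on real numbers. -/
inductive ArithOp
  | add
  | sub
  | mul
  | div

def ArithOp.eval : ArithOp → ℝ → ℝ → ℝ
  | .add, x, y => x + y
  | .sub, x, y => x - y
  | .mul, x, y => x * y
  | .div, x, y => x / y

/-- Programs. Every program is a fixed finite text; it does not depend on the size of the input. -/
inductive Prog
  | skip
  | seq (P Q : Prog)
  /-- set an index register to a constant, copy it, increase it or decrease it by one -/
  | idxConst (r k : ℕ)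
  | idxCopy (r s : ℕ)
  | idxSucc (r : ℕ)
  | idxPred (r : ℕ)
  /-- real assignments: an integer constant, a copy, an arithmetic operation, an exponential -/
  | const (d : Ref) (k : ℤ)
  | copy (d a : Ref)
  | arith (o : ArithOp) (d a b : Ref)
  | exp (d a : Ref)
  /-- branch on a strict comparison of two index registers -/
  | ifLt (r s : ℕ) (P Q : Prog)
  /-- branch on a comparison `a ≤ b` of two real numbers -/
  | ifLe (a b : Ref) (P Q : Prog)
  /-- for `r = 0, 1, …, s - 1` do `P`; the number of rounds is read off register `s` at the start -/
  | loop (r s : ℕ) (P : Prog)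

namespace RAMState

def get (σ : RAMState) (a : Ref) : ℝ := σ.mem a.arr (σ.idx a.row) (σ.idx a.col)

def setIdx (σ : RAMState) (r k : ℕ) : RAMState := { σ with idx := Function.update σ.idx r k }

def set (σ : RAMState) (d : Ref) (v : ℝ) : RAMState :=
  { σ with
    mem := fun a i j =>
      if a = d.arr ∧ i = σ.idx d.row ∧ j = σ.idx d.col then v else σ.mem a i j }

end RAMState

open Classical in
/-- Execution: the final state and the number of steps. Every elementary instruction, every test
and every round of a loop costs one step (on top of the body). -/
def Prog.exec : Prog → RAMState → RAMState × ℕ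
  | .skip, σ => (σ, 1)
  | .seq P Q, σ => ((Q.exec (P.exec σ).1).1, (P.exec σ).2 + (Q.exec (P.exec σ).1).2)
  | .idxConst r k, σ => (σ.setIdx r k, 1)
  | .idxCopy r s, σ => (σ.setIdx r (σ.idx s), 1)
  | .idxSucc r, σ => (σ.setIdx r (σ.idx r + 1), 1)
  | .idxPred r, σ => (σ.setIdx r (σ.idx r - 1), 1)
  | .const d k, σ => (σ.set d k, 1)
  | .copy d a, σ => (σ.set d (σ.get a), 1)
  | .arith o d a b, σ => (σ.set d (o.eval (σ.get a) (σ.get b)), 1)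
  | .exp d a, σ => (σ.set d (Real.exp (σ.get a)), 1)
  | .ifLt r s P Q, σ =>
    if σ.idx r < σ.idx s then ((P.exec σ).1, (P.exec σ).2 + 1)
    else ((Q.exec σ).1, (Q.exec σ).2 + 1)
  | .ifLe a b P Q, σ =>
    if σ.get a ≤ σ.get b then ((P.exec σ).1, (P.exec σ).2 + 1)
    else ((Q.exec σ).1, (Q.exec σ).2 + 1)
  | .loop r s P, σ =>
    Nat.rec (σ, 1)
      (fun k τ => ((P.exec (τ.1.setIdx r k)).1, τ.2 + (P.exec (τ.1.setIdx r k)).2 + 1))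
      (σ.idx s)

/-- The initial state. Registers `0` and `1` hold `n` and `T`; array `0` holds the parameters
`lam, η, β`, array `1` the missing probabilities, array `2` the samples (a missing entry being
coded by `0`); everything else is `0`. -/
def inputState {n T : ℕ} (p : Fin n → ℝ) (lam η β : ℝ) (X : Fin T → Fin n → Entry) : RAMState where
  idx r := if r = 0 then n else if r = 1 then T else 0
  mem a i j :=
    if a = 0 ∧ i = 0 ∧ j = 0 then lam
    else if a = 0 ∧ i = 0 ∧ j = 1 then η
    else if a = 0 ∧ i = 0 ∧ j = 2 then β
    else if h : a = 1 ∧ i = 0 ∧ j < n then p ⟨j, h.2.2⟩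
    else if h : a = 2 ∧ i < T ∧ j < n then entryVal (X ⟨i, h.2.1⟩ ⟨j, h.2.2⟩)
    else 0

/-- The output of a program: the `n × n` array with name `3` in the final state. -/
def Prog.output {n T : ℕ} (P : Prog) (p : Fin n → ℝ) (lam η β : ℝ) (X : Fin T → Fin n → Entry)
    (u i : Fin n) : ℝ :=
  (P.exec (inputState p lam η β X)).1.mem 3 u i

/-- The number of steps of a program. -/
def Prog.steps {n T : ℕ} (P : Prog) (p : Fin n → ℝ) (lam η β : ℝ) (X : Fin T → Fin n → Entry) :
    ℕ :=
  (P.exec (inputState p lam η β X)).2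

end IsingMissing

end

open IsingMissing

noncomputable section

namespace IsingMissing

/-! ### The Ising model at zero field: flips, local fields, and the screening gradient -/

/-! The weights at `u` are the zero of the gradient of the interaction screening objective
$S(v)=E\exp(-Z_u\sum_k v_kZ_k)$. At $v=A_u$, the factor $\exp(-Z_u\langle A_u,Z\rangle)$ cancels the
dependence of the Ising weight on the spin at `u`, so the remaining odd factor $Z_u$ averages to
zero (`sum_spin_mul_exp_eq_zero`). Subtracting this zero writes $\langle v-A_u,\nabla S(v)\rangle$
as a weighted mean of $y(e^y-1)$ with $y=-Z_u\langle v-A_u,Z\rangle$. This is at least a multiple of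
$E\,y^2$, and flipping one spin $i$ shows that $E\,y^2\ge e^{-2\lambda}(v_i-A_{ui})^2$. Hence each
squared error is at most $e^{3\lambda}(1+2\lambda)$ times the pairing
(`sq_le_sum_mul_screeningGrad`).

Erasures are independent and the estimator is a product over vertices whose factors have the right
means, so it is unbiased (`integral_gMiss`). Convexity of the exponential bounds it on the $\ell^1$
ball by $B$, independently of $n$ (`abs_gMiss_le`).

The multiplicative updates have small regret against $A_u$ for the linear losses given by the
sampled gradients (`smg_regret`). An Azuma bound replaces sampled gradients by true ones
(`measureReal_runProcess_ge_le`); the iterate is fixed before its sample is drawn, so the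
differences have conditional mean zero. Monotonicity and Cauchy–Schwarz turn the resulting bound on
the sum of pairings into a bound on the error of the averaged iterate (`recovery_at_vertex`). No
objective values are compared. A union bound over vertices and thresholding give the graph
(`graph_recovery`).

For the running time, prefix and suffix products of the vertex factors yield all gradient
coordinates of one sample in $O(n)$ steps, hence $O(n^2T)$ for all vertices and samples. Program
correctness rests on a syntactic frame rule and a loop invariant rule (`loop_induction`), the step
count on loop lengths that the program never changes (`exec_snd_le_cost`). -/

lemma spin_mul_self (b : Bool) : spin b * spin b = 1 := by cases b <;> simp [spin]

lemma abs_spin (b : Bool) : |spin b| = 1 := by cases b <;> simp [spin]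

lemma spin_not (b : Bool) : spin (!b) = -spin b := by cases b <;> simp [spin]

/-- Flip the spin at `u`. -/
def flip {n : ℕ} (u : Fin n) (z : Fin n → Bool) : Fin n → Bool := Function.update z u (!z u)

lemma flip_flip {n : ℕ} (u : Fin n) (z : Fin n → Bool) : flip u (flip u z) = z := by
  simp [flip]

lemma flip_involutive {n : ℕ} (u : Fin n) : Function.Involutive (flip u) := flip_flip u

lemma spin_flip_self {n : ℕ} (u : Fin n) (z : Fin n → Bool) :
    spin (flip u z u) = -spin (z u) := by simp [flip, spin_not]

lemma spin_flip_of_ne {n : ℕ} {u j : Fin n} (h : j ≠ u) (z : Fin n → Bool) :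
    spin (flip u z j) = spin (z j) := by simp [flip, h]

lemma sum_flip {n : ℕ} (u : Fin n) (f : (Fin n → Bool) → ℝ) :
    ∑ z, f (flip u z) = ∑ z, f z :=
  Equiv.sum_comp (flip_involutive u).toPerm f

lemma isingExponent_zero_eq {n : ℕ} {A : Matrix (Fin n) (Fin n) ℝ} (hA : A.IsSymm)
    (hd : ∀ i, A i i = 0) (z : Fin n → Bool) :
    2 * isingExponent A 0 z = ∑ i, ∑ j, A i j * spin (z i) * spin (z j) := by
  have hsplit : ∑ i, ∑ j, A i j * spin (z i) * spin (z j) =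
      (∑ i, ∑ j, if i < j then A i j * spin (z i) * spin (z j) else 0) +
        ∑ i, ∑ j, if j < i then A i j * spin (z i) * spin (z j) else 0 := by
    rw [← Finset.sum_add_distrib]
    refine Finset.sum_congr rfl fun i _ => ?_
    rw [← Finset.sum_add_distrib]
    refine Finset.sum_congr rfl fun j _ => ?_
    rcases lt_trichotomy i j with h | h | h
    · simp [h, h.not_gt]
    · simp [h, hd]
    · simp [h, h.not_gt]
  have hswap : (∑ i, ∑ j, if j < i then A i j * spin (z i) * spin (z j) else 0) =
      ∑ i, ∑ j, if i < j then A i j * spin (z i) * spin (z j) else 0 := by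
    rw [Finset.sum_comm]
    refine Finset.sum_congr rfl fun i _ => Finset.sum_congr rfl fun j _ => ?_
    rw [hA.apply i j, mul_right_comm]
  rw [hsplit, hswap]
  simp [isingExponent, two_mul]

/-- In the symmetrized double sum only terms with exactly one index equal to `u` change sign; the
row and the column of `u` contribute equally. -/
lemma isingExponent_sub_flip {n : ℕ} {A : Matrix (Fin n) (Fin n) ℝ} (hA : A.IsSymm)
    (hd : ∀ i, A i i = 0) (u : Fin n) (z : Fin n → Bool) :
    isingExponent A 0 z - isingExponent A 0 (flip u z) =
      2 * (spin (z u) * ∑ j, A u j * spin (z j)) := by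
  have key : ∀ i j, A i j * spin (z i) * spin (z j) -
      A i j * spin (flip u z i) * spin (flip u z j) =
      (if i = u then 2 * (spin (z u) * (A u j * spin (z j))) else 0) +
        (if j = u then 2 * (spin (z u) * (A u i * spin (z i))) else 0) := by
    intro i j
    by_cases hi : i = u <;> by_cases hj : j = u
    · subst hi; subst hj; simp [hd]
    · subst hi; simp only [spin_flip_self, spin_flip_of_ne hj, hj, if_true, if_false]; ring
    · subst hj; simp only [spin_flip_self, spin_flip_of_ne hi, hi, if_true, if_false]
      rw [hA.apply j i]; ring
    · simp [spin_flip_of_ne hi, spin_flip_of_ne hj, hi, hj]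
  have h : 2 * (isingExponent A 0 z - isingExponent A 0 (flip u z)) =
      2 * (2 * (spin (z u) * ∑ j, A u j * spin (z j))) := by
    rw [mul_sub, isingExponent_zero_eq hA hd, isingExponent_zero_eq hA hd,
      ← Finset.sum_sub_distrib]
    simp_rw [← Finset.sum_sub_distrib, key, Finset.sum_add_distrib]
    rw [Finset.sum_comm]
    simp only [Finset.sum_ite_eq', Finset.mem_univ, if_true, ← Finset.mul_sum]
    ring
  linarith

/-- The probability of a configuration. -/
def isingWeight {n : ℕ} (A : Matrix (Fin n) (Fin n) ℝ) (z : Fin n → Bool) : ℝ :=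
  Real.exp (isingExponent A 0 z) / partitionFn A 0

lemma partitionFn_pos {n : ℕ} (A : Matrix (Fin n) (Fin n) ℝ) (θ : Fin n → ℝ) :
    0 < partitionFn A θ :=
  Finset.sum_pos (fun _ _ => Real.exp_pos _) Finset.univ_nonempty

lemma isingWeight_pos {n : ℕ} (A : Matrix (Fin n) (Fin n) ℝ) (z : Fin n → Bool) :
    0 < isingWeight A z := div_pos (Real.exp_pos _) (partitionFn_pos _ _)

lemma sum_isingWeight {n : ℕ} (A : Matrix (Fin n) (Fin n) ℝ) : ∑ z, isingWeight A z = 1 := by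
  simp only [isingWeight]
  rw [← Finset.sum_div]
  exact div_self (partitionFn_pos A 0).ne'

lemma isingWeight_flip {n : ℕ} {A : Matrix (Fin n) (Fin n) ℝ} (hA : A.IsSymm)
    (hd : ∀ i, A i i = 0) (u : Fin n) (z : Fin n → Bool) :
    isingWeight A z =
      isingWeight A (flip u z) * Real.exp (2 * (spin (z u) * ∑ j, A u j * spin (z j))) := by
  rw [← isingExponent_sub_flip hA hd, isingWeight, isingWeight, div_mul_eq_mul_div,
    ← Real.exp_add]
  congr 2
  ring

lemma abs_sum_mul_spin_le {ι : Type*} [Fintype ι] (a : ι → ℝ) (s : ι → Bool) :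
    |∑ j, a j * spin (s j)| ≤ ∑ j, |a j| :=
  (Finset.abs_sum_le_sum_abs _ _).trans_eq (by simp [abs_mul, abs_spin])

/-- The local field at `u` is at most `lam` in absolute value, so one flip changes the weight by a
factor within $e^{\pm2\lambda}$. -/
lemma isingWeight_ge_flip {n : ℕ} {A : Matrix (Fin n) (Fin n) ℝ} (hA : A.IsSymm)
    (hd : ∀ i, A i i = 0) {lam : ℝ} (hl : ∀ i, ∑ j, |A i j| ≤ lam) (u : Fin n)
    (z : Fin n → Bool) :
    Real.exp (-2 * lam) * isingWeight A (flip u z) ≤ isingWeight A z := by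
  rw [isingWeight_flip hA hd u z, mul_comm]
  refine mul_le_mul_of_nonneg_left (Real.exp_le_exp.2 ?_) (isingWeight_pos _ _).le
  have h : |spin (z u) * ∑ j, A u j * spin (z j)| ≤ lam := by
    rw [abs_mul, abs_spin, one_mul]
    exact (abs_sum_mul_spin_le _ _).trans (hl u)
  linarith [(abs_le.1 h).1]

/-- Anti-concentration: a linear form with a large coefficient has a large second moment. -/
lemma sq_le_second_moment {n : ℕ} {A : Matrix (Fin n) (Fin n) ℝ} (hA : A.IsSymm)
    (hd : ∀ i, A i i = 0) {lam : ℝ} (hlam : 0 ≤ lam) (hl : ∀ i, ∑ j, |A i j| ≤ lam) {u : Fin n}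
    (d : Others u → ℝ) (i : Others u) :
    Real.exp (-2 * lam) * d i ^ 2 ≤
      ∑ z, isingWeight A z * (∑ j : Others u, d j * spin (z j)) ^ 2 := by
  set q : (Fin n → Bool) → ℝ := fun z => ∑ j : Others u, d j * spin (z j) with hq
  have hdiff : ∀ z, q z - q (flip i z) = 2 * d i * spin (z i) := by
    intro z
    simp only [hq]
    rw [← Finset.sum_sub_distrib, Finset.sum_eq_single i]
    · rw [spin_flip_self]; ring
    · intro j _ hj
      rw [spin_flip_of_ne (fun h => hj (Subtype.ext h))]; ring
    · simp
  have hpt : ∀ z, Real.exp (-2 * lam) * d i ^ 2 * (isingWeight A z + isingWeight A (flip i z)) ≤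
      isingWeight A z * q z ^ 2 + isingWeight A (flip i z) * q (flip i z) ^ 2 := by
    intro z
    have h1 := isingWeight_ge_flip hA hd hl i z
    have h2 := isingWeight_ge_flip hA hd hl i (flip i z)
    rw [flip_flip] at h2
    have hw := isingWeight_pos A z
    have hw' := isingWeight_pos A (flip i z)
    have he : Real.exp (-2 * lam) ≤ 1 := Real.exp_le_one_iff.2 (by linarith)
    have he0 := Real.exp_pos (-2 * lam)
    set e := Real.exp (-2 * lam)
    set W := isingWeight A z
    set W' := isingWeight A (flip i z)
    -- Each of the two weights is at least `e` times the other, and `e ≤ 1`.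
    have g1 : e * (W + W') / 2 ≤ W := by nlinarith
    have g2 : e * (W + W') / 2 ≤ W' := by nlinarith
    -- The two values of the form differ by `±2 d i`, so they cannot both be small.
    have hs : 2 * d i ^ 2 ≤ q z ^ 2 + q (flip i z) ^ 2 := by
      have h3 : (q z - q (flip i z)) ^ 2 = 4 * d i ^ 2 := by
        rw [hdiff]
        linear_combination (4 * d i ^ 2) * spin_mul_self (z i)
      nlinarith [sq_nonneg (q z + q (flip i z))]
    calc e * d i ^ 2 * (W + W') = e * (W + W') / 2 * (2 * d i ^ 2) := by ring
      _ ≤ e * (W + W') / 2 * (q z ^ 2 + q (flip i z) ^ 2) :=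
        mul_le_mul_of_nonneg_left hs (by positivity)
      _ ≤ _ := by
        rw [mul_add]
        exact add_le_add (mul_le_mul_of_nonneg_right g1 (sq_nonneg _))
          (mul_le_mul_of_nonneg_right g2 (sq_nonneg _))
  have hsum := Finset.sum_le_sum fun z (_ : z ∈ Finset.univ) => hpt z
  rw [← Finset.mul_sum, Finset.sum_add_distrib, Finset.sum_add_distrib,
    sum_flip i.1 (isingWeight A), sum_flip i.1 (fun z => isingWeight A z * q z ^ 2),
    sum_isingWeight] at hsum
  linarith

/-- The gradient of the interaction screening objective
`v ↦ E[exp (-z_u ∑ k, v_k z_k)]`. -/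
def screeningGrad {n : ℕ} (A : Matrix (Fin n) (Fin n) ℝ) {u : Fin n} (v : Others u → ℝ)
    (i : Others u) : ℝ :=
  ∑ z, isingWeight A z *
    (-spin (z u) * spin (z i) * Real.exp (-spin (z u) * ∑ k : Others u, v k * spin (z k)))

lemma sum_others {n : ℕ} {u : Fin n} (f : Fin n → ℝ) (hf : f u = 0) :
    ∑ j : Others u, f j = ∑ j, f j := by
  rw [Fintype.sum_eq_add_sum_subtype_ne f u, hf, zero_add]

/-- The screening gradient vanishes at the true weights. -/
lemma sum_spin_mul_exp_eq_zero {n : ℕ} {A : Matrix (Fin n) (Fin n) ℝ} (hA : A.IsSymm)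
    (hd : ∀ i, A i i = 0) {u : Fin n} (d : Others u → ℝ) :
    ∑ z, isingWeight A z * (Real.exp (-spin (z u) * ∑ k : Others u, A u k * spin (z k)) *
      (-spin (z u) * ∑ k : Others u, d k * spin (z k))) = 0 := by
  set F : (Fin n → Bool) → ℝ := fun z => isingWeight A z *
    (Real.exp (-spin (z u) * ∑ k : Others u, A u k * spin (z k)) *
      (-spin (z u) * ∑ k : Others u, d k * spin (z k))) with hF
  -- The change of the weight under the flip is compensated exactly by the exponential; only the
  -- sign of the linear factor remains.
  have h : ∀ z, F (flip u z) = -F z := by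
    intro z
    have hlin : ∀ c : Others u → ℝ, ∑ k : Others u, c k * spin (flip u z k) =
        ∑ k : Others u, c k * spin (z k) := fun c =>
      Finset.sum_congr rfl fun k _ => by rw [spin_flip_of_ne k.2]
    have hs : ∑ j, A u j * spin (z j) = ∑ k : Others u, A u k * spin (z k) :=
      (sum_others (fun j => A u j * spin (z j)) (by simp [hd])).symm
    simp only [hF]
    rw [isingWeight_flip hA hd u z, hs, hlin d, hlin (fun k => A u k), spin_flip_self]
    set S := ∑ k : Others u, A u k * spin (z k)
    have : Real.exp (- -spin (z u) * S) =
        Real.exp (2 * (spin (z u) * S)) * Real.exp (-spin (z u) * S) := by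
      rw [← Real.exp_add]; congr 1; ring
    rw [this]; ring
  have h2 := sum_flip u F
  simp only [h, Finset.sum_neg_distrib] at h2
  linarith

/-- For $y\ge0$ use $e^y-1\ge y$; for $y<0$ use $1-e^y\ge 1-\frac1{1+|y|}$. The denominator is
linear in $|y|$, so monotonicity loses only $1+2\lambda$ here and no further exponential. -/
lemma sq_div_le_mul_exp_sub_one (y : ℝ) : y ^ 2 / (1 + |y|) ≤ y * (Real.exp y - 1) := by
  rcases le_total 0 y with hy | hy
  · rw [abs_of_nonneg hy, div_le_iff₀ (by linarith)]
    have h1 := Real.add_one_le_exp y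
    have h2 : y * y ≤ y * (Real.exp y - 1) := mul_le_mul_of_nonneg_left (by linarith) hy
    nlinarith
  · rw [abs_of_nonpos hy, div_le_iff₀ (by linarith)]
    have h1 := Real.add_one_le_exp (-y)
    have h2 : Real.exp y * (1 + -y) ≤ 1 := by
      calc Real.exp y * (1 + -y) ≤ Real.exp y * Real.exp (-y) :=
            mul_le_mul_of_nonneg_left (by linarith) (Real.exp_pos y).le
        _ = 1 := by rw [← Real.exp_add]; simp
    nlinarith [mul_nonneg (neg_nonneg.2 hy) (sub_nonneg.2 h2)]

/-- Strong monotonicity of the screening gradient around the true weights. -/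
theorem sq_le_sum_mul_screeningGrad {n : ℕ} {A : Matrix (Fin n) (Fin n) ℝ} (hA : A.IsSymm)
    (hd : ∀ i, A i i = 0) {lam : ℝ} (hlam : 0 ≤ lam) (hl : ∀ i, ∑ j, |A i j| ≤ lam) {u : Fin n}
    (v : Others u → ℝ) (hv : ∑ j, |v j| ≤ lam) (i : Others u) :
    Real.exp (-3 * lam) / (1 + 2 * lam) * (v i - A u i) ^ 2 ≤
      ∑ j : Others u, (v j - A u j) * screeningGrad A v j := by
  set d : Others u → ℝ := fun j => v j - A u j with hdd
  have ha : ∑ j : Others u, |A u j| ≤ lam := by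
    rw [sum_others (fun j => |A u j|) (by simp [hd])]; exact hl u
  have hdl : ∑ j, |d j| ≤ 2 * lam := by
    calc ∑ j, |d j| ≤ ∑ j : Others u, (|v j| + |A u j|) :=
          Finset.sum_le_sum fun j _ => abs_sub _ _
      _ ≤ 2 * lam := by rw [Finset.sum_add_distrib]; linarith
  -- Subtract the vanishing pairing at the true weights and split the exponent along `v = A u + d`.
  have hrew : ∑ j : Others u, d j * screeningGrad A v j =
      ∑ z, isingWeight A z * (Real.exp (-spin (z u) * ∑ k : Others u, A u k * spin (z k)) *
        ((-spin (z u) * ∑ k : Others u, d k * spin (z k)) *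
          (Real.exp (-spin (z u) * ∑ k : Others u, d k * spin (z k)) - 1))) := by
    have h0 := sum_spin_mul_exp_eq_zero hA hd d
    rw [← sub_zero (∑ j : Others u, d j * screeningGrad A v j), ← h0]
    simp only [screeningGrad, Finset.mul_sum (s := (Finset.univ : Finset (Fin n → Bool)))]
    rw [Finset.sum_comm, ← Finset.sum_sub_distrib]
    refine Finset.sum_congr rfl fun z _ => ?_
    have hsplit : ∑ k : Others u, v k * spin (z k) =
        ∑ k : Others u, A u k * spin (z k) + ∑ k : Others u, d k * spin (z k) := by
      rw [← Finset.sum_add_distrib]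
      exact Finset.sum_congr rfl fun k _ => by simp only [hdd]; ring
    have hfac : ∑ j : Others u, d j * (isingWeight A z * (-spin (z u) * spin (z j) *
        Real.exp (-spin (z u) * ∑ k : Others u, v k * spin (z k)))) =
        isingWeight A z * ((-spin (z u) * ∑ k : Others u, d k * spin (z k)) *
          Real.exp (-spin (z u) * ∑ k : Others u, v k * spin (z k))) := by
      simp only [Finset.mul_sum, Finset.sum_mul]
      exact Finset.sum_congr rfl fun j _ => by ring
    rw [hfac, hsplit, mul_add, Real.exp_add]
    ring
  rw [hrew]
  have h2 := sq_le_second_moment hA hd hlam hl d i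
  have hpos : 0 < 1 + 2 * lam := by linarith
  calc Real.exp (-3 * lam) / (1 + 2 * lam) * d i ^ 2
      = Real.exp (-lam) / (1 + 2 * lam) * (Real.exp (-2 * lam) * d i ^ 2) := by
        rw [show -3 * lam = -lam + -2 * lam by ring, Real.exp_add]; ring
    _ ≤ Real.exp (-lam) / (1 + 2 * lam) *
        ∑ z, isingWeight A z * (∑ j : Others u, d j * spin (z j)) ^ 2 :=
        mul_le_mul_of_nonneg_left h2 (by positivity)
    _ ≤ _ := by
        rw [Finset.mul_sum]
        refine Finset.sum_le_sum fun z _ => ?_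
        have hy : |-spin (z u) * ∑ k : Others u, d k * spin (z k)| ≤ 2 * lam := by
          rw [abs_mul, abs_neg, abs_spin, one_mul]
          exact (abs_sum_mul_spin_le d fun j => z j).trans hdl
        have hysq : (-spin (z u) * ∑ k : Others u, d k * spin (z k)) ^ 2 =
            (∑ k : Others u, d k * spin (z k)) ^ 2 := by
          linear_combination (∑ k : Others u, d k * spin (z k)) ^ 2 * spin_mul_self (z u)
        have he : Real.exp (-lam) ≤
            Real.exp (-spin (z u) * ∑ k : Others u, A u k * spin (z k)) := by
          refine Real.exp_le_exp.2 (abs_le.1 ?_).1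
          rw [abs_mul, abs_neg, abs_spin, one_mul]
          exact (abs_sum_mul_spin_le (fun j : Others u => A u j) fun j => z j).trans ha
        rw [← hysq]
        set y := -spin (z u) * ∑ k : Others u, d k * spin (z k)
        have hq : y ^ 2 / (1 + 2 * lam) ≤ y * (Real.exp y - 1) :=
          (div_le_div_of_nonneg_left (sq_nonneg y) (by positivity) (by linarith)).trans
            (sq_div_le_mul_exp_sub_one y)
        have hq0 : 0 ≤ y ^ 2 / (1 + 2 * lam) := by positivity
        calc Real.exp (-lam) / (1 + 2 * lam) * (isingWeight A z * y ^ 2)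
            = isingWeight A z * (Real.exp (-lam) * (y ^ 2 / (1 + 2 * lam))) := by ring
          _ ≤ _ := mul_le_mul_of_nonneg_left
            (mul_le_mul he hq hq0 (Real.exp_pos _).le) (isingWeight_pos _ _).le

/-! ### The law of a corrupted sample and the gradient estimator -/

lemma isingLaw_zero_eq {n : ℕ} (A : Matrix (Fin n) (Fin n) ℝ) :
    isingLaw A 0 = ∑ z, ENNReal.ofReal (isingWeight A z) • Measure.dirac z := rfl

instance isProbabilityMeasure_isingLaw {n : ℕ} (A : Matrix (Fin n) (Fin n) ℝ) :
    IsProbabilityMeasure (isingLaw A 0) := by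
  refine ⟨?_⟩
  simp only [isingLaw_zero_eq, Measure.coe_finsetSum, Finset.sum_apply, Measure.smul_apply,
    measure_univ, smul_eq_mul, mul_one]
  rw [← ENNReal.ofReal_sum_of_nonneg fun z _ => (isingWeight_pos A z).le, sum_isingWeight,
    ENNReal.ofReal_one]

lemma integral_isingLaw {n : ℕ} (A : Matrix (Fin n) (Fin n) ℝ) (f : (Fin n → Bool) → ℝ) :
    ∫ z, f z ∂isingLaw A 0 = ∑ z, isingWeight A z * f z := by
  rw [isingLaw_zero_eq, integral_finsetSum_measure fun z _ =>
    (integrable_dirac (by simp)).smul_measure ENNReal.ofReal_ne_top]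
  refine Finset.sum_congr rfl fun z _ => ?_
  rw [integral_smul_measure, integral_dirac, ENNReal.toReal_ofReal (isingWeight_pos A z).le,
    smul_eq_mul]

lemma isProbabilityMeasure_bernoulliLaw {r : ℝ} (h0 : 0 ≤ r) (h1 : r ≤ 1) :
    IsProbabilityMeasure (bernoulliLaw r) := by
  refine ⟨?_⟩
  simp only [bernoulliLaw, Measure.add_apply, Measure.smul_apply, measure_univ, smul_eq_mul,
    mul_one]
  rw [← ENNReal.ofReal_add h0 (by linarith)]
  simp

lemma integral_bernoulliLaw {r : ℝ} (h0 : 0 ≤ r) (h1 : r ≤ 1) (f : Bool → ℝ) :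
    ∫ b, f b ∂bernoulliLaw r = r * f true + (1 - r) * f false := by
  rw [bernoulliLaw, integral_add_measure
    ((integrable_dirac (by simp)).smul_measure ENNReal.ofReal_ne_top)
    ((integrable_dirac (by simp)).smul_measure ENNReal.ofReal_ne_top)]
  rw [integral_smul_measure, integral_smul_measure, integral_dirac, integral_dirac,
    ENNReal.toReal_ofReal h0, ENNReal.toReal_ofReal (by linarith)]
  simp

lemma isProbabilityMeasure_missLaw {n : ℕ} (A : Matrix (Fin n) (Fin n) ℝ) {p : Fin n → ℝ}
    (hp : ∀ i, 0 ≤ p i ∧ p i ≤ 1) : IsProbabilityMeasure (missLaw A 0 p) := by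
  have : ∀ i, IsProbabilityMeasure (bernoulliLaw (1 - p i)) := fun i =>
    isProbabilityMeasure_bernoulliLaw (by linarith [hp i]) (by linarith [hp i])
  exact Measure.isProbabilityMeasure_map (Measurable.of_discrete).aemeasurable

lemma integral_missLaw {n : ℕ} (A : Matrix (Fin n) (Fin n) ℝ) {p : Fin n → ℝ}
    (hp : ∀ i, 0 ≤ p i ∧ p i ≤ 1) (f : (Fin n → Entry) → ℝ) :
    ∫ x, f x ∂missLaw A 0 p = ∑ z, isingWeight A z *
      ∫ c, f (fun i => if c i then some (z i) else none)
        ∂Measure.pi fun i => bernoulliLaw (1 - p i) := by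
  have : ∀ i, IsProbabilityMeasure (bernoulliLaw (1 - p i)) := fun i =>
    isProbabilityMeasure_bernoulliLaw (by linarith [hp i]) (by linarith [hp i])
  rw [missLaw, integral_map (Measurable.of_discrete).aemeasurable
    (Measurable.of_discrete).aestronglyMeasurable, integral_prod _ Integrable.of_finite,
    integral_isingLaw]

/-- The estimator, for the erasure pattern `c`, is a product of one factor for every vertex. -/
def gMissFactor {n : ℕ} {u : Fin n} (p : Fin n → ℝ) (w : Coord u → ℝ) (z : Fin n → Bool)
    (i : Others u) (k : Fin n) (c : Bool) : ℝ :=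
  if hk : k = u then if c then -(spin (z u) / (1 - p u)) else 0
  else if k = i then
    if c then Real.exp (-(simplexToBall w i) * spin (z u) * spin (z i)) * spin (z i) / (1 - p i)
    else 0
  else if c then
    (Real.exp (-(simplexToBall w ⟨k, hk⟩) * spin (z u) * spin (z k)) - p k) / (1 - p k)
  else 1

lemma gMissFactor_self {n : ℕ} {u : Fin n} (p : Fin n → ℝ) (w : Coord u → ℝ) (z : Fin n → Bool)
    (i : Others u) (c : Bool) :
    gMissFactor p w z i u c = if c then -(spin (z u) / (1 - p u)) else 0 := by
  simp [gMissFactor]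

lemma gMissFactor_coord {n : ℕ} {u : Fin n} (p : Fin n → ℝ) (w : Coord u → ℝ) (z : Fin n → Bool)
    (i : Others u) (c : Bool) :
    gMissFactor p w z i i c = if c then
      Real.exp (-(simplexToBall w i) * spin (z u) * spin (z i)) * spin (z i) / (1 - p i)
    else 0 := by
  simp [gMissFactor, i.2]

lemma gMissFactor_of_ne {n : ℕ} {u : Fin n} (p : Fin n → ℝ) (w : Coord u → ℝ) (z : Fin n → Bool)
    {i j : Others u} (h : j ≠ i) (c : Bool) :
    gMissFactor p w z i j c = if c then
      (Real.exp (-(simplexToBall w j) * spin (z u) * spin (z j)) - p j) / (1 - p j) else 1 := by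
  have : (j : Fin n) ≠ i := fun e => h (Subtype.ext e)
  simp [gMissFactor, j.2, this]

lemma prod_univ_eq_mul_mul_prod_erase {n : ℕ} {u : Fin n} (f : Fin n → ℝ) (i : Others u) :
    ∏ k, f k = f u * f i * ∏ j ∈ Finset.univ.erase i, f (j : Others u) := by
  rw [Fintype.prod_eq_mul_prod_subtype_ne f u, mul_assoc,
    Finset.mul_prod_erase Finset.univ (fun j : Others u => f j) (Finset.mem_univ i)]

/-- A hidden entry has value `0`: at `u` or `i` this kills the product, elsewhere the factor becomes
$(1-p)/(1-p)=1$. The product form in the erasure pattern is what allows the expectation to factor.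
-/
lemma gMiss_mask {n : ℕ} {u : Fin n} {p : Fin n → ℝ} (hp : ∀ i, p i < 1) (w : Coord u → ℝ)
    (z c : Fin n → Bool) (i : Others u) :
    gMiss p w (fun i => if c i then some (z i) else none) i =
      ∏ k, gMissFactor p w z i k (c k) := by
  rw [prod_univ_eq_mul_mul_prod_erase _ i, gMissFactor_self, gMissFactor_coord, gMiss]
  by_cases hu : c u
  · have hprod : ∏ j ∈ Finset.univ.erase i, gMissFactor p w z i (j : Others u) (c j) =
        ∏ j ∈ Finset.univ.erase i,
          (Real.exp (-(simplexToBall w j) * spin (z u) *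
            entryVal (if c j then some (z j) else none)) - p j) / (1 - p j) := by
      refine Finset.prod_congr rfl fun j hj => ?_
      rw [gMissFactor_of_ne p w z (Finset.ne_of_mem_erase hj)]
      by_cases hc : c j
      · simp [hc, entryVal]
      · simp [hc, entryVal, div_self (sub_pos.2 (hp j)).ne']
    rw [hprod]
    by_cases hi : c i <;> simp [hu, hi, entryVal]
  · simp [hu, entryVal]

/-- The gradient estimator is unbiased. -/
theorem integral_gMiss {n : ℕ} (A : Matrix (Fin n) (Fin n) ℝ) {p : Fin n → ℝ}
    (hp : ∀ i, 0 ≤ p i ∧ p i < 1) {u : Fin n} (w : Coord u → ℝ) (i : Others u) :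
    ∫ x, gMiss p w x i ∂missLaw A 0 p = screeningGrad A (simplexToBall w) i := by
  have : ∀ i, IsProbabilityMeasure (bernoulliLaw (1 - p i)) := fun i =>
    isProbabilityMeasure_bernoulliLaw (by linarith [hp i]) (by linarith [hp i])
  rw [integral_missLaw A fun i => ⟨(hp i).1, (hp i).2.le⟩, screeningGrad]
  refine Finset.sum_congr rfl fun z _ => ?_
  congr 1
  simp_rw [gMiss_mask (fun i => (hp i).2) w z _ i]
  rw [integral_fintype_prod_eq_prod (fun k c => gMissFactor p w z i k c)]
  simp_rw [integral_bernoulliLaw (sub_nonneg.2 (hp _).2.le) (sub_le_self 1 (hp _).1)]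
  rw [prod_univ_eq_mul_mul_prod_erase _ i]
  have hne : ∀ k, 1 - p k ≠ 0 := fun k => (sub_pos.2 (hp k).2).ne'
  -- The mean of one factor is $(1-p)\frac{e^s-p}{1-p}+p\cdot1=e^s$.
  have hprod : ∏ j ∈ Finset.univ.erase i,
      ((1 - p (j : Others u)) * gMissFactor p w z i (j : Others u) true +
        (1 - (1 - p (j : Others u))) * gMissFactor p w z i (j : Others u) false) =
      ∏ j ∈ Finset.univ.erase i, Real.exp (-spin (z u) * (simplexToBall w j * spin (z j))) := by
    refine Finset.prod_congr rfl fun j hj => ?_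
    rw [gMissFactor_of_ne p w z (Finset.ne_of_mem_erase hj),
      gMissFactor_of_ne p w z (Finset.ne_of_mem_erase hj)]
    simp only [if_true, Bool.false_eq_true, if_false]
    rw [mul_div_cancel₀ _ (hne j)]
    ring_nf
  rw [hprod, gMissFactor_self, gMissFactor_self, gMissFactor_coord, gMissFactor_coord,
    Finset.mul_sum, Real.exp_sum,
    ← Finset.mul_prod_erase Finset.univ _ (Finset.mem_univ i)]
  simp only [if_true, Bool.false_eq_true, if_false, mul_zero, add_zero]
  rw [mul_neg, mul_div_cancel₀ _ (hne u), mul_div_cancel₀ _ (hne i)]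
  ring_nf

lemma abs_entryVal_le (x : Entry) : |entryVal x| ≤ 1 := by
  cases x <;> simp [entryVal, abs_spin]

/-- From $e^t+e^{-t}\ge2\ge2p$ one gets $|e^s-p|\le e^t-p$, and convexity of the exponential between
$0$ and $t/(1-p)$ bounds this by $(1-p)e^{t/(1-p)}$. No constant appears in front, so the product
over all vertices depends only on the $\ell^1$ norm of the weights. -/
lemma abs_exp_sub_div_le {q p s t : ℝ} (hp : 0 ≤ p) (hpq : p ≤ q) (hq : q < 1) (hst : |s| ≤ t) :
    |(Real.exp s - p) / (1 - p)| ≤ Real.exp (t / (1 - q)) := by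
  have h1p : 0 < 1 - p := by linarith
  have h1q : 0 < 1 - q := by linarith
  have ht : 0 ≤ t := (abs_nonneg s).trans hst
  have hup : Real.exp s ≤ Real.exp t := Real.exp_le_exp.2 ((le_abs_self s).trans hst)
  have hlow : Real.exp (-t) ≤ Real.exp s := Real.exp_le_exp.2 (neg_le_of_abs_le hst)
  have hcosh : 2 ≤ Real.exp t + Real.exp (-t) := by
    linarith [Real.one_le_cosh t, Real.cosh_eq t]
  have habs : |Real.exp s - p| ≤ Real.exp t - p := abs_le.2 ⟨by linarith, by linarith⟩
  have hconv : Real.exp t ≤ p + (1 - p) * Real.exp (t / (1 - p)) := by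
    have h := convexOn_exp.2 (Set.mem_univ (0 : ℝ)) (Set.mem_univ (t / (1 - p))) hp h1p.le
      (by ring)
    simp only [smul_eq_mul, mul_zero, zero_add, Real.exp_zero, mul_one] at h
    rwa [mul_div_cancel₀ _ h1p.ne'] at h
  rw [abs_div, abs_of_pos h1p, div_le_iff₀ h1p]
  calc |Real.exp s - p| ≤ (1 - p) * Real.exp (t / (1 - p)) := by linarith
    _ ≤ (1 - p) * Real.exp (t / (1 - q)) := by
      refine mul_le_mul_of_nonneg_left (Real.exp_le_exp.2 ?_) h1p.le
      exact div_le_div_of_nonneg_left ht h1q (by linarith)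
    _ = _ := mul_comm _ _

/-- The sup-norm bound for the estimator on the `ℓ¹` ball. -/
theorem abs_gMiss_le {n : ℕ} {q lam : ℝ} {p : Fin n → ℝ} (hp : ∀ i, 0 ≤ p i ∧ p i ≤ q)
    (hq : q < 1) {u : Fin n} {w : Coord u → ℝ} (hw : ∑ j, |simplexToBall w j| ≤ lam)
    (x : Fin n → Entry) (i : Others u) : |gMiss p w x i| ≤ gradBound q lam := by
  have h1q : 0 < 1 - q := by linarith
  have h1p : ∀ k, 1 - q ≤ 1 - p k := fun k => by linarith [(hp k).2]
  have hexp : ∀ j : Others u,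
      |-(simplexToBall w j) * entryVal (x u) * entryVal (x j)| ≤ |simplexToBall w j| := by
    intro j
    rw [abs_mul, abs_mul, abs_neg, mul_assoc]
    exact mul_le_of_le_one_right (abs_nonneg _)
      (mul_le_one₀ (abs_entryVal_le _) (abs_nonneg _) (abs_entryVal_le _))
  have h1 : |-(entryVal (x u) / (1 - p u))| ≤ 1 / (1 - q) := by
    rw [abs_neg, abs_div, abs_of_pos (h1q.trans_le (h1p u))]
    exact div_le_div₀ zero_le_one (abs_entryVal_le _) h1q (h1p u)
  have h2 : |Real.exp (-(simplexToBall w i) * entryVal (x u) * entryVal (x i)) *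
      entryVal (x i) / (1 - p i)| ≤ Real.exp (|simplexToBall w i| / (1 - q)) / (1 - q) := by
    rw [abs_div, abs_of_pos (h1q.trans_le (h1p i)), abs_mul, abs_of_pos (Real.exp_pos _)]
    refine div_le_div₀ (Real.exp_pos _).le ?_ h1q (h1p i)
    refine (mul_le_of_le_one_right (Real.exp_pos _).le (abs_entryVal_le _)).trans ?_
    refine Real.exp_le_exp.2 ((le_abs_self _).trans ((hexp i).trans ?_))
    exact le_div_self (abs_nonneg _) h1q (by linarith [(hp i).1, (hp i).2])
  have h3 : |∏ j ∈ Finset.univ.erase i,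
      (Real.exp (-(simplexToBall w j) * entryVal (x u) * entryVal (x j)) - p j) / (1 - p j)| ≤
      ∏ j ∈ Finset.univ.erase i, Real.exp (|simplexToBall w j| / (1 - q)) := by
    rw [Finset.abs_prod]
    exact Finset.prod_le_prod (fun _ _ => abs_nonneg _) fun j _ =>
      abs_exp_sub_div_le (hp j).1 (hp j).2 hq (hexp j)
  rw [gMiss, abs_mul, abs_mul]
  calc _ ≤ 1 / (1 - q) * (Real.exp (|simplexToBall w i| / (1 - q)) / (1 - q)) *
        ∏ j ∈ Finset.univ.erase i, Real.exp (|simplexToBall w j| / (1 - q)) :=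
        mul_le_mul (mul_le_mul h1 h2 (abs_nonneg _) (by positivity)) h3 (abs_nonneg _)
          (by positivity)
    _ = Real.exp (∑ j, |simplexToBall w j| / (1 - q)) / (1 - q) ^ 2 := by
        rw [Real.exp_sum, ← Finset.mul_prod_erase Finset.univ _ (Finset.mem_univ i)]
        field_simp
    _ ≤ gradBound q lam := by
        rw [gradBound, ← Finset.sum_div]
        gcongr

/-! ### Regret of the multiplicative updates -/

/-- The coordinates as a disjoint union. -/
def coordEquiv {n : ℕ} (u : Fin n) : (Others u ⊕ Others u) ⊕ Unit ≃ Coord u where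
  toFun
    | .inl (.inl j) => .pos j
    | .inl (.inr j) => .neg j
    | .inr _ => .slack
  invFun
    | .pos j => .inl (.inl j)
    | .neg j => .inl (.inr j)
    | .slack => .inr ()
  left_inv := by rintro ((_ | _) | _) <;> rfl
  right_inv := by rintro (_ | _ | _) <;> rfl

lemma sum_coord {n : ℕ} {u : Fin n} (f : Coord u → ℝ) :
    ∑ c, f c = ∑ j, f (.pos j) + ∑ j, f (.neg j) + f .slack := by
  rw [← (coordEquiv u).sum_comp f, Fintype.sum_sum_type, Fintype.sum_sum_type]
  simp [coordEquiv]

lemma card_coord {n : ℕ} (u : Fin n) : (Fintype.card (Coord u) : ℝ) = 2 * (n : ℝ) - 1 := by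
  have hn : 1 ≤ n := Nat.one_le_of_lt u.2
  rw [← Fintype.card_congr (coordEquiv u), Fintype.card_sum, Fintype.card_sum,
    Fintype.card_subtype_compl, Fintype.card_unit, Fintype.card_fin, Fintype.card_subtype_eq]
  push_cast [hn]
  ring

/-- The interior of the simplex of total mass `lam`. -/
def InSimplex {n : ℕ} {u : Fin n} (lam : ℝ) (w : Coord u → ℝ) : Prop :=
  (∀ c, 0 < w c) ∧ ∑ c, w c = lam

lemma InSimplex.sum_abs_le {n : ℕ} {u : Fin n} {lam : ℝ} {w : Coord u → ℝ}
    (hw : InSimplex lam w) : ∑ j, |simplexToBall w j| ≤ lam := by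
  have h : ∑ j, |simplexToBall w j| ≤ ∑ j, (w (.pos j) + w (.neg j)) :=
    Finset.sum_le_sum fun j _ => by
      rw [simplexToBall, abs_le]
      constructor <;> linarith [hw.1 (.pos j), hw.1 (.neg j)]
  have h2 := sum_coord w
  rw [hw.2] at h2
  rw [Finset.sum_add_distrib] at h
  linarith [hw.1 .slack]

lemma InSimplex.le {n : ℕ} {u : Fin n} {lam : ℝ} {w : Coord u → ℝ}
    (hw : InSimplex lam w) (c : Coord u) : w c ≤ lam := by
  rw [← hw.2]
  exact Finset.single_le_sum (fun d _ => (hw.1 d).le) (Finset.mem_univ c)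

lemma abs_GMiss_le {n : ℕ} {q lam : ℝ} {p : Fin n → ℝ} (hp : ∀ i, 0 ≤ p i ∧ p i ≤ q)
    (hq : q < 1) {u : Fin n} {w : Coord u → ℝ} (hw : InSimplex lam w)
    (x : Fin n → Entry) (c : Coord u) : |GMiss p w x c| ≤ gradBound q lam := by
  cases c with
  | pos i => exact abs_gMiss_le hp hq hw.sum_abs_le x i
  | neg i => simpa [GMiss] using abs_gMiss_le hp hq hw.sum_abs_le x i
  | slack =>
    simp only [GMiss, abs_zero, gradBound]
    positivity

/-- Linear losses on the simplex and on the $\ell^1$ ball agree, because the slack coordinate has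
zero gradient. Regret can therefore be measured on either side. -/
lemma sum_mul_GMiss {n : ℕ} {u : Fin n} (p : Fin n → ℝ) (w y : Coord u → ℝ) (x : Fin n → Entry) :
    ∑ c, y c * GMiss p w x c = ∑ i, simplexToBall y i * gMiss p w x i := by
  rw [sum_coord]
  simp only [GMiss, simplexToBall, sub_mul, Finset.sum_sub_distrib, mul_neg,
    Finset.sum_neg_distrib]
  ring

/-- The average of the gradient estimate with respect to the current weights. -/
lemma abs_mean_GMiss_le {n : ℕ} {q lam : ℝ} (hlam : 0 < lam) {p : Fin n → ℝ}
    (hp : ∀ i, 0 ≤ p i ∧ p i ≤ q) (hq : q < 1) {u : Fin n} {w : Coord u → ℝ}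
    (hw : InSimplex lam w) (x : Fin n → Entry) :
    |(∑ d, w d * GMiss p w x d) / lam| ≤ gradBound q lam := by
  rw [abs_div, abs_of_pos hlam, div_le_iff₀ hlam]
  calc |∑ d, w d * GMiss p w x d| ≤ ∑ d, w d * gradBound q lam := by
        refine (Finset.abs_sum_le_sum_abs _ _).trans (Finset.sum_le_sum fun d _ => ?_)
        rw [abs_mul, abs_of_pos (hw.1 d)]
        exact mul_le_mul_of_nonneg_left (abs_GMiss_le hp hq hw x d) (hw.1 d).le
    _ = gradBound q lam * lam := by rw [← Finset.sum_mul, hw.2, mul_comm]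

lemma abs_step_le {n : ℕ} {q lam η : ℝ} (hlam : 0 < lam) (hη : 0 ≤ η) {p : Fin n → ℝ}
    (hp : ∀ i, 0 ≤ p i ∧ p i ≤ q) (hq : q < 1) {u : Fin n} {w : Coord u → ℝ}
    (hw : InSimplex lam w) (x : Fin n → Entry) (c : Coord u) :
    |η * GMiss p w x c - η * ((∑ d, w d * GMiss p w x d) / lam)| ≤ 2 * (η * gradBound q lam) := by
  rw [← mul_sub, abs_mul, abs_of_nonneg hη]
  have h := (abs_sub (GMiss p w x c) ((∑ d, w d * GMiss p w x d) / lam)).trans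
    (add_le_add (abs_GMiss_le hp hq hw x c) (abs_mean_GMiss_le hlam hp hq hw x))
  calc _ ≤ η * (gradBound q lam + gradBound q lam) := mul_le_mul_of_nonneg_left h hη
    _ = _ := by ring

/-- The relative change is at most $2\eta B\le1/4$, which keeps the weights positive; centring the
gradient by its weighted mean makes the total mass exactly invariant, so no normalization is needed.
-/
lemma smgStep_inSimplex {n : ℕ} {q lam η : ℝ} (hlam : 0 < lam) (hη : 0 ≤ η)
    (hηB : η * gradBound q lam ≤ 1 / 8) {p : Fin n → ℝ}
    (hp : ∀ i, 0 ≤ p i ∧ p i ≤ q) (hq : q < 1) {u : Fin n} {w : Coord u → ℝ}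
    (hw : InSimplex lam w) (x : Fin n → Entry) : InSimplex lam (smgStep p lam η w x) := by
  constructor
  · intro c
    have h := (abs_le.1 (abs_step_le hlam hη hp hq hw x c)).2
    exact mul_pos (hw.1 c) (by linarith)
  · have h : ∀ c, smgStep p lam η w x c = w c - η * (w c * GMiss p w x c) +
        η * ((∑ d, w d * GMiss p w x d) / lam) * w c := fun c => by rw [smgStep]; ring
    simp_rw [h]
    rw [Finset.sum_add_distrib, Finset.sum_sub_distrib, ← Finset.mul_sum, ← Finset.mul_sum, hw.2]
    field_simp
    ring

/-- Apply $\log x\ge1-1/x$ at $x=1-y$ and use $1/(1-y)\le2$. -/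
lemma neg_sub_two_mul_sq_le_log {y : ℝ} (hy : y ≤ 1 / 2) :
    -y - 2 * y ^ 2 ≤ Real.log (1 - y) := by
  have h1 : 0 < 1 - y := by linarith
  refine le_trans ?_ (Real.one_sub_inv_le_log_of_pos h1)
  have h2 : 1 - (1 - y)⁻¹ = -y - y ^ 2 * (1 - y)⁻¹ := by field_simp; ring
  have h3 : (1 - y)⁻¹ ≤ 2 := by
    rw [inv_le_comm₀ h1 two_pos]; linarith
  rw [h2]
  nlinarith [mul_le_mul_of_nonneg_left h3 (sq_nonneg y)]

/-- Progress of the potential `∑ c, y_c log w_c` in one step. -/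
lemma potential_step {n : ℕ} {q lam η : ℝ} (hlam : 0 < lam) (hη : 0 ≤ η)
    (hηB : η * gradBound q lam ≤ 1 / 8) {p : Fin n → ℝ}
    (hp : ∀ i, 0 ≤ p i ∧ p i ≤ q) (hq : q < 1) {u : Fin n} {w y : Coord u → ℝ}
    (hw : InSimplex lam w) (hy : ∀ c, 0 ≤ y c) (hys : ∑ c, y c = lam) (x : Fin n → Entry) :
    η * ∑ i, (simplexToBall w i - simplexToBall y i) * gMiss p w x i ≤
      ∑ c, y c * Real.log (smgStep p lam η w x c) - ∑ c, y c * Real.log (w c) +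
        8 * (η * gradBound q lam) ^ 2 * lam := by
  have hpt : ∀ c, y c * (-(η * GMiss p w x c - η * ((∑ d, w d * GMiss p w x d) / lam)) -
      8 * (η * gradBound q lam) ^ 2) ≤
      y c * Real.log (smgStep p lam η w x c) - y c * Real.log (w c) := by
    intro c
    have habs := abs_step_le hlam hη hp hq hw x c
    have hpos := (smgStep_inSimplex hlam hη hηB hp hq hw x).1 c
    rw [← mul_sub (y c)]
    refine mul_le_mul_of_nonneg_left ?_ (hy c)
    set r := η * GMiss p w x c - η * ((∑ d, w d * GMiss p w x d) / lam) with hr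
    -- The logarithm of the update factor loses at most $2r^2\le 2(2\eta B)^2=8(\eta B)^2$ against
    -- its linear part.
    have hstep : smgStep p lam η w x c = w c * (1 - r) := by rw [smgStep, hr]; ring
    have h1r : 0 < 1 - r := by linarith [(abs_le.1 habs).2]
    rw [hstep, Real.log_mul (hw.1 c).ne' h1r.ne']
    have h2 := neg_sub_two_mul_sq_le_log (y := r) (by linarith [(abs_le.1 habs).2])
    have h3 : r ^ 2 ≤ (2 * (η * gradBound q lam)) ^ 2 :=
      sq_le_sq' (abs_le.1 habs).1 (abs_le.1 habs).2
    nlinarith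
  have hsum := Finset.sum_le_sum fun c (_ : c ∈ Finset.univ) => hpt c
  rw [Finset.sum_sub_distrib] at hsum
  have hl : ∑ c, y c * (-(η * GMiss p w x c - η * ((∑ d, w d * GMiss p w x d) / lam)) -
      8 * (η * gradBound q lam) ^ 2) =
      η * ∑ i, (simplexToBall w i - simplexToBall y i) * gMiss p w x i -
        8 * (η * gradBound q lam) ^ 2 * lam := by
    have : ∀ c, y c * (-(η * GMiss p w x c - η * ((∑ d, w d * GMiss p w x d) / lam)) -
      8 * (η * gradBound q lam) ^ 2) = -η * (y c * GMiss p w x c) +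
        (η * ((∑ d, w d * GMiss p w x d) / lam) - 8 * (η * gradBound q lam) ^ 2) * y c :=
      fun c => by ring
    simp_rw [this]
    rw [Finset.sum_add_distrib, ← Finset.mul_sum, ← Finset.mul_sum, hys, sum_mul_GMiss,
      sum_mul_GMiss]
    simp_rw [sub_mul]
    rw [Finset.sum_sub_distrib]
    field_simp
    ring
  linarith

lemma uniform_inSimplex {n : ℕ} (u : Fin n) {lam : ℝ} (hlam : 0 < lam) :
    InSimplex (u := u) lam fun _ => lam / (2 * (n : ℝ) - 1) := by
  have hn : (1 : ℝ) ≤ n := by exact_mod_cast Nat.one_le_of_lt u.2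
  have hN : 0 < 2 * (n : ℝ) - 1 := by linarith
  refine ⟨fun _ => by positivity, ?_⟩
  rw [Finset.sum_const, Finset.card_univ, nsmul_eq_mul, card_coord]
  field_simp

lemma smgIter_succ {n T : ℕ} (u : Fin n) (p : Fin n → ℝ) (lam η : ℝ) (X : Fin T → Fin n → Entry)
    (t : Fin T) :
    smgIter u p lam η X (t + 1) = smgStep p lam η (smgIter u p lam η X t) (X t) := by
  simp [smgIter]

lemma smgIter_inSimplex {n T : ℕ} {q lam η : ℝ} (hlam : 0 < lam) (hη : 0 ≤ η)
    (hηB : η * gradBound q lam ≤ 1 / 8) {p : Fin n → ℝ}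
    (hp : ∀ i, 0 ≤ p i ∧ p i ≤ q) (hq : q < 1) (u : Fin n) (X : Fin T → Fin n → Entry) (t : ℕ) :
    InSimplex lam (smgIter u p lam η X t) := by
  induction t with
  | zero => exact uniform_inSimplex u hlam
  | succ t ih =>
    by_cases h : t < T
    · simpa [smgIter, h] using smgStep_inSimplex hlam hη hηB hp hq ih (X ⟨t, h⟩)
    · simpa [smgIter, h] using ih

/-- A point of the closed simplex above a point of the `ℓ¹` ball. -/
lemma exists_simplex_lift {n : ℕ} {u : Fin n} {lam : ℝ} (a : Others u → ℝ)
    (ha : ∑ j, |a j| ≤ lam) :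
    ∃ y : Coord u → ℝ, (∀ c, 0 ≤ y c) ∧ ∑ c, y c = lam ∧ simplexToBall y = a := by
  let y : Coord u → ℝ
    | .pos j => max (a j) 0
    | .neg j => max (-a j) 0
    | .slack => lam - ∑ j, |a j|
  refine ⟨y, ?_, ?_, ?_⟩
  · rintro (j | j | _)
    · exact le_max_right _ _
    · exact le_max_right _ _
    · exact sub_nonneg.2 ha
  · rw [sum_coord, ← Finset.sum_add_distrib]
    have : ∑ j, (y (.pos j) + y (.neg j)) = ∑ j, |a j| :=
      Finset.sum_congr rfl fun j _ => by
        change max (a j) 0 + max (-a j) 0 = |a j|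
        rcases le_total 0 (a j) with h | h
        · rw [max_eq_left h, max_eq_right (by linarith), abs_of_nonneg h, add_zero]
        · rw [max_eq_right h, max_eq_left (by linarith), abs_of_nonpos h, zero_add]
    rw [this]
    change _ + (lam - ∑ j, |a j|) = lam
    ring
  · funext j
    change max (a j) 0 - max (-a j) 0 = a j
    rcases le_total 0 (a j) with h | h
    · rw [max_eq_left h, max_eq_right (by linarith), sub_zero]
    · rw [max_eq_right h, max_eq_left (by linarith)]; ring

/-- The regret bound for the iterates. -/
theorem smg_regret {n T : ℕ} {q lam η : ℝ} (hlam : 0 < lam) (hη : 0 ≤ η)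
    (hηB : η * gradBound q lam ≤ 1 / 8) {p : Fin n → ℝ}
    (hp : ∀ i, 0 ≤ p i ∧ p i ≤ q) (hq : q < 1) {u : Fin n} (a : Others u → ℝ)
    (ha : ∑ j, |a j| ≤ lam) (X : Fin T → Fin n → Entry) :
    η * ∑ t : Fin T, ∑ i, (simplexToBall (smgIter u p lam η X t) i - a i) *
        gMiss p (smgIter u p lam η X t) (X t) i ≤
      lam * Real.log (2 * (n : ℝ) - 1) + T * (8 * (η * gradBound q lam) ^ 2 * lam) := by
  -- The comparison point is lifted to the closed simplex; zero coordinates are harmless because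
  -- logarithms are taken only of the iterates.
  obtain ⟨y, hy, hys, rfl⟩ := exists_simplex_lift a ha
  have hS := smgIter_inSimplex (T := T) hlam hη hηB hp hq u X
  set F : ℕ → ℝ := fun t => ∑ c, y c * Real.log (smgIter u p lam η X t c) with hF
  have hstep : ∀ t : Fin T, η * ∑ i, (simplexToBall (smgIter u p lam η X t) i -
      simplexToBall y i) * gMiss p (smgIter u p lam η X t) (X t) i ≤
      F (t + 1) - F t + 8 * (η * gradBound q lam) ^ 2 * lam := by
    intro t
    simp only [hF, smgIter_succ]
    exact potential_step hlam hη hηB hp hq (hS t) hy hys (X t)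
  have hsum := Finset.sum_le_sum fun t (_ : t ∈ Finset.univ) => hstep t
  rw [← Finset.mul_sum, Finset.sum_add_distrib,
    Fin.sum_univ_eq_sum_range (fun t => F (t + 1) - F t) T, Finset.sum_range_sub] at hsum
  rw [Finset.sum_const, Finset.card_univ, Fintype.card_fin, nsmul_eq_mul] at hsum
  have hN : 0 < 2 * (n : ℝ) - 1 := by
    have hn : (1 : ℝ) ≤ n := by exact_mod_cast Nat.one_le_of_lt u.2
    linarith
  -- The final potential is bounded by `w c ≤ lam`, and the initial one is explicit at the uniform
  -- point; their gap is the entropy term $\lambda\log(2n-1)$.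
  have hT : F T ≤ lam * Real.log lam := by
    rw [← hys, Finset.sum_mul, hys]
    exact Finset.sum_le_sum fun c _ => mul_le_mul_of_nonneg_left
      (Real.log_le_log ((hS T).1 c) ((hS T).le c)) (hy c)
  have h0 : F 0 = lam * (Real.log lam - Real.log (2 * (n : ℝ) - 1)) := by
    simp only [hF, smgIter]
    rw [← Finset.sum_mul, hys, Real.log_div hlam.ne' hN.ne']
  rw [h0] at hsum
  linarith

/-! ### Concentration along an adaptive process driven by independent samples -/

/-- The process `w_{t+1} = step w_t (X t)`, stopped when the samples are used up. -/
def runProcess {α W : Type*} (step : W → α → W) {T : ℕ} (X : Fin T → α) (w : W) : ℕ → W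
  | 0 => w
  | t + 1 => if h : t < T then step (runProcess step X w t) (X ⟨t, h⟩) else runProcess step X w t

lemma runProcess_zero {α W : Type*} (step : W → α → W) {T : ℕ} (X : Fin T → α) (w : W) :
    runProcess step X w 0 = w := rfl

/-- The process is defined by appending a last sample; removing the first one instead allows
induction on `T` with a varying starting point. -/
lemma runProcess_cons {α W : Type*} (step : W → α → W) {T : ℕ} (x : α) (X : Fin T → α) (w : W)
    (t : ℕ) :
    runProcess step (Fin.cons x X : Fin (T + 1) → α) w (t + 1) =
      runProcess step X (step w x) t := by
  induction t with
  | zero => simp [runProcess]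
  | succ t ih =>
    rw [runProcess, ih]
    by_cases h : t < T
    · have h' : (⟨t + 1, Nat.succ_lt_succ h⟩ : Fin (T + 1)) = Fin.succ ⟨t, h⟩ := rfl
      rw [dif_pos (Nat.succ_lt_succ h), h', Fin.cons_succ, runProcess, dif_pos h]
    · rw [dif_neg (by omega), runProcess, dif_neg h]

lemma smgIter_eq_runProcess {n T : ℕ} (u : Fin n) (p : Fin n → ℝ) (lam η : ℝ)
    (X : Fin T → Fin n → Entry) (t : ℕ) :
    smgIter u p lam η X t =
      runProcess (smgStep p lam η) X (fun _ => lam / (2 * (n : ℝ) - 1)) t := by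
  induction t with
  | zero => rfl
  | succ t ih => simp only [smgIter, runProcess, ih]

/-- Fix the first sample and apply the induction hypothesis from the point it leads to. The bound is
uniform over starting points satisfying the invariant, so this replaces conditioning on a
filtration. -/
lemma sum_prod_mul_exp_runProcess_le {α W : Type*} [Fintype α] {μ : α → ℝ} (hμ : ∀ x, 0 ≤ μ x)
    {step : W → α → W} {Inv : W → Prop} (hInv : ∀ w x, Inv w → Inv (step w x)) {φ : W → α → ℝ}
    {M : ℝ} (hM : ∀ w, Inv w → ∑ x, μ x * Real.exp (φ w x) ≤ M) (T : ℕ) :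
    ∀ w, Inv w → ∑ X : Fin T → α, (∏ t, μ (X t)) *
      Real.exp (∑ t : Fin T, φ (runProcess step X w t) (X t)) ≤ M ^ T := by
  induction T with
  | zero => intro w _; simp
  | succ T ih =>
    intro w hw
    have hM0 : 0 ≤ M :=
      (Finset.sum_nonneg fun x _ => mul_nonneg (hμ x) (Real.exp_pos _).le).trans (hM w hw)
    rw [← (Fin.consEquiv fun _ => α).sum_comp, Fintype.sum_prod_type]
    calc _ = ∑ x, μ x * Real.exp (φ w x) * ∑ X : Fin T → α, (∏ t, μ (X t)) *
          Real.exp (∑ t : Fin T, φ (runProcess step X (step w x) t) (X t)) := by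
          refine Finset.sum_congr rfl fun x _ => ?_
          rw [Finset.mul_sum]
          refine Finset.sum_congr rfl fun X _ => ?_
          have hcons : Fin.consEquiv (fun _ => α) (x, X) = (Fin.cons x X : Fin (T + 1) → α) := rfl
          rw [hcons, Fin.prod_univ_succ, Fin.sum_univ_succ, Real.exp_add]
          simp only [Fin.cons_zero, Fin.cons_succ, Fin.val_zero, Fin.val_succ, runProcess_cons,
            runProcess_zero]
          ring
      _ ≤ ∑ x, μ x * Real.exp (φ w x) * M ^ T :=
          Finset.sum_le_sum fun x _ => mul_le_mul_of_nonneg_left (ih _ (hInv w x hw))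
            (mul_nonneg (hμ x) (Real.exp_pos _).le)
      _ ≤ M ^ (T + 1) := by
          rw [← Finset.sum_mul, pow_succ']
          exact mul_le_mul_of_nonneg_right (hM w hw) (pow_nonneg hM0 T)

/-- The Azuma–Hoeffding inequality for an adaptive process driven by independent samples. -/
theorem measureReal_runProcess_ge_le {α W : Type*} [Fintype α] [MeasurableSpace α]
    [DiscreteMeasurableSpace α] (μ : Measure α) [IsProbabilityMeasure μ]
    {step : W → α → W} {Inv : W → Prop} (hInv : ∀ w x, Inv w → Inv (step w x)) {φ : W → α → ℝ}
    {c : ℝ} (hc : 0 < c) (hφ : ∀ w x, Inv w → |φ w x| ≤ c)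
    (h0 : ∀ w, Inv w → ∫ x, φ w x ∂μ = 0) {T : ℕ} (hT : 0 < T) {r : ℝ} (hr : 0 ≤ r)
    {w : W} (hw : Inv w) :
    (Measure.pi fun _ : Fin T => μ).real
      {X | r ≤ ∑ t : Fin T, φ (runProcess step X w t) (X t)} ≤
        Real.exp (-(r ^ 2 / (2 * T * c ^ 2))) := by
  classical
  have hTr : (0 : ℝ) < T := by exact_mod_cast hT
  -- The minimizer of the Chernoff exponent $-sr+Tc^2s^2/2$.
  set s := r / (T * c ^ 2) with hs
  have hs0 : 0 ≤ s := by positivity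
  have hM : ∀ w, Inv w → ∑ x, μ.real {x} * Real.exp (s * φ w x) ≤
      Real.exp (c ^ 2 * s ^ 2 / 2) := by
    intro w hw
    -- Hoeffding's lemma on `[-c, c]`, with variance proxy $c^2$.
    have h := (ProbabilityTheory.hasSubgaussianMGF_of_mem_Icc_of_integral_eq_zero (μ := μ)
      (X := φ w) (a := -c) (b := c) Measurable.of_discrete.aemeasurable
      (Filter.Eventually.of_forall fun x => abs_le.1 (hφ w x hw)) (h0 w hw)).mgf_le s
    rw [ProbabilityTheory.mgf, integral_fintype Integrable.of_finite] at h
    simp only [smul_eq_mul] at h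
    refine h.trans_eq ?_
    congr 3
    push_cast
    rw [Real.norm_of_nonneg (by linarith)]
    ring
  have hmgf := sum_prod_mul_exp_runProcess_le (μ := fun x => μ.real {x})
    (fun _ => measureReal_nonneg) hInv (φ := fun w x => s * φ w x) hM T w hw
  set S : Finset (Fin T → α) :=
    Finset.univ.filter fun X => r ≤ ∑ t : Fin T, φ (runProcess step X w t) (X t) with hS
  have hSet : {X : Fin T → α | r ≤ ∑ t : Fin T, φ (runProcess step X w t) (X t)} = ↑S := by
    ext X; simp [hS]
  have hsing : ∀ X : Fin T → α, (Measure.pi fun _ : Fin T => μ).real {X} =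
      ∏ t, μ.real {X t} := fun X => by
    simp [Measure.real, ENNReal.toReal_prod]
  rw [hSet, ← sum_measureReal_singleton]
  calc ∑ X ∈ S, (Measure.pi fun _ : Fin T => μ).real {X}
      ≤ ∑ X ∈ S, Real.exp (-(s * r)) * ((∏ t, μ.real {X t}) *
        Real.exp (∑ t : Fin T, s * φ (runProcess step X w t) (X t))) := by
        refine Finset.sum_le_sum fun X hX => ?_
        have hX' : r ≤ ∑ t : Fin T, φ (runProcess step X w t) (X t) := (Finset.mem_filter.1 hX).2
        rw [hsing, mul_left_comm, ← Real.exp_add]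
        refine le_mul_of_one_le_right (Finset.prod_nonneg fun _ _ => measureReal_nonneg)
          (Real.one_le_exp ?_)
        rw [← Finset.mul_sum]
        nlinarith
    _ ≤ ∑ X, Real.exp (-(s * r)) * ((∏ t, μ.real {X t}) *
        Real.exp (∑ t : Fin T, s * φ (runProcess step X w t) (X t))) :=
        Finset.sum_le_sum_of_subset_of_nonneg (Finset.subset_univ _) fun X _ _ =>
          mul_nonneg (Real.exp_pos _).le (mul_nonneg
            (Finset.prod_nonneg fun _ _ => measureReal_nonneg) (Real.exp_pos _).le)
    _ ≤ Real.exp (-(s * r)) * Real.exp (c ^ 2 * s ^ 2 / 2) ^ T := by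
        rw [← Finset.mul_sum]
        exact mul_le_mul_of_nonneg_left hmgf (Real.exp_pos _).le
    _ = Real.exp (-(r ^ 2 / (2 * T * c ^ 2))) := by
        rw [← Real.exp_nat_mul, ← Real.exp_add]
        congr 1
        rw [hs]
        field_simp
        ring

/-! ### Recovery of the weights -/

lemma simplexToBall_smgOutput {n T : ℕ} (u : Fin n) (p : Fin n → ℝ) (lam η : ℝ)
    (X : Fin T → Fin n → Entry) (i : Others u) :
    simplexToBall (smgOutput u p lam η X) i =
      (∑ t : Fin T, simplexToBall (smgIter u p lam η X t) i) / T := by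
  rw [Fin.sum_univ_eq_sum_range fun t => simplexToBall (smgIter u p lam η X t) i]
  simp only [simplexToBall, smgOutput, Finset.sum_sub_distrib, sub_div]

lemma gradBound_pos {q : ℝ} (hq : q < 1) (lam : ℝ) : 0 < gradBound q lam := by
  have : 0 < 1 - q := by linarith
  unfold gradBound
  positivity

lemma one_le_gradBound {q lam : ℝ} (hq0 : 0 ≤ q) (hq : q < 1) (hlam : 0 < lam) :
    1 ≤ gradBound q lam := by
  have h : 0 < 1 - q := by linarith
  rw [gradBound, one_le_div (by positivity)]
  calc (1 - q) ^ 2 ≤ 1 := pow_le_one₀ h.le (by linarith)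
    _ ≤ _ := Real.one_le_exp (by positivity)

lemma stepSize_nonneg {q : ℝ} (hq : q < 1) (lam : ℝ) (n T : ℕ) : 0 ≤ stepSize q lam n T := by
  have := gradBound_pos hq lam
  exact le_min (by positivity) (by positivity)

lemma stepSize_mul_gradBound_le {q : ℝ} (hq : q < 1) (lam : ℝ) (n T : ℕ) :
    stepSize q lam n T * gradBound q lam ≤ 1 / 8 := by
  have := gradBound_pos hq lam
  calc _ ≤ 1 / (8 * gradBound q lam) * gradBound q lam :=
        mul_le_mul_of_nonneg_right (min_le_left _ _) this.le
    _ = 1 / 8 := by field_simp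

lemma abs_apply_le_sum_abs {ι : Type*} [Fintype ι] (v : ι → ℝ) (i : ι) : |v i| ≤ ∑ j, |v j| :=
  Finset.single_le_sum (f := fun j => |v j|) (fun _ _ => abs_nonneg _) (Finset.mem_univ i)

/-- The squared quantity is the gradient scale $\lambda B$ times, up to a factor 2, the inverse
$e^{3\lambda}(1+2\lambda)$ of the monotonicity constant. -/
lemma explicitBound_eq (K q lam L ε : ℝ) :
    explicitBound K q lam L ε =
      K * (lam * (1 + lam) * gradBound q lam * Real.exp (3 * lam)) ^ 2 * L / ε ^ 4 := by
  have h : Real.exp ((2 / (1 - q) + 6) * lam) =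
      (Real.exp (lam / (1 - q)) * Real.exp (3 * lam)) ^ 2 := by
    rw [← Real.exp_add, ← Real.exp_nat_mul]
    congr 1
    push_cast
    ring
  rw [explicitBound, h, gradBound, show (1 - q) ^ 4 = ((1 - q) ^ 2) ^ 2 by ring]
  generalize (1 - q) ^ 2 = b
  ring

lemma log_two_mul_sub_one_le {n : ℕ} {δ : ℝ} (hn : 1 ≤ n) (hδ0 : 0 < δ) (hδ1 : δ < 1) :
    Real.log (2 * (n : ℝ) - 1) ≤ 2 * Real.log (n / δ) := by
  have hn' : (1 : ℝ) ≤ n := by exact_mod_cast hn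
  have h1 : (n : ℝ) ≤ n / δ := le_div_self (by positivity) hδ0 hδ1.le
  calc Real.log (2 * (n : ℝ) - 1) ≤ Real.log ((n / δ) ^ 2) :=
        Real.log_le_log (by linarith) (by nlinarith [sq_nonneg ((n : ℝ) - 1)])
    _ = 2 * Real.log (n / δ) := by rw [Real.log_pow]; norm_num

/-- The squared error of the averaged iterate is controlled by the linearized losses. -/
lemma sq_error_le {n T : ℕ} {A : Matrix (Fin n) (Fin n) ℝ} (hA : A.IsSymm)
    (hd : ∀ i, A i i = 0) {q lam η : ℝ} (hlam : 0 < lam) (hl : ∀ i, ∑ j, |A i j| ≤ lam)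
    (hη : 0 ≤ η) (hηB : η * gradBound q lam ≤ 1 / 8) {p : Fin n → ℝ}
    (hp : ∀ i, 0 ≤ p i ∧ p i ≤ q) (hq : q < 1) (hT : 0 < T) {u : Fin n}
    (X : Fin T → Fin n → Entry) (i : Others u) :
    Real.exp (-3 * lam) / (1 + 2 * lam) *
        (simplexToBall (smgOutput u p lam η X) i - A u i) ^ 2 * T ≤
      ∑ t : Fin T, ∑ j : Others u, (simplexToBall (smgIter u p lam η X t) j - A u j) *
        screeningGrad A (simplexToBall (smgIter u p lam η X t)) j := by
  have hTr : (0 : ℝ) < T := by exact_mod_cast hT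
  set κ := Real.exp (-3 * lam) / (1 + 2 * lam) with hκ
  have hκ0 : 0 < κ := by positivity
  have hS := smgIter_inSimplex (T := T) hlam hη hηB hp hq u X
  have h1 : ∀ t : Fin T, κ * (simplexToBall (smgIter u p lam η X t) i - A u i) ^ 2 ≤
      ∑ j : Others u, (simplexToBall (smgIter u p lam η X t) j - A u j) *
        screeningGrad A (simplexToBall (smgIter u p lam η X t)) j := fun t =>
    sq_le_sum_mul_screeningGrad hA hd hlam.le hl _ (hS t).sum_abs_le i
  refine le_trans ?_ (Finset.sum_le_sum fun t _ => h1 t)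
  rw [← Finset.mul_sum, mul_assoc]
  refine mul_le_mul_of_nonneg_left ?_ hκ0.le
  have hmean : simplexToBall (smgOutput u p lam η X) i - A u i =
      (∑ t : Fin T, (simplexToBall (smgIter u p lam η X t) i - A u i)) / T := by
    rw [simplexToBall_smgOutput, Finset.sum_sub_distrib, Finset.sum_const, Finset.card_univ,
      Fintype.card_fin, nsmul_eq_mul]
    field_simp
  -- Cauchy–Schwarz: the square of the mean error is at most the mean of the squared errors.
  have hcs := sq_sum_le_card_mul_sum_sq (s := (Finset.univ : Finset (Fin T)))
    (f := fun t => simplexToBall (smgIter u p lam η X t) i - A u i)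
  rw [Finset.card_univ, Fintype.card_fin] at hcs
  rw [hmean, div_pow, div_mul_eq_mul_div, div_le_iff₀ (by positivity)]
  nlinarith

/-- Recovery of the weights at one vertex, with a strict inequality. -/
theorem recovery_at_vertex {n T : ℕ} {A : Matrix (Fin n) (Fin n) ℝ} (hA : A.IsSymm)
    (hd : ∀ i, A i i = 0) {q lam δ ε : ℝ} (hq0 : 0 ≤ q) (hq : q < 1) (hlam : 0 < lam)
    (hl : ∀ i, ∑ j, |A i j| ≤ lam) {p : Fin n → ℝ}
    (hp : ∀ i, 0 ≤ p i ∧ p i ≤ q) (hδ0 : 0 < δ) (hδ1 : δ < 1) (hε : 0 < ε) (u : Fin n)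
    (hTb : explicitBound 1024 q lam (Real.log (n / δ)) ε ≤ T) :
    (sampleLaw A 0 p T).real
      {X | ∀ i : Others u,
        |simplexToBall (smgOutput u p lam (stepSize q lam n T) X) i - A u i| < ε}ᶜ ≤ δ := by
  have hp1 : ∀ i, 0 ≤ p i ∧ p i < 1 := fun i => ⟨(hp i).1, (hp i).2.trans_lt hq⟩
  have := isProbabilityMeasure_missLaw A fun i => ⟨(hp1 i).1, (hp1 i).2.le⟩
  rw [sampleLaw]
  have hn : 1 ≤ n := Nat.one_le_of_lt u.2
  have hone : (1 : ℝ) ≤ n := by exact_mod_cast hn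
  have hη := stepSize_nonneg hq lam n T
  have hηB := stepSize_mul_gradBound_le hq lam n T
  set η := stepSize q lam n T with hηdef
  set B := gradBound q lam with hB
  have hB0 : 0 < B := gradBound_pos hq lam
  have hB1 : 1 ≤ B := one_le_gradBound hq0 hq hlam
  have hS := fun X => smgIter_inSimplex (T := T) hlam hη hηB hp hq u X
  have ha : ∑ j : Others u, |A u j| ≤ lam := by
    rw [sum_others (fun j => |A u j|) (by simp [hd])]; exact hl u
  have haj : ∀ j : Others u, |A u j| ≤ lam := fun j =>
    (abs_apply_le_sum_abs (fun j : Others u => A u j) j).trans ha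
  -- If `ε > 2 lam` the claim is trivial, as both vectors lie in the $\ell^1$ ball of radius `lam`.
  -- This case is separated because the hypothesis then no longer forces `T` to be large; even `T =
  -- 0` is covered.
  rcases lt_or_ge (2 * lam) ε with hbig | hsmall
  · have huniv : {X : Fin T → Fin n → Entry | ∀ i : Others u,
        |simplexToBall (smgOutput u p lam η X) i - A u i| < ε} = Set.univ := by
      refine Set.eq_univ_of_forall fun X i => ?_
      have h1 : |simplexToBall (smgOutput u p lam η X) i| ≤ lam := by
        rw [simplexToBall_smgOutput, abs_div, Nat.abs_cast]
        refine div_le_of_le_mul₀ (Nat.cast_nonneg _) hlam.le ?_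
        calc _ ≤ ∑ t : Fin T, lam := (Finset.abs_sum_le_sum_abs _ _).trans
              (Finset.sum_le_sum fun t _ =>
                (abs_apply_le_sum_abs _ i).trans (hS X t).sum_abs_le)
          _ = lam * T := by simp [mul_comm]
      exact ((abs_sub _ _).trans (add_le_add h1 (haj i))).trans_lt (by linarith)
    rw [huniv, Set.compl_univ]
    simpa using hδ0.le
  -- the main case
  set L := Real.log (n / δ) with hL
  have hnδ : 1 < n / δ := (one_lt_div hδ0).2 (by linarith)
  have hL0 : 0 < L := Real.log_pos hnδ
  set E := Real.exp (3 * lam) with hE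
  have hE1 : 1 ≤ E := Real.one_le_exp (by positivity)
  set Q := lam * (1 + lam) * B * E with hQ
  have hQ0 : 0 < Q := by positivity
  have hQlam : lam ^ 2 ≤ Q := by
    calc lam ^ 2 ≤ lam * (1 + lam) := by nlinarith
      _ ≤ lam * (1 + lam) * B := le_mul_of_one_le_right (by positivity) hB1
      _ ≤ Q := le_mul_of_one_le_right (by positivity) hE1
  rw [explicitBound_eq, div_le_iff₀ (by positivity)] at hTb
  -- Since $\varepsilon\le2\lambda$, $\varepsilon^4\le16\lambda^4\le16Q^2$, and $1024/16=64$. This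
  -- puts the step size in its second regime below.
  have hTL : 64 * L ≤ T := by
    have h1 : ε ^ 2 ≤ 4 * Q := by nlinarith
    have h2 : ε ^ 4 ≤ 16 * Q ^ 2 := by
      calc ε ^ 4 = (ε ^ 2) ^ 2 := by ring
        _ ≤ (4 * Q) ^ 2 := pow_le_pow_left₀ (by positivity) h1 2
        _ = 16 * Q ^ 2 := by ring
    have h3 : 1024 * Q ^ 2 * L ≤ T * (16 * Q ^ 2) :=
      hTb.trans (mul_le_mul_of_nonneg_left h2 (Nat.cast_nonneg _))
    have hQ2 : 0 < 16 * Q ^ 2 := by positivity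
    refine le_of_mul_le_mul_right ?_ hQ2
    linarith
  have hTr : (0 : ℝ) < T := by linarith
  have hT : 0 < T := by exact_mod_cast hTr
  set σ := Real.sqrt (L / T) with hσ
  have hσ2 : σ ^ 2 * T = L := by
    rw [hσ, Real.sq_sqrt (by positivity)]; field_simp
  have hσ0 : 0 < σ := Real.sqrt_pos.2 (by positivity)
  -- This fixes the absolute constant: $1024=32^2$.
  have hσε : 32 * Q * σ ≤ ε ^ 2 := by
    refine abs_le_of_sq_le_sq' ?_ (by positivity) |>.2
    refine le_of_mul_le_mul_right ?_ hTr
    calc (32 * Q * σ) ^ 2 * T = 1024 * Q ^ 2 * (σ ^ 2 * T) := by ring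
      _ ≤ T * ε ^ 4 := by rw [hσ2]; exact hTb
      _ = (ε ^ 2) ^ 2 * T := by ring
  -- the regret
  have hregret : ∀ X : Fin T → Fin n → Entry,
      ∑ t : Fin T, ∑ i, (simplexToBall (smgIter u p lam η X t) i - A u i) *
        gMiss p (smgIter u p lam η X t) (X t) i ≤ 9 * (lam * B * T * σ) := by
    intro X
    -- For `n = 1` the logarithm vanishes, so `η = 0` and the regret bound cannot be divided by `η`;
    -- but then there are no coordinates.
    by_cases hn1 : n = 1
    · have : IsEmpty (Others u) := ⟨fun j => j.2 (by have := j.1.2; have := u.2; ext; omega)⟩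
      simp only [Finset.univ_eq_empty, Finset.sum_empty, Finset.sum_const_zero]
      positivity
    have hn2 : (2 : ℝ) ≤ n := by exact_mod_cast (by omega : 2 ≤ n)
    set ℓ := Real.log (2 * (n : ℝ) - 1) with hℓ
    have hℓ0 : 0 < ℓ := Real.log_pos (by linarith)
    have hℓL : ℓ ≤ 2 * L := log_two_mul_sub_one_le hn hδ0 hδ1
    set ρ := Real.sqrt (ℓ / T) with hρ
    have hρ0 : 0 < ρ := Real.sqrt_pos.2 (by positivity)
    have hρ2 : ρ ^ 2 * T = ℓ := by
      rw [hρ, Real.sq_sqrt (by positivity)]; field_simp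
    have hρσ : ρ ≤ 3 / 2 * σ := by
      refine abs_le_of_sq_le_sq' ?_ (by positivity) |>.2
      refine le_of_mul_le_mul_right ?_ hTr
      nlinarith
    -- Because $\ell\le2L\le T/32$; hence the minimum in the step size is its second entry.
    have hρ4 : ρ ≤ 1 / 4 := by
      refine abs_le_of_sq_le_sq' ?_ (by positivity) |>.2
      refine le_of_mul_le_mul_right ?_ hTr
      nlinarith
    have hηρ : η = 1 / (2 * B) * ρ := by
      refine min_eq_right ?_
      calc 1 / (2 * B) * ρ ≤ 1 / (2 * B) * (1 / 4) :=
            mul_le_mul_of_nonneg_left hρ4 (by positivity)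
        _ = 1 / (8 * B) := by field_simp; norm_num
    have hreg := smg_regret hlam hη hηB hp hq (fun j : Others u => A u j) ha X
    rw [show η * gradBound q lam = ρ / 2 by rw [hηρ, ← hB]; field_simp] at hreg
    set Ψ := ∑ t : Fin T, ∑ i, (simplexToBall (smgIter u p lam η X t) i - A u i) *
        gMiss p (smgIter u p lam η X t) (X t) i
    -- With $\eta B=\rho/2$ and $\ell=\rho^2T$ the entropy and quadratic terms are $\lambda T\rho^2$
    -- and $2\lambda T\rho^2$; the factor $2B$ gives 6, and $\rho\le\frac32\sigma$ later gives 9.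
    have h1 : ρ * Ψ ≤ ρ * (6 * (lam * B * T * ρ)) := by
      have h2 : ρ * Ψ = 2 * B * (η * Ψ) := by rw [hηρ]; field_simp
      rw [h2]
      calc 2 * B * (η * Ψ) ≤ 2 * B * (lam * ℓ + T * (8 * (ρ / 2) ^ 2 * lam)) :=
            mul_le_mul_of_nonneg_left hreg (by positivity)
        _ = ρ * (6 * (lam * B * T * ρ)) := by rw [← hρ2]; ring
    have h3 := le_of_mul_le_mul_left h1 hρ0
    have h4 : lam * B * T * ρ ≤ lam * B * T * (3 / 2 * σ) :=
      mul_le_mul_of_nonneg_left hρσ (by positivity)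
    linarith
  -- the sampling noise
  set ψ : (Coord u → ℝ) → (Fin n → Entry) → ℝ := fun w x =>
    ∑ i, (simplexToBall w i - A u i) * gMiss p w x i with hψ
  set m : (Coord u → ℝ) → ℝ := fun w =>
    ∑ i, (simplexToBall w i - A u i) * screeningGrad A (simplexToBall w) i with hm
  have hψm : ∀ w, ∫ x, ψ w x ∂missLaw A 0 p = m w := by
    intro w
    simp only [hψ, hm]
    rw [integral_finsetSum _ fun i _ => Integrable.of_finite]
    exact Finset.sum_congr rfl fun i _ => by rw [integral_const_mul, integral_gMiss A hp1]
  have hψb : ∀ w x, InSimplex lam w → |ψ w x| ≤ 2 * lam * B := by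
    intro w x hw
    calc |ψ w x| ≤ ∑ i, (|simplexToBall w i| + |A u i|) * B := by
          refine (Finset.abs_sum_le_sum_abs _ _).trans (Finset.sum_le_sum fun i _ => ?_)
          rw [abs_mul]
          exact mul_le_mul (abs_sub _ _) (abs_gMiss_le hp hq hw.sum_abs_le x i) (abs_nonneg _)
            (by positivity)
      _ ≤ 2 * lam * B := by
          rw [← Finset.sum_mul, Finset.sum_add_distrib]
          exact mul_le_mul_of_nonneg_right (by linarith [hw.sum_abs_le]) hB0.le
  have hmb : ∀ w, InSimplex lam w → |m w| ≤ 2 * lam * B := by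
    intro w hw
    rw [← hψm, ← Real.norm_eq_abs]
    refine (norm_integral_le_of_norm_le_const
      (Filter.Eventually.of_forall fun x => hψb w x hw)).trans_eq ?_
    simp
  -- Only one tail matters: the true pairings exceeding the sampled ones. The differences are
  -- bounded by $4\lambda B$, and the deviation $6\lambda BT\sigma$ has exponent $36L/32=\frac98L$.
  have hconc := measureReal_runProcess_ge_le (missLaw A 0 p) (step := smgStep p lam η)
    (Inv := InSimplex lam) (fun w x hw => smgStep_inSimplex hlam hη hηB hp hq hw x)
    (φ := fun w x => m w - ψ w x) (c := 4 * lam * B) (by positivity)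
    (fun w x hw => (abs_sub _ _).trans (by linarith [hmb w hw, hψb w x hw]))
    (fun w _ => by
      rw [integral_sub Integrable.of_finite Integrable.of_finite, hψm]; simp)
    hT (r := 6 * (lam * B * T * σ)) (by positivity) (uniform_inSimplex u hlam)
  simp only [← smgIter_eq_runProcess] at hconc
  refine (measureReal_mono ?_).trans (hconc.trans ?_)
  · intro X hX
    simp only [Set.mem_compl_iff, Set.mem_ofPred_eq, not_forall, not_lt] at hX ⊢
    obtain ⟨i, hi⟩ := hX
    by_contra! hlt
    rw [Finset.sum_sub_distrib] at hlt
    have h1 := sq_error_le hA hd hlam hl hη hηB hp hq hT X i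
    have h2 := hregret X
    have h3 : Real.exp (-3 * lam) / (1 + 2 * lam) * ε ^ 2 * T < 15 * (lam * B * T * σ) := by
      refine lt_of_le_of_lt ?_ (h1.trans_lt (by linarith))
      exact mul_le_mul_of_nonneg_right (mul_le_mul_of_nonneg_left
        (sq_le_sq.2 (by rwa [abs_of_pos hε])) (by positivity)) hTr.le
    -- Regret 9 plus noise 6 gives 15, doubled by $1+2\lambda\le2(1+\lambda)$. The result 30
    -- contradicts the 32 guaranteed by the sample size.
    have h4 : ε ^ 2 * T < 30 * Q * σ * T := by
      calc ε ^ 2 * T = E * (1 + 2 * lam) *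
            (Real.exp (-3 * lam) / (1 + 2 * lam) * ε ^ 2 * T) := by
            rw [hE, neg_mul, Real.exp_neg]; field_simp
        _ < E * (1 + 2 * lam) * (15 * (lam * B * T * σ)) :=
            mul_lt_mul_of_pos_left h3 (by positivity)
        _ ≤ E * (2 * (1 + lam)) * (15 * (lam * B * T * σ)) := by gcongr; linarith
        _ = 30 * Q * σ * T := by rw [hQ]; ring
    have h5 : 0 < Q * σ := by positivity
    linarith [lt_of_mul_lt_mul_right h4 hTr.le]
  · have h1 : (6 * (lam * B * T * σ)) ^ 2 / (2 * T * (4 * lam * B) ^ 2) = 9 / 8 * L := by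
      rw [← hσ2]; field_simp; norm_num
    rw [h1]
    calc Real.exp (-(9 / 8 * L)) ≤ Real.exp (-L) := Real.exp_le_exp.2 (by linarith)
      _ = δ / n := by rw [hL, Real.exp_neg, Real.exp_log (by linarith), inv_div]
      _ ≤ δ := div_le_self hδ0.le hone

/-! ### Recovery of the graph -/

lemma isProbabilityMeasure_sampleLaw {n : ℕ} (A : Matrix (Fin n) (Fin n) ℝ) {p : Fin n → ℝ}
    (hp : ∀ i, 0 ≤ p i ∧ p i ≤ 1) (T : ℕ) : IsProbabilityMeasure (sampleLaw A 0 p T) := by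
  have := isProbabilityMeasure_missLaw A hp
  rw [sampleLaw]
  infer_instance

lemma neighborSet_depGraph {n : ℕ} {A : Matrix (Fin n) (Fin n) ℝ} (hA : A.IsSymm) (u : Fin n) :
    (depGraph A).neighborSet u = {i | i ≠ u ∧ A u i ≠ 0} := by
  ext i
  simp only [SimpleGraph.mem_neighborSet, depGraph, SimpleGraph.fromRel_adj, Set.mem_ofPred_eq,
    hA.apply u i, or_self, ne_comm]

/-- If all weights at `u` are estimated to precision below `β / 2`, thresholding finds the
neighbourhood of `u`. -/
lemma estNeighbors_eq {n T : ℕ} {A : Matrix (Fin n) (Fin n) ℝ} (hA : A.IsSymm) {p : Fin n → ℝ}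
    {lam η β : ℝ} (hβ : ∀ i j, A i j ≠ 0 → β ≤ |A i j|) {X : Fin T → Fin n → Entry} {u : Fin n}
    (h : ∀ i : Others u, |simplexToBall (smgOutput u p lam η X) i - A u i| < β / 2) :
    estNeighbors p lam η β X u = (depGraph A).neighborSet u := by
  rw [neighborSet_depGraph hA]
  ext i
  simp only [estNeighbors, Set.mem_ofPred_eq]
  constructor
  · rintro ⟨hi, hle⟩
    refine ⟨hi, fun h0 => ?_⟩
    -- Strictness of the error bound is essential: the threshold accepts equality, so a
    -- non-neighbour must stay strictly below `β / 2`.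
    have := h ⟨i, hi⟩
    rw [h0, sub_zero] at this
    linarith
  · rintro ⟨hi, hne⟩
    refine ⟨hi, ?_⟩
    have h1 := h ⟨i, hi⟩
    rw [abs_sub_comm] at h1
    have h2 := abs_sub_abs_le_abs_sub (A u i) (simplexToBall (smgOutput u p lam η X) ⟨i, hi⟩)
    linarith [hβ u i hne]

lemma one_sub_le_measureReal {Ω : Type*} [MeasurableSpace Ω] {μ : Measure Ω}
    [IsProbabilityMeasure μ] {s t : Set Ω} (hs : MeasurableSet s) (hst : s ⊆ t) {δ : ℝ}
    (h : μ.real sᶜ ≤ δ) : 1 - δ ≤ μ.real t := by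
  have h1 := probReal_compl_eq_one_sub (μ := μ) hs
  have h2 : μ.real s ≤ μ.real t := measureReal_mono hst
  linarith

/-- A union bound over vertices, each allowed failure probability $\delta/n$; this is why
$n/(\delta/n)=n^2/\delta$ stands in the logarithm. The vertices share their samples, as no
independence between them is needed. -/
theorem graph_recovery {n T : ℕ} {A : Matrix (Fin n) (Fin n) ℝ} (hA : A.IsSymm)
    (hd : ∀ i, A i i = 0) {q lam δ β : ℝ} (hq0 : 0 ≤ q) (hq : q < 1) (hlam : 0 < lam)
    (hl : ∀ i, ∑ j, |A i j| ≤ lam) {p : Fin n → ℝ}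
    (hp : ∀ i, 0 ≤ p i ∧ p i ≤ q) (hδ0 : 0 < δ) (hδ1 : δ < 1) (hβ : 0 < β)
    (hAβ : ∀ i j, A i j ≠ 0 → β ≤ |A i j|)
    (hTb : explicitBound 1024 q lam (Real.log ((n : ℝ) ^ 2 / δ)) (β / 2) ≤ T) :
    1 - δ ≤ (sampleLaw A 0 p T).real
      {X | ∀ u, estNeighbors p lam (stepSize q lam n T) β X u = (depGraph A).neighborSet u} := by
  have := isProbabilityMeasure_sampleLaw A
    (fun i => ⟨(hp i).1, (hp i).2.trans hq.le⟩) T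
  set good : Fin n → Set (Fin T → Fin n → Entry) := fun u => {X | ∀ i : Others u,
    |simplexToBall (smgOutput u p lam (stepSize q lam n T) X) i - A u i| < β / 2} with hgood
  have hbad : ∀ u, (sampleLaw A 0 p T).real (good u)ᶜ ≤ δ / n := by
    intro u
    have hn : (1 : ℝ) ≤ n := by exact_mod_cast Nat.one_le_of_lt u.2
    refine recovery_at_vertex hA hd hq0 hq hlam hl hp (by positivity)
      ((div_le_self hδ0.le hn).trans_lt hδ1) (by positivity) u ?_
    rwa [show (n : ℝ) / (δ / n) = (n : ℝ) ^ 2 / δ by field_simp]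
  have hunion : (sampleLaw A 0 p T).real (⋃ u, (good u)ᶜ) ≤ δ := by
    refine (measureReal_iUnion_fintype_le _).trans
      ((Finset.sum_le_sum fun u _ => hbad u).trans ?_)
    rw [Finset.sum_const, Finset.card_univ, Fintype.card_fin, nsmul_eq_mul]
    rcases Nat.eq_zero_or_pos n with h0 | h0
    · simp [h0, hδ0.le]
    · have : (0 : ℝ) < n := by exact_mod_cast h0
      exact (mul_div_cancel₀ δ this.ne').le
  rw [← Set.compl_iInter] at hunion
  exact one_sub_le_measureReal (Set.toFinite _).measurableSet
    (fun X hX u => estNeighbors_eq hA hAβ (Set.mem_iInter.1 hX u)) hunion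

/-- For `lam` bounded below, the explicit bound is absorbed by an exponential. -/
lemma exists_explicitBound_le_sampleBound (K : ℝ) {q lam₀ : ℝ} (hq : q < 1)
    (hlam₀ : 0 < lam₀) :
    ∃ C : ℝ, 0 < C ∧ ∀ lam L ε : ℝ, lam₀ ≤ lam → 0 ≤ L →
      explicitBound K q lam L ε ≤ sampleBound C lam L ε := by
  have h1q : 0 < 1 - q := by linarith
  set Q := |K| * (1 + 1 / lam₀) ^ 2 / (1 - q) ^ 4 with hQ
  have hQ0 : 0 ≤ Q := by positivity
  -- The last summand pays for the prefactor: $Q\le\frac{Q}{\lambda_0}\lambda\le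
  -- e^{(Q/\lambda_0)\lambda}$, while $1+\lambda\le\lambda(1+1/\lambda_0)$ supplies the fourth power
  -- of `lam`.
  refine ⟨2 / (1 - q) + 6 + Q / lam₀, by positivity, fun lam L ε hlam hL => ?_⟩
  have hlam0 : 0 < lam := hlam₀.trans_le hlam
  have h1 : Q ≤ Real.exp (Q / lam₀ * lam) := by
    have h2 : Q ≤ Q / lam₀ * lam := by
      rw [div_mul_eq_mul_div, le_div_iff₀ hlam₀]
      exact mul_le_mul_of_nonneg_left hlam hQ0
    linarith [Real.add_one_le_exp (Q / lam₀ * lam)]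
  have h3 : 1 + lam ≤ lam * (1 + 1 / lam₀) := by
    have : 1 ≤ lam * (1 / lam₀) := by rwa [mul_one_div, one_le_div hlam₀]
    linarith
  have h4 : K * (lam ^ 2 * (1 + lam) ^ 2 / (1 - q) ^ 4) ≤ lam ^ 4 * Q := by
    calc K * (lam ^ 2 * (1 + lam) ^ 2 / (1 - q) ^ 4)
        ≤ |K| * (lam ^ 2 * (lam * (1 + 1 / lam₀)) ^ 2 / (1 - q) ^ 4) := by
          gcongr
          exact le_abs_self K
      _ = lam ^ 4 * Q := by rw [hQ]; ring
  have h5 : Real.exp ((2 / (1 - q) + 6 + Q / lam₀) * lam) =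
      Real.exp ((2 / (1 - q) + 6) * lam) * Real.exp (Q / lam₀ * lam) := by
    rw [← Real.exp_add, ← add_mul]
  have h6 := h4.trans (mul_le_mul_of_nonneg_left h1 (by positivity : 0 ≤ lam ^ 4))
  have h7 : 0 ≤ Real.exp ((2 / (1 - q) + 6) * lam) * L * (ε ^ 4)⁻¹ := by positivity
  rw [explicitBound, sampleBound, h5]
  linarith [mul_le_mul_of_nonneg_right h6 h7]

/-! ### Frames, loops and running times of programs -/

namespace RAMState

@[simp] lemma idx_set (σ : RAMState) (d : Ref) (v : ℝ) : (σ.set d v).idx = σ.idx := rfl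

lemma mem_set (σ : RAMState) (d : Ref) (v : ℝ) (a i j : ℕ) :
    (σ.set d v).mem a i j =
      if a = d.arr ∧ i = σ.idx d.row ∧ j = σ.idx d.col then v else σ.mem a i j := rfl

lemma mem_set_of_ne (σ : RAMState) {d : Ref} (v : ℝ) {a : ℕ} (h : a ≠ d.arr) :
    (σ.set d v).mem a = σ.mem a := by
  funext i j
  simp [mem_set, h]

@[simp] lemma mem_setIdx (σ : RAMState) (r k : ℕ) : (σ.setIdx r k).mem = σ.mem := rfl

lemma idx_setIdx (σ : RAMState) (r k s : ℕ) :
    (σ.setIdx r k).idx s = if s = r then k else σ.idx s := by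
  simp [setIdx, Function.update_apply]

end RAMState

namespace Prog

/-- Sequential composition of a list of programs. -/
def block : List Prog → Prog
  | [] => .skip
  | P :: Ps => .seq P (block Ps)

/-- The arrays that a program may write to. -/
def arrs : Prog → List ℕ
  | .skip | .idxConst _ _ | .idxCopy _ _ | .idxSucc _ | .idxPred _ => []
  | .const d _ | .copy d _ | .arith _ d _ _ | .exp d _ => [d.arr]
  | .seq P Q | .ifLt _ _ P Q | .ifLe _ _ P Q => P.arrs ++ Q.arrs
  | .loop _ _ P => P.arrs

/-- The index registers that a program may write to. -/
def regs : Prog → List ℕ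
  | .idxConst r _ | .idxCopy r _ | .idxSucc r | .idxPred r => [r]
  | .skip | .const _ _ | .copy _ _ | .arith _ _ _ _ | .exp _ _ => []
  | .seq P Q | .ifLt _ _ P Q | .ifLe _ _ P Q => P.regs ++ Q.regs
  | .loop r _ P => r :: P.regs

/-- The state and the step count after `k` rounds of a loop. -/
def rounds (r : ℕ) (P : Prog) (σ : RAMState) : ℕ → RAMState × ℕ
  | 0 => (σ, 1)
  | k + 1 => ((P.exec ((rounds r P σ k).1.setIdx r k)).1,
      (rounds r P σ k).2 + (P.exec ((rounds r P σ k).1.setIdx r k)).2 + 1)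

lemma exec_loop (r s : ℕ) (P : Prog) (σ : RAMState) :
    (Prog.loop r s P).exec σ = rounds r P σ (σ.idx s) := by
  rw [exec]
  induction σ.idx s with
  | zero => rfl
  | succ k ih => simp only [rounds, ← ih]

/-- The frame rule for arrays. The set of written arrays is read off the program text, so for a
concrete program its hypothesis is decidable. -/
lemma exec_mem_of_notMem {P : Prog} {a : ℕ} (h : a ∉ P.arrs) (σ : RAMState) :
    (P.exec σ).1.mem a = σ.mem a := by
  induction P generalizing σ with
  | skip | idxConst | idxCopy | idxSucc | idxPred => rfl
  | const | copy | arith | exp =>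
    exact RAMState.mem_set_of_ne _ _ (by simpa [arrs] using h)
  | seq P Q ihP ihQ =>
    simp only [arrs, List.mem_append, not_or] at h
    rw [exec, ihQ h.2, ihP h.1]
  | ifLt r s P Q ihP ihQ | ifLe r s P Q ihP ihQ =>
    simp only [arrs, List.mem_append, not_or] at h
    rw [exec]
    split_ifs
    · exact ihP h.1 σ
    · exact ihQ h.2 σ
  | loop r s P ih =>
    rw [exec_loop]
    induction σ.idx s with
    | zero => rfl
    | succ k ihk => rw [rounds, ih h, RAMState.mem_setIdx, ihk]

lemma exec_idx_of_notMem {P : Prog} {r : ℕ} (h : r ∉ P.regs) (σ : RAMState) :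
    (P.exec σ).1.idx r = σ.idx r := by
  induction P generalizing σ with
  | idxConst | idxCopy | idxSucc | idxPred =>
    simp only [exec, RAMState.idx_setIdx]
    exact if_neg (by simpa [regs] using h)
  | skip | const | copy | arith | exp => rfl
  | seq P Q ihP ihQ =>
    simp only [regs, List.mem_append, not_or] at h
    rw [exec, ihQ h.2, ihP h.1]
  | ifLt s s' P Q ihP ihQ | ifLe s s' P Q ihP ihQ =>
    simp only [regs, List.mem_append, not_or] at h
    rw [exec]
    split_ifs
    · exact ihP h.1 σ
    · exact ihQ h.2 σ
  | loop s s' P ih =>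
    simp only [regs, List.mem_cons, not_or] at h
    rw [exec_loop]
    induction σ.idx s' with
    | zero => rfl
    | succ k ihk => rw [rounds, ih h.2, RAMState.idx_setIdx, if_neg h.1, ihk]

/-- The loop rule: an invariant may use that everything the body does not write is unchanged. -/
lemma loop_induction {r s : ℕ} {P : Prog} {σ : RAMState} (I : ℕ → RAMState → Prop)
    (h0 : I 0 σ)
    (hstep : ∀ k < σ.idx s, ∀ τ : RAMState, (∀ a ∉ P.arrs, τ.mem a = σ.mem a) →
      (∀ r' ∉ r :: P.regs, τ.idx r' = σ.idx r') → I k τ →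
      I (k + 1) (P.exec (τ.setIdx r k)).1) :
    I (σ.idx s) ((Prog.loop r s P).exec σ).1 := by
  rw [exec_loop]
  suffices h : ∀ k ≤ σ.idx s, I k (rounds r P σ k).1 ∧
      (∀ a ∉ P.arrs, (rounds r P σ k).1.mem a = σ.mem a) ∧
      (∀ r' ∉ r :: P.regs, (rounds r P σ k).1.idx r' = σ.idx r') from (h _ le_rfl).1
  intro k
  induction k with
  | zero => exact fun _ => ⟨h0, fun _ _ => rfl, fun _ _ => rfl⟩
  | succ k ih =>
    intro hk
    obtain ⟨h1, h2, h3⟩ := ih (Nat.le_of_succ_le hk)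
    refine ⟨hstep k hk _ h2 h3 h1, fun a ha => ?_, fun r' hout => ?_⟩
    · rw [rounds, exec_mem_of_notMem ha, RAMState.mem_setIdx, h2 a ha]
    · have hrs := hout
      simp only [List.mem_cons, not_or] at hrs
      rw [rounds, exec_idx_of_notMem hrs.2, RAMState.idx_setIdx, if_neg hrs.1, h3 r' hout]

/-- The number of steps of a program whose loops run over registers `0` and `1` only, when these
hold `n` and `T`. -/
def cost (n T : ℕ) : Prog → ℕ
  | .seq P Q => P.cost n T + Q.cost n T
  | .ifLt _ _ P Q | .ifLe _ _ P Q => P.cost n T + Q.cost n T + 1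
  | .loop _ s P => 1 + (if s = 0 then n else T) * (P.cost n T + 1)
  | _ => 1

/-- All loops run over registers `0` and `1`. -/
def SimpleLoops : Prog → Prop
  | .seq P Q | .ifLt _ _ P Q | .ifLe _ _ P Q => P.SimpleLoops ∧ Q.SimpleLoops
  | .loop _ s P => (s = 0 ∨ s = 1) ∧ P.SimpleLoops
  | _ => True

/-- Registers `0` and `1` are never written, so every loop has the same length whenever it is
reached and the cost depends on the text alone. Both branches of a test are charged, which only
overcounts. -/
lemma exec_snd_le_cost {P : Prog} (h0 : 0 ∉ P.regs) (h1 : 1 ∉ P.regs) (hs : P.SimpleLoops)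
    (σ : RAMState) : (P.exec σ).2 ≤ P.cost (σ.idx 0) (σ.idx 1) := by
  induction P generalizing σ with
  | idxConst | idxCopy | idxSucc | idxPred | skip | const | copy | arith | exp => exact le_rfl
  | seq P Q ihP ihQ =>
    simp only [regs, List.mem_append, not_or] at h0 h1
    have hP := ihP h0.1 h1.1 hs.1 σ
    have hQ := ihQ h0.2 h1.2 hs.2 (P.exec σ).1
    rw [exec_idx_of_notMem h0.1, exec_idx_of_notMem h1.1] at hQ
    exact add_le_add hP hQ
  | ifLt r s P Q ihP ihQ | ifLe r s P Q ihP ihQ =>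
    simp only [regs, List.mem_append, not_or] at h0 h1
    have hP := ihP h0.1 h1.1 hs.1 σ
    have hQ := ihQ h0.2 h1.2 hs.2 σ
    rw [exec, cost]
    split_ifs <;> simp only <;> omega
  | loop r s P ih =>
    simp only [regs, List.mem_cons, not_or] at h0 h1
    have hrounds : ∀ k, (rounds r P σ k).1.idx 0 = σ.idx 0 ∧
        (rounds r P σ k).1.idx 1 = σ.idx 1 ∧
        (rounds r P σ k).2 ≤ 1 + k * (P.cost (σ.idx 0) (σ.idx 1) + 1) := by
      intro k
      induction k with
      | zero => simp [rounds]
      | succ k ihk =>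
        obtain ⟨e0, e1, hle⟩ := ihk
        have e0' : ((rounds r P σ k).1.setIdx r k).idx 0 = σ.idx 0 := by
          rw [RAMState.idx_setIdx, if_neg h0.1, e0]
        have e1' : ((rounds r P σ k).1.setIdx r k).idx 1 = σ.idx 1 := by
          rw [RAMState.idx_setIdx, if_neg h1.1, e1]
        have hb := ih h0.2 h1.2 hs.2 ((rounds r P σ k).1.setIdx r k)
        rw [e0', e1'] at hb
        refine ⟨?_, ?_, ?_⟩
        · rw [rounds, exec_idx_of_notMem h0.2, e0']
        · rw [rounds, exec_idx_of_notMem h1.2, e1']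
        · simp only [rounds]
          rw [Nat.succ_mul]
          omega
    rw [exec_loop, cost]
    refine (hrounds _).2.2.trans_eq ?_
    rcases hs.1 with rfl | rfl <;> simp

end Prog

/-! ### The program

Registers: `0` holds `n`, `1` holds `T`, `2` holds `0`, `3` the vertex `u`, `4` the sample `t`,
`5` the running vertex `j`, `6` a pointer running backwards, `7` and `8` the constants `1`, `2`.
Arrays from `4` on: `4` the constant `1`, `5` and `6` the positive and negative weights, `7` the sum
of the iterates, `8` and `9` the factors of the estimator, `10` and `11` prefix and suffix products,
`12` the gradient estimate, `13` the initial weight, `14` a running product, `15` the factor of `u`,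
`16` the inner product of weights and gradient, `17` and `18` temporary values, `19` the number `T`,
`20` the threshold, `21` the constant `0`. -/

namespace Prog

/-- A scalar. -/
abbrev sc (a : ℕ) : Ref := ⟨a, 2, 2⟩

/-- The entry at the running vertex `j` of a vector. -/
abbrev vec (a : ℕ) : Ref := ⟨a, 2, 5⟩

abbrev etaRef : Ref := ⟨0, 2, 7⟩

abbrev betaRef : Ref := ⟨0, 2, 8⟩

/-- The entry `j` of the current sample. -/
abbrev sampleRef : Ref := ⟨2, 4, 5⟩

/-- The entry `u` of the current sample. -/
abbrev sampleRefU : Ref := ⟨2, 4, 3⟩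

/-- Factors and prefix products. -/
def forwardBody : Prog := block [
  .arith .sub (sc 17) (vec 5) (vec 6),
  .arith .add (vec 7) (vec 7) (sc 17),
  .arith .sub (sc 17) (sc 21) (sc 17),
  .arith .mul (sc 17) (sc 17) sampleRefU,
  .arith .mul (sc 17) (sc 17) sampleRef,
  .exp (sc 17) (sc 17),
  .arith .sub (sc 18) (sc 4) (vec 1),
  .arith .mul (vec 8) (sc 17) sampleRef,
  .arith .div (vec 8) (vec 8) (sc 18),
  .arith .sub (vec 9) (sc 17) (vec 1),
  .arith .div (vec 9) (vec 9) (sc 18),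
  .copy (vec 10) (sc 14),
  .arith .mul (sc 14) (sc 14) (vec 9)]

/-- Suffix products. -/
def backwardBody : Prog := block [
  .idxPred 6,
  .copy ⟨11, 2, 6⟩ (sc 14),
  .arith .mul (sc 14) (sc 14) ⟨9, 2, 6⟩]

/-- The gradient estimate and its inner product with the weights. -/
def gradBody : Prog := block [
  .arith .mul (sc 17) (vec 10) (vec 11),
  .arith .mul (vec 12) (sc 15) (vec 8),
  .arith .mul (vec 12) (vec 12) (sc 17),
  .arith .mul (sc 17) (vec 5) (vec 12),
  .arith .add (sc 16) (sc 16) (sc 17),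
  .arith .mul (sc 17) (vec 6) (vec 12),
  .arith .sub (sc 16) (sc 16) (sc 17)]

/-- The multiplicative update. -/
def updateBody : Prog := block [
  .arith .mul (sc 17) etaRef (vec 12),
  .arith .sub (sc 18) (sc 4) (sc 17),
  .arith .add (sc 18) (sc 18) (sc 16),
  .arith .mul (vec 5) (vec 5) (sc 18),
  .arith .add (sc 18) (sc 4) (sc 17),
  .arith .add (sc 18) (sc 18) (sc 16),
  .arith .mul (vec 6) (vec 6) (sc 18)]

/-- The factor of `u` and the start of the running product. -/
def headBlock : Prog := block [
  .arith .sub (sc 15) (sc 4) ⟨1, 2, 3⟩,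
  .arith .div (sc 15) sampleRefU (sc 15),
  .arith .sub (sc 15) (sc 21) (sc 15),
  .const (sc 14) 1]

def scaleBlock : Prog := block [
  .arith .div (sc 16) (sc 16) (sc 0),
  .arith .mul (sc 16) etaRef (sc 16)]

def suffixInit : Prog := block [.const (sc 14) 1, .idxCopy 6 0]

/-- One update with the sample `t`. -/
def stepProg : Prog := block [
  headBlock,
  .loop 5 0 forwardBody,
  suffixInit,
  .loop 5 0 backwardBody,
  .const (sc 16) 0,
  .loop 5 0 gradBody,
  scaleBlock,
  .loop 5 0 updateBody]

/-! ### Correctness of the loops of one update -/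

/-- The constant registers and scalars that the program relies on. -/
structure Base (σ : RAMState) : Prop where
  idx_two : σ.idx 2 = 0
  idx_seven : σ.idx 7 = 1
  idx_eight : σ.idx 8 = 2
  one : σ.mem 4 0 0 = 1
  zero : σ.mem 21 0 0 = 0

lemma Base.exec {σ : RAMState} (h : Base σ) {P : Prog} (h2 : 2 ∉ P.regs) (h7 : 7 ∉ P.regs)
    (h8 : 8 ∉ P.regs) (h4 : 4 ∉ P.arrs) (h21 : 21 ∉ P.arrs) : Base (P.exec σ).1 := by
  constructor
  · rw [exec_idx_of_notMem h2, h.1]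
  · rw [exec_idx_of_notMem h7, h.2]
  · rw [exec_idx_of_notMem h8, h.3]
  · rw [exec_mem_of_notMem h4, h.4]
  · rw [exec_mem_of_notMem h21, h.5]

/-- `exp (-v_j x_u x_j)` as read off the memory. -/
def expAt (σ : RAMState) (j : ℕ) : ℝ :=
  Real.exp (-(σ.mem 5 0 j - σ.mem 6 0 j) * σ.mem 2 (σ.idx 4) (σ.idx 3) * σ.mem 2 (σ.idx 4) j)

/-- The factor of the coordinate itself. -/
def coordFactor (σ : RAMState) (j : ℕ) : ℝ :=
  expAt σ j * σ.mem 2 (σ.idx 4) j / (1 - σ.mem 1 0 j)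

/-- The factor of another coordinate. -/
def otherFactor (σ : RAMState) (j : ℕ) : ℝ := (expAt σ j - σ.mem 1 0 j) / (1 - σ.mem 1 0 j)

lemma forwardBody_exec {σ : RAMState} (h : Base σ) :
    (∀ j, (forwardBody.exec σ).1.mem 7 0 j =
      if j = σ.idx 5 then σ.mem 7 0 j + (σ.mem 5 0 j - σ.mem 6 0 j) else σ.mem 7 0 j) ∧
    (∀ j, (forwardBody.exec σ).1.mem 8 0 j =
      if j = σ.idx 5 then coordFactor σ j else σ.mem 8 0 j) ∧
    (∀ j, (forwardBody.exec σ).1.mem 9 0 j =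
      if j = σ.idx 5 then otherFactor σ j else σ.mem 9 0 j) ∧
    (∀ j, (forwardBody.exec σ).1.mem 10 0 j =
      if j = σ.idx 5 then σ.mem 14 0 0 else σ.mem 10 0 j) ∧
    (forwardBody.exec σ).1.mem 14 0 0 = σ.mem 14 0 0 * otherFactor σ (σ.idx 5) := by
  obtain ⟨h2, h7, h8, h4, h21⟩ := h
  refine ⟨fun j => ?_, fun j => ?_, fun j => ?_, fun j => ?_, ?_⟩
  · simp only [forwardBody, block, Prog.exec, RAMState.get, RAMState.mem_set, RAMState.idx_set,
      ArithOp.eval]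
    by_cases hj : j = σ.idx 5 <;> simp [h2, hj]
  · simp only [forwardBody, block, Prog.exec, RAMState.get, RAMState.mem_set, RAMState.idx_set,
      ArithOp.eval]
    by_cases hj : j = σ.idx 5 <;> simp [h2, h4, h21, hj, coordFactor, expAt]
  · simp only [forwardBody, block, Prog.exec, RAMState.get, RAMState.mem_set, RAMState.idx_set,
      ArithOp.eval]
    by_cases hj : j = σ.idx 5 <;> simp [h2, h4, h21, hj, otherFactor, expAt]
  · simp only [forwardBody, block, Prog.exec, RAMState.get, RAMState.mem_set, RAMState.idx_set,
      ArithOp.eval]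
    by_cases hj : j = σ.idx 5 <;> simp [h2, hj]
  · simp only [forwardBody, block, Prog.exec, RAMState.get, RAMState.mem_set, RAMState.idx_set,
      ArithOp.eval]
    simp [h2, h4, h21, otherFactor, expAt]

/-- The scalar `14` carries the product of the factors seen so far. Array `7` is updated in place,
so the invariant also records that its entries from `k` on still have their old values. The vertex
`u` is treated like any other index. -/
lemma forward_loop {σ : RAMState} (h : Base σ) (h14 : σ.mem 14 0 0 = 1) :
    ∀ j < σ.idx 0,
      ((Prog.loop 5 0 forwardBody).exec σ).1.mem 7 0 j =
        σ.mem 7 0 j + (σ.mem 5 0 j - σ.mem 6 0 j) ∧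
      ((Prog.loop 5 0 forwardBody).exec σ).1.mem 8 0 j = coordFactor σ j ∧
      ((Prog.loop 5 0 forwardBody).exec σ).1.mem 9 0 j = otherFactor σ j ∧
      ((Prog.loop 5 0 forwardBody).exec σ).1.mem 10 0 j =
        ∏ i ∈ Finset.range j, otherFactor σ i := by
  refine (loop_induction (r := 5) (s := 0) (P := forwardBody) (σ := σ) (fun k τ =>
    (∀ j, k ≤ j → τ.mem 7 0 j = σ.mem 7 0 j) ∧
    τ.mem 14 0 0 = ∏ i ∈ Finset.range k, otherFactor σ i ∧
    ∀ j < k, τ.mem 7 0 j = σ.mem 7 0 j + (σ.mem 5 0 j - σ.mem 6 0 j) ∧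
      τ.mem 8 0 j = coordFactor σ j ∧ τ.mem 9 0 j = otherFactor σ j ∧
      τ.mem 10 0 j = ∏ i ∈ Finset.range j, otherFactor σ i) ?_ ?_).2.2
  · simp [h14]
  · intro k _ τ hmem hidx ⟨hI0, hI1, hI2⟩
    have hb : Base (τ.setIdx 5 k) := by
      constructor <;> simp [RAMState.idx_setIdx, hidx, hmem, forwardBody, block, regs, arrs, h.1,
        h.2, h.3, h.4, h.5]
    have he : ∀ j, expAt (τ.setIdx 5 k) j = expAt σ j := by
      intro j
      simp [expAt, RAMState.idx_setIdx, hidx, hmem, forwardBody, block, regs, arrs]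
    have hm1 : τ.mem 1 = σ.mem 1 := hmem 1 (by decide)
    have hm2 : τ.mem 2 = σ.mem 2 := hmem 2 (by decide)
    have hm5 : τ.mem 5 = σ.mem 5 := hmem 5 (by decide)
    have hm6 : τ.mem 6 = σ.mem 6 := hmem 6 (by decide)
    have hi4 : τ.idx 4 = σ.idx 4 := hidx 4 (by decide)
    have hc : ∀ j, coordFactor (τ.setIdx 5 k) j = coordFactor σ j := fun j => by
      simp [coordFactor, he, RAMState.idx_setIdx, hm1, hm2, hi4]
    have ho : ∀ j, otherFactor (τ.setIdx 5 k) j = otherFactor σ j := fun j => by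
      simp [otherFactor, he, hm1]
    obtain ⟨e7, e8, e9, e10, e14⟩ := forwardBody_exec hb
    simp only [hc, ho, RAMState.idx_setIdx, if_true, RAMState.mem_setIdx, hm5, hm6]
      at e7 e8 e9 e10 e14
    refine ⟨fun j hj => ?_, ?_, fun j hj => ?_⟩
    · rw [e7, if_neg (by omega), hI0 j (by omega)]
    · rw [e14, hI1, Finset.prod_range_succ]
    · rw [e7, e8, e9, e10]
      rcases Nat.lt_succ_iff_lt_or_eq.1 hj with hlt | rfl
      · simpa [hlt.ne] using hI2 j hlt
      · simp [hI0, hI1]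

lemma backwardBody_exec {σ : RAMState} (h : Base σ) :
    (backwardBody.exec σ).1.idx 6 = σ.idx 6 - 1 ∧
    (∀ j, (backwardBody.exec σ).1.mem 11 0 j =
      if j = σ.idx 6 - 1 then σ.mem 14 0 0 else σ.mem 11 0 j) ∧
    (backwardBody.exec σ).1.mem 14 0 0 = σ.mem 14 0 0 * σ.mem 9 0 (σ.idx 6 - 1) := by
  obtain ⟨h2, h7, h8, h4, h21⟩ := h
  refine ⟨?_, fun j => ?_, ?_⟩ <;>
  simp [backwardBody, block, Prog.exec, RAMState.get, RAMState.mem_set, RAMState.idx_setIdx,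
      ArithOp.eval, h2]

/-- Register `5` only counts rounds; the pointer `6` starts at `n` and is decremented before use.
The running product is stored before being multiplied, so the product stored at `j` excludes the
factor of `j`. -/
lemma backward_loop {σ : RAMState} (h : Base σ) (h14 : σ.mem 14 0 0 = 1)
    (h6 : σ.idx 6 = σ.idx 0) :
    ∀ j < σ.idx 0, ((Prog.loop 5 0 backwardBody).exec σ).1.mem 11 0 j =
      ∏ i ∈ Finset.Ico (j + 1) (σ.idx 0), σ.mem 9 0 i := by
  have key := (loop_induction (r := 5) (s := 0) (P := backwardBody) (σ := σ) (fun k τ =>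
    τ.idx 6 = σ.idx 0 - k ∧
    τ.mem 14 0 0 = ∏ i ∈ Finset.Ico (σ.idx 0 - k) (σ.idx 0), σ.mem 9 0 i ∧
    ∀ j < σ.idx 0, σ.idx 0 - k ≤ j →
      τ.mem 11 0 j = ∏ i ∈ Finset.Ico (j + 1) (σ.idx 0), σ.mem 9 0 i) ?_ ?_).2.2
  · intro j hj
    exact key j hj (by omega)
  · refine ⟨by simpa using h6, by simpa using h14, fun j hj hj' => by omega⟩
  · intro k hk τ hmem hidx ⟨hI0, hI1, hI2⟩
    have hb : Base (τ.setIdx 5 k) := by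
      constructor <;> simp [RAMState.idx_setIdx, hidx, hmem, backwardBody, block, regs, arrs, h.1,
        h.2, h.3, h.4, h.5]
    have hm9 : τ.mem 9 = σ.mem 9 := hmem 9 (by decide)
    obtain ⟨e6, e11, e14⟩ := backwardBody_exec hb
    have hidx6 : (τ.setIdx 5 k).idx 6 - 1 = σ.idx 0 - (k + 1) := by
      simp only [RAMState.idx_setIdx]
      rw [if_neg (by decide), hI0]
      omega
    have hsucc : σ.idx 0 - (k + 1) + 1 = σ.idx 0 - k := by omega
    rw [hidx6] at e6 e14
    simp only [hidx6, RAMState.mem_setIdx, hm9] at e11 e14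
    refine ⟨e6, ?_, fun j hj hj' => ?_⟩
    · rw [e14, hI1, Finset.prod_eq_prod_Ico_succ_bot (a := σ.idx 0 - (k + 1)) (by omega), hsucc,
        mul_comm]
    · rw [e11]
      split_ifs with hjk
      · rw [hI1, hjk, hsucc]
      · exact hI2 j hj (by omega)

/-- The gradient estimate as read off the memory. -/
def gradAt (σ : RAMState) (j : ℕ) : ℝ :=
  σ.mem 15 0 0 * σ.mem 8 0 j * (σ.mem 10 0 j * σ.mem 11 0 j)

lemma gradBody_exec {σ : RAMState} (h : Base σ) :
    (∀ j, (gradBody.exec σ).1.mem 12 0 j =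
      if j = σ.idx 5 then gradAt σ j else σ.mem 12 0 j) ∧
    (gradBody.exec σ).1.mem 16 0 0 = σ.mem 16 0 0 +
      (σ.mem 5 0 (σ.idx 5) * gradAt σ (σ.idx 5) - σ.mem 6 0 (σ.idx 5) * gradAt σ (σ.idx 5)) := by
  obtain ⟨h2, h7, h8, h4, h21⟩ := h
  refine ⟨fun j => ?_, ?_⟩
  · simp only [gradBody, block, Prog.exec, RAMState.get, RAMState.mem_set, RAMState.idx_set,
      ArithOp.eval]
    by_cases hj : j = σ.idx 5 <;> simp [h2, hj, gradAt]
  · simp only [gradBody, block, Prog.exec, RAMState.get, RAMState.mem_set, RAMState.idx_set,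
      ArithOp.eval]
    simp [h2, gradAt, add_sub_assoc]

lemma grad_loop {σ : RAMState} (h : Base σ) (h16 : σ.mem 16 0 0 = 0) :
    ((Prog.loop 5 0 gradBody).exec σ).1.mem 16 0 0 = ∑ i ∈ Finset.range (σ.idx 0),
      (σ.mem 5 0 i * gradAt σ i - σ.mem 6 0 i * gradAt σ i) ∧
    ∀ j < σ.idx 0, ((Prog.loop 5 0 gradBody).exec σ).1.mem 12 0 j = gradAt σ j := by
  refine loop_induction (r := 5) (s := 0) (P := gradBody) (σ := σ) (fun k τ =>
    τ.mem 16 0 0 = ∑ i ∈ Finset.range k,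
      (σ.mem 5 0 i * gradAt σ i - σ.mem 6 0 i * gradAt σ i) ∧
    ∀ j < k, τ.mem 12 0 j = gradAt σ j) ?_ ?_
  · simp [h16]
  · intro k _ τ hmem hidx ⟨hI1, hI2⟩
    have hb : Base (τ.setIdx 5 k) := by
      constructor <;> simp [RAMState.idx_setIdx, hidx, hmem, gradBody, block, regs, arrs, h.1,
        h.2, h.3, h.4, h.5]
    have hg : ∀ j, gradAt (τ.setIdx 5 k) j = gradAt σ j := fun j => by
      simp [gradAt, hmem, gradBody, block, arrs]
    have hm5 : τ.mem 5 = σ.mem 5 := hmem 5 (by decide)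
    have hm6 : τ.mem 6 = σ.mem 6 := hmem 6 (by decide)
    obtain ⟨e12, e16⟩ := gradBody_exec hb
    simp only [hg, RAMState.idx_setIdx, if_true, RAMState.mem_setIdx, hm5, hm6] at e12 e16
    refine ⟨by rw [e16, hI1, Finset.sum_range_succ], fun j hj => ?_⟩
    rw [e12]
    split_ifs with hjk
    · rfl
    · exact hI2 j (by omega)

lemma updateBody_exec {σ : RAMState} (h : Base σ) :
    (∀ j, (updateBody.exec σ).1.mem 5 0 j = if j = σ.idx 5 then
      σ.mem 5 0 j * (1 - σ.mem 0 0 1 * σ.mem 12 0 j + σ.mem 16 0 0) else σ.mem 5 0 j) ∧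
    (∀ j, (updateBody.exec σ).1.mem 6 0 j = if j = σ.idx 5 then
      σ.mem 6 0 j * (1 + σ.mem 0 0 1 * σ.mem 12 0 j + σ.mem 16 0 0) else σ.mem 6 0 j) := by
  obtain ⟨h2, h7, h8, h4, h21⟩ := h
  refine ⟨fun j => ?_, fun j => ?_⟩
  · simp only [updateBody, block, Prog.exec, RAMState.get, RAMState.mem_set, RAMState.idx_set,
      ArithOp.eval]
    by_cases hj : j = σ.idx 5 <;> simp [h2, h4, h7, hj]
  · simp only [updateBody, block, Prog.exec, RAMState.get, RAMState.mem_set, RAMState.idx_set,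
      ArithOp.eval]
    by_cases hj : j = σ.idx 5 <;> simp [h2, h4, h7, hj]

lemma update_loop {σ : RAMState} (h : Base σ) :
    ∀ j < σ.idx 0,
      ((Prog.loop 5 0 updateBody).exec σ).1.mem 5 0 j =
        σ.mem 5 0 j * (1 - σ.mem 0 0 1 * σ.mem 12 0 j + σ.mem 16 0 0) ∧
      ((Prog.loop 5 0 updateBody).exec σ).1.mem 6 0 j =
        σ.mem 6 0 j * (1 + σ.mem 0 0 1 * σ.mem 12 0 j + σ.mem 16 0 0) := by
  refine (loop_induction (r := 5) (s := 0) (P := updateBody) (σ := σ) (fun k τ =>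
    (∀ j, k ≤ j → τ.mem 5 0 j = σ.mem 5 0 j ∧ τ.mem 6 0 j = σ.mem 6 0 j) ∧
    ∀ j < k, τ.mem 5 0 j =
        σ.mem 5 0 j * (1 - σ.mem 0 0 1 * σ.mem 12 0 j + σ.mem 16 0 0) ∧
      τ.mem 6 0 j =
        σ.mem 6 0 j * (1 + σ.mem 0 0 1 * σ.mem 12 0 j + σ.mem 16 0 0)) ?_ ?_).2
  · simp
  · intro k _ τ hmem hidx ⟨hI1, hI2⟩
    have hb : Base (τ.setIdx 5 k) := by
      constructor <;> simp [RAMState.idx_setIdx, hidx, hmem, updateBody, block, regs, arrs, h.1,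
        h.2, h.3, h.4, h.5]
    have hm0 : τ.mem 0 = σ.mem 0 := hmem 0 (by decide)
    have hm12 : τ.mem 12 = σ.mem 12 := hmem 12 (by decide)
    have hm16 : τ.mem 16 = σ.mem 16 := hmem 16 (by decide)
    obtain ⟨e5, e6⟩ := updateBody_exec hb
    simp only [RAMState.idx_setIdx, if_true, RAMState.mem_setIdx, hm0, hm12, hm16] at e5 e6
    refine ⟨fun j hj => ?_, fun j hj => ?_⟩
    · rw [e5, e6, if_neg (by omega), if_neg (by omega)]
      exact hI1 j (by omega)
    · rw [e5, e6]
      split_ifs with hjk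
      · rw [(hI1 j (by omega)).1, (hI1 j (by omega)).2]
        exact ⟨rfl, rfl⟩
      · exact hI2 j (by omega)

lemma exec_block_cons (P : Prog) (Ps : List Prog) (σ : RAMState) :
    ((block (P :: Ps)).exec σ).1 = ((block Ps).exec (P.exec σ).1).1 := rfl

lemma exec_block_nil (σ : RAMState) : ((block []).exec σ).1 = σ := rfl

lemma headBlock_exec {σ : RAMState} (h : Base σ) :
    (headBlock.exec σ).1.mem 15 0 0 =
      -(σ.mem 2 (σ.idx 4) (σ.idx 3) / (1 - σ.mem 1 0 (σ.idx 3))) ∧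
    (headBlock.exec σ).1.mem 14 0 0 = 1 := by
  obtain ⟨h2, h7, h8, h4, h21⟩ := h
  constructor <;>
  simp [headBlock, block, Prog.exec, RAMState.get, RAMState.mem_set, ArithOp.eval, h2, h4, h21]

lemma suffixInit_exec {σ : RAMState} (h : Base σ) :
    (suffixInit.exec σ).1.mem 14 0 0 = 1 ∧ (suffixInit.exec σ).1.idx 6 = σ.idx 0 := by
  constructor <;>
  simp [suffixInit, block, Prog.exec, RAMState.mem_set, RAMState.idx_setIdx, h.1]

lemma scaleBlock_exec {σ : RAMState} (h : Base σ) :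
    (scaleBlock.exec σ).1.mem 16 0 0 = σ.mem 0 0 1 * (σ.mem 16 0 0 / σ.mem 0 0 0) := by
  simp [scaleBlock, block, Prog.exec, RAMState.get, RAMState.mem_set, ArithOp.eval, h.1, h.2]

/-- The gradient estimate in terms of the memory before the update. -/
def gradOf (σ : RAMState) (j : ℕ) : ℝ :=
  -(σ.mem 2 (σ.idx 4) (σ.idx 3) / (1 - σ.mem 1 0 (σ.idx 3))) * coordFactor σ j *
    ((∏ i ∈ Finset.range j, otherFactor σ i) *
      ∏ i ∈ Finset.Ico (j + 1) (σ.idx 0), otherFactor σ i)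

/-- The inner product of weights and gradient. -/
def innerOf (σ : RAMState) : ℝ :=
  ∑ i ∈ Finset.range (σ.idx 0), (σ.mem 5 0 i * gradOf σ i - σ.mem 6 0 i * gradOf σ i)

/-- The effect of one update. -/
lemma stepProg_exec {σ : RAMState} (h : Base σ) {j : ℕ} (hj : j < σ.idx 0) :
    (stepProg.exec σ).1.mem 7 0 j = σ.mem 7 0 j + (σ.mem 5 0 j - σ.mem 6 0 j) ∧
    (stepProg.exec σ).1.mem 5 0 j = σ.mem 5 0 j *
      (1 - σ.mem 0 0 1 * gradOf σ j + σ.mem 0 0 1 * (innerOf σ / σ.mem 0 0 0)) ∧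
    (stepProg.exec σ).1.mem 6 0 j = σ.mem 6 0 j *
      (1 + σ.mem 0 0 1 * gradOf σ j + σ.mem 0 0 1 * (innerOf σ / σ.mem 0 0 0)) := by
  simp only [stepProg, exec_block_cons, exec_block_nil]
  -- the factor of `u`
  obtain ⟨a15, a14⟩ := headBlock_exec h
  have b1 : Base (headBlock.exec σ).1 :=
    h.exec (by decide) (by decide) (by decide) (by decide) (by decide)
  have m1 : ∀ a ∉ [14, 15], (headBlock.exec σ).1.mem a = σ.mem a := fun a ha =>
    exec_mem_of_notMem (by simp [headBlock, block, arrs] at ha ⊢; omega) σ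
  have i1 : ∀ r, (headBlock.exec σ).1.idx r = σ.idx r := fun r =>
    exec_idx_of_notMem (by simp [headBlock, block, regs]) σ
  generalize (headBlock.exec σ).1 = σ₁ at *
  have hc : ∀ i, coordFactor σ₁ i = coordFactor σ i := fun i => by
    simp [coordFactor, expAt, m1, i1]
  have ho : ∀ i, otherFactor σ₁ i = otherFactor σ i := fun i => by
    simp [otherFactor, expAt, m1, i1]
  -- factors and prefix products
  have l2 := forward_loop b1 a14
  have b2 : Base ((Prog.loop 5 0 forwardBody).exec σ₁).1 :=
    b1.exec (by decide) (by decide) (by decide) (by decide) (by decide)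
  have m2 : ∀ a ∉ [7, 8, 9, 10, 14, 17, 18],
      ((Prog.loop 5 0 forwardBody).exec σ₁).1.mem a = σ₁.mem a := fun a ha =>
    exec_mem_of_notMem (by
      simp [forwardBody, block, arrs] at ha ⊢
      omega) σ₁
  have i2 : ((Prog.loop 5 0 forwardBody).exec σ₁).1.idx 0 = σ₁.idx 0 :=
    exec_idx_of_notMem (by decide) σ₁
  generalize ((Prog.loop 5 0 forwardBody).exec σ₁).1 = σ₂ at *
  -- suffix products
  obtain ⟨a14', a6⟩ := suffixInit_exec b2
  have b3 : Base (suffixInit.exec σ₂).1 :=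
    b2.exec (by decide) (by decide) (by decide) (by decide) (by decide)
  have m3 : ∀ a ≠ 14, (suffixInit.exec σ₂).1.mem a = σ₂.mem a := fun a ha =>
    exec_mem_of_notMem (by simpa [suffixInit, block, arrs] using ha) σ₂
  have i3 : (suffixInit.exec σ₂).1.idx 0 = σ₂.idx 0 := exec_idx_of_notMem (by decide) σ₂
  generalize (suffixInit.exec σ₂).1 = σ₃ at *
  have l4 := backward_loop b3 a14' (a6.trans i3.symm)
  have b4 : Base ((Prog.loop 5 0 backwardBody).exec σ₃).1 :=
    b3.exec (by decide) (by decide) (by decide) (by decide) (by decide)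
  have m4 : ∀ a ∉ [11, 14], ((Prog.loop 5 0 backwardBody).exec σ₃).1.mem a = σ₃.mem a :=
    fun a ha => exec_mem_of_notMem (by simpa [backwardBody, block, arrs] using ha) σ₃
  have i4 : ((Prog.loop 5 0 backwardBody).exec σ₃).1.idx 0 = σ₃.idx 0 :=
    exec_idx_of_notMem (by decide) σ₃
  generalize ((Prog.loop 5 0 backwardBody).exec σ₃).1 = σ₄ at *
  -- the gradient
  have a16 : ((Prog.const (sc 16) 0).exec σ₄).1.mem 16 0 0 = 0 := by
    simp [Prog.exec, RAMState.mem_set, b4.1]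
  have b5 : Base ((Prog.const (sc 16) 0).exec σ₄).1 :=
    b4.exec (by decide) (by decide) (by decide) (by decide) (by decide)
  have m5 : ∀ a ≠ 16, ((Prog.const (sc 16) 0).exec σ₄).1.mem a = σ₄.mem a := fun a ha =>
    exec_mem_of_notMem (by simpa [arrs] using ha) σ₄
  have i5 : ((Prog.const (sc 16) 0).exec σ₄).1.idx 0 = σ₄.idx 0 :=
    exec_idx_of_notMem (by decide) σ₄
  generalize ((Prog.const (sc 16) 0).exec σ₄).1 = σ₅ at *
  obtain ⟨l6, l6'⟩ := grad_loop b5 a16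
  have b6 : Base ((Prog.loop 5 0 gradBody).exec σ₅).1 :=
    b5.exec (by decide) (by decide) (by decide) (by decide) (by decide)
  have m6 : ∀ a ∉ [12, 16, 17], ((Prog.loop 5 0 gradBody).exec σ₅).1.mem a = σ₅.mem a :=
    fun a ha => exec_mem_of_notMem (by
      simp [gradBody, block, arrs] at ha ⊢
      omega) σ₅
  have i6 : ((Prog.loop 5 0 gradBody).exec σ₅).1.idx 0 = σ₅.idx 0 :=
    exec_idx_of_notMem (by decide) σ₅
  generalize ((Prog.loop 5 0 gradBody).exec σ₅).1 = σ₆ at *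
  have a16' := scaleBlock_exec b6
  have b7 : Base (scaleBlock.exec σ₆).1 :=
    b6.exec (by decide) (by decide) (by decide) (by decide) (by decide)
  have m7 : ∀ a ≠ 16, (scaleBlock.exec σ₆).1.mem a = σ₆.mem a := fun a ha =>
    exec_mem_of_notMem (by simpa [scaleBlock, block, arrs] using ha) σ₆
  have i7 : (scaleBlock.exec σ₆).1.idx 0 = σ₆.idx 0 := exec_idx_of_notMem (by decide) σ₆
  generalize (scaleBlock.exec σ₆).1 = σ₇ at *
  -- the update
  have l8 := update_loop b7
  have m8 : ((Prog.loop 5 0 updateBody).exec σ₇).1.mem 7 = σ₇.mem 7 :=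
    exec_mem_of_notMem (by decide) σ₇
  have n1 := i1 0
  have hg : ∀ i < σ.idx 0, gradAt σ₅ i = gradOf σ i := by
    intro i hi
    obtain ⟨-, q8, q9, q10⟩ := l2 i (by omega)
    have q11 := l4 i (by omega)
    have hp : ∏ i ∈ Finset.Ico (i + 1) (σ₃.idx 0), σ₃.mem 9 0 i =
        ∏ i ∈ Finset.Ico (i + 1) (σ.idx 0), otherFactor σ i := by
      rw [i3, i2, n1]
      refine Finset.prod_congr rfl fun k hk => ?_
      rw [m3 9 (by decide), (l2 k (by have := Finset.mem_Ico.1 hk; omega)).2.2.1, ho]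
    rw [gradAt, m5 15 (by decide), m5 8 (by decide), m5 10 (by decide), m5 11 (by decide), q11, hp,
      m4 15 (by decide), m4 8 (by decide), m4 10 (by decide), m3 15 (by decide), m3 8 (by decide),
      m3 10 (by decide), q8, q10, m2 15 (by decide), a15, gradOf, hc]
    simp only [ho]
  have w5 : ∀ a ∈ [5, 6, 0], σ₅.mem a = σ.mem a := by
    intro a ha
    simp only [List.mem_cons, List.not_mem_nil, or_false] at ha
    rcases ha with rfl | rfl | rfl <;>
    rw [m5 _ (by decide), m4 _ (by decide), m3 _ (by decide), m2 _ (by decide), m1 _ (by decide)]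
  have w7 : ∀ a ∈ [5, 6, 0], σ₇.mem a = σ.mem a := by
    intro a ha
    rw [← w5 a ha]
    simp only [List.mem_cons, List.not_mem_nil, or_false] at ha
    rcases ha with rfl | rfl | rfl <;> rw [m7 _ (by decide), m6 _ (by decide)]
  have hinner : σ₇.mem 16 0 0 = σ.mem 0 0 1 * (innerOf σ / σ.mem 0 0 0) := by
    rw [a16', m6 0 (by decide), w5 0 (by decide), l6, w5 5 (by decide), w5 6 (by decide),
      show σ₅.idx 0 = σ.idx 0 by omega, innerOf]
    congr 2
    exact Finset.sum_congr rfl fun i hi => by rw [hg i (Finset.mem_range.1 hi)]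
  have hgrad : σ₇.mem 12 0 j = gradOf σ j := by
    rw [m7 12 (by decide), l6' j (by omega), hg j hj]
  obtain ⟨r5, r6⟩ := l8 j (by omega)
  refine ⟨?_, ?_, ?_⟩
  · rw [m8, m7 7 (by decide), m6 7 (by decide), m5 7 (by decide), m4 7 (by decide),
      m3 7 (by decide), (l2 j (by omega)).1, m1 7 (by decide), m1 5 (by decide), m1 6 (by decide)]
  · rw [r5, hgrad, hinner, w7 5 (by decide), w7 0 (by decide)]
  · rw [r6, hgrad, hinner, w7 6 (by decide), w7 0 (by decide)]

/-! ### Setup, initialization, thresholding and the full program -/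

def constBlock : Prog := block [
  .idxConst 7 1,
  .idxConst 8 2,
  .const (sc 4) 1,
  .const (sc 21) 0,
  .const (sc 13) (-1),
  .const (sc 19) 0]

def sizeBody : Prog := block [
  .arith .add (sc 13) (sc 13) (sc 4),
  .arith .add (sc 13) (sc 13) (sc 4)]

def countBody : Prog := .arith .add (sc 19) (sc 19) (sc 4)

def paramBlock : Prog := block [
  .arith .div (sc 13) (sc 0) (sc 13),
  .const (sc 20) 2,
  .arith .div (sc 20) betaRef (sc 20)]

/-- Constants, the initial weight, the number of samples and the threshold. -/
def setupProg : Prog := block [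
  constBlock,
  .loop 5 0 sizeBody,
  .loop 5 1 countBody,
  paramBlock]

def initBody : Prog := block [
  .copy (vec 5) (sc 13),
  .copy (vec 6) (sc 13),
  .const (vec 7) 0]

/-- The weights at `u` itself are kept at `0`. -/
def initFix : Prog := block [.const ⟨5, 2, 3⟩ 0, .const ⟨6, 2, 3⟩ 0]

def thresholdBody : Prog := block [
  .arith .div (sc 17) (vec 7) (sc 19),
  .ifLe (sc 20) (sc 17) (.const ⟨3, 3, 5⟩ 1) (block [
    .arith .sub (sc 17) (sc 21) (sc 17),
    .ifLe (sc 20) (sc 17) (.const ⟨3, 3, 5⟩ 1) (.const ⟨3, 3, 5⟩ 0)])]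

/-- The algorithm for one vertex. -/
def vertexProg : Prog := block [
  .loop 5 0 initBody,
  initFix,
  .loop 4 1 stepProg,
  .loop 5 0 thresholdBody,
  .const ⟨3, 3, 3⟩ 0]

/-- The algorithm for all vertices. -/
def mainProg : Prog := block [setupProg, .loop 3 0 vertexProg]

/-- What holds after the setup, and until the end. -/
structure Ready {n T : ℕ} (p : Fin n → ℝ) (lam η β : ℝ) (X : Fin T → Fin n → Entry)
    (σ : RAMState) : Prop where
  base : Base σ
  idx_zero : σ.idx 0 = n
  idx_one : σ.idx 1 = T
  input : ∀ a ∈ [0, 1, 2], σ.mem a = (inputState p lam η β X).mem a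
  start : σ.mem 13 0 0 = lam / (2 * (n : ℝ) - 1)
  count : σ.mem 19 0 0 = T
  threshold : σ.mem 20 0 0 = β / 2

section Ready

variable {n T : ℕ} {p : Fin n → ℝ} {lam η β : ℝ} {X : Fin T → Fin n → Entry} {σ τ : RAMState}

lemma Ready.congr (h : Ready p lam η β X σ) (hidx : ∀ r ∈ [0, 1, 2, 7, 8], τ.idx r = σ.idx r)
    (hmem : ∀ a ∈ [0, 1, 2, 4, 13, 19, 20, 21], τ.mem a = σ.mem a) : Ready p lam η β X τ := by
  refine ⟨⟨?_, ?_, ?_, ?_, ?_⟩, ?_, ?_, fun a ha => ?_, ?_, ?_, ?_⟩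
  · rw [hidx 2 (by decide), h.base.1]
  · rw [hidx 7 (by decide), h.base.2]
  · rw [hidx 8 (by decide), h.base.3]
  · rw [hmem 4 (by decide), h.base.4]
  · rw [hmem 21 (by decide), h.base.5]
  · rw [hidx 0 (by decide), h.idx_zero]
  · rw [hidx 1 (by decide), h.idx_one]
  · rw [hmem a (by simp at ha ⊢; omega), h.input a ha]
  · rw [hmem 13 (by decide), h.start]
  · rw [hmem 19 (by decide), h.count]
  · rw [hmem 20 (by decide), h.threshold]

lemma Ready.exec (h : Ready p lam η β X σ) {P : Prog} (hidx : ∀ r ∈ [0, 1, 2, 7, 8], r ∉ P.regs)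
    (hmem : ∀ a ∈ [0, 1, 2, 4, 13, 19, 20, 21], a ∉ P.arrs) : Ready p lam η β X (P.exec σ).1 :=
  h.congr (fun r hr => exec_idx_of_notMem (hidx r hr) σ)
    fun a ha => exec_mem_of_notMem (hmem a ha) σ

lemma Ready.lam_eq (h : Ready p lam η β X σ) : σ.mem 0 0 0 = lam := by
  rw [h.input 0 (by decide)]; simp [inputState]

lemma Ready.eta_eq (h : Ready p lam η β X σ) : σ.mem 0 0 1 = η := by
  rw [h.input 0 (by decide)]; simp [inputState]

lemma Ready.p_eq (h : Ready p lam η β X σ) (j : Fin n) : σ.mem 1 0 j = p j := by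
  rw [h.input 1 (by decide)]; simp [inputState]

lemma Ready.sample_eq (h : Ready p lam η β X σ) (t : Fin T) (j : Fin n) :
    σ.mem 2 t j = entryVal (X t j) := by
  rw [h.input 2 (by decide)]; simp [inputState]

/-! #### The setup -/

/-- An index register cannot be read as a real number, so $2n-1$ is counted up from $-1$ by two
additions per vertex. -/
lemma size_loop (h : Base σ) (h13 : σ.mem 13 0 0 = -1) :
    ((Prog.loop 5 0 sizeBody).exec σ).1.mem 13 0 0 = 2 * (σ.idx 0 : ℝ) - 1 := by
  refine loop_induction (r := 5) (s := 0) (P := sizeBody) (σ := σ)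
    (fun k τ => τ.mem 13 0 0 = 2 * (k : ℝ) - 1) (by simp [h13]) ?_
  intro k _ τ hmem hidx hI
  have h2 : τ.idx 2 = 0 := by rw [hidx 2 (by decide), h.1]
  have h4 : τ.mem 4 0 0 = 1 := by rw [hmem 4 (by decide), h.4]
  simp only [sizeBody, block, Prog.exec, RAMState.get, RAMState.mem_set, RAMState.idx_set,
    RAMState.idx_setIdx, RAMState.mem_setIdx, ArithOp.eval]
  simp [h2, h4, hI]
  ring

lemma count_loop (h : Base σ) (h19 : σ.mem 19 0 0 = 0) :
    ((Prog.loop 5 1 countBody).exec σ).1.mem 19 0 0 = (σ.idx 1 : ℝ) := by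
  refine loop_induction (r := 5) (s := 1) (P := countBody) (σ := σ)
    (fun k τ => τ.mem 19 0 0 = (k : ℝ)) (by simp [h19]) ?_
  intro k _ τ hmem hidx hI
  have h2 : τ.idx 2 = 0 := by rw [hidx 2 (by decide), h.1]
  have h4 : τ.mem 4 0 0 = 1 := by rw [hmem 4 (by decide), h.4]
  simp only [countBody, Prog.exec, RAMState.get, RAMState.mem_set,
    RAMState.idx_setIdx, RAMState.mem_setIdx, ArithOp.eval]
  simp [h2, h4, hI]

lemma setupProg_exec (p : Fin n → ℝ) (lam η β : ℝ) (X : Fin T → Fin n → Entry) :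
    Ready p lam η β X (setupProg.exec (inputState p lam η β X)).1 := by
  set σ₀ := inputState p lam η β X with hσ₀
  have h2 : σ₀.idx 2 = 0 := by simp [hσ₀, inputState]
  simp only [setupProg, exec_block_cons, exec_block_nil]
  have b1 : Base (constBlock.exec σ₀).1 := by
    constructor <;>
    simp [constBlock, block, Prog.exec, RAMState.mem_set, RAMState.idx_setIdx, h2]
  have a13 : (constBlock.exec σ₀).1.mem 13 0 0 = -1 := by
    simp [constBlock, block, Prog.exec, RAMState.mem_set, RAMState.idx_setIdx, h2]
  have a19 : (constBlock.exec σ₀).1.mem 19 0 0 = 0 := by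
    simp [constBlock, block, Prog.exec, RAMState.mem_set, RAMState.idx_setIdx, h2]
  have i1 : ∀ r ∈ [0, 1], (constBlock.exec σ₀).1.idx r = σ₀.idx r := fun r hr =>
    exec_idx_of_notMem (by revert r; decide) σ₀
  have m1 : ∀ a ∈ [0, 1, 2], (constBlock.exec σ₀).1.mem a = σ₀.mem a := fun a ha =>
    exec_mem_of_notMem (by revert a; decide) σ₀
  generalize (constBlock.exec σ₀).1 = σ₁ at *
  have a13' := size_loop b1 a13
  have b2 : Base ((Prog.loop 5 0 sizeBody).exec σ₁).1 :=
    b1.exec (by decide) (by decide) (by decide) (by decide) (by decide)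
  have i2 : ∀ r ∈ [0, 1], ((Prog.loop 5 0 sizeBody).exec σ₁).1.idx r = σ₁.idx r := fun r hr =>
    exec_idx_of_notMem (by revert r; decide) σ₁
  have m2 : ∀ a ∈ [0, 1, 2, 19], ((Prog.loop 5 0 sizeBody).exec σ₁).1.mem a = σ₁.mem a :=
    fun a ha => exec_mem_of_notMem (by revert a; decide) σ₁
  generalize ((Prog.loop 5 0 sizeBody).exec σ₁).1 = σ₂ at *
  have a19' := count_loop b2 (by rw [m2 19 (by decide), a19])
  have b3 : Base ((Prog.loop 5 1 countBody).exec σ₂).1 :=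
    b2.exec (by decide) (by decide) (by decide) (by decide) (by decide)
  have i3 : ∀ r ∈ [0, 1], ((Prog.loop 5 1 countBody).exec σ₂).1.idx r = σ₂.idx r := fun r hr =>
    exec_idx_of_notMem (by revert r; decide) σ₂
  have m3 : ∀ a ∈ [0, 1, 2, 13], ((Prog.loop 5 1 countBody).exec σ₂).1.mem a = σ₂.mem a :=
    fun a ha => exec_mem_of_notMem (by revert a; decide) σ₂
  generalize ((Prog.loop 5 1 countBody).exec σ₂).1 = σ₃ at *
  have b4 : Base (paramBlock.exec σ₃).1 :=
    b3.exec (by decide) (by decide) (by decide) (by decide) (by decide)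
  have i4 : ∀ r ∈ [0, 1], (paramBlock.exec σ₃).1.idx r = σ₃.idx r := fun r hr =>
    exec_idx_of_notMem (by revert r; decide) σ₃
  have m4 : ∀ a ∈ [0, 1, 2, 19], (paramBlock.exec σ₃).1.mem a = σ₃.mem a := fun a ha =>
    exec_mem_of_notMem (by revert a; decide) σ₃
  have hin : ∀ a ∈ [0, 1, 2], σ₃.mem a = σ₀.mem a := fun a ha => by
    rw [m3 a (by simp at ha ⊢; omega), m2 a (by simp at ha ⊢; omega), m1 a ha]
  have n0 : σ₁.idx 0 = n := by rw [i1 0 (by decide)]; rfl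
  have n1 : σ₁.idx 1 = T := by rw [i1 1 (by decide)]; rfl
  refine ⟨b4, ?_, ?_, fun a ha => ?_, ?_, ?_, ?_⟩
  · rw [i4 0 (by decide), i3 0 (by decide), i2 0 (by decide), n0]
  · rw [i4 1 (by decide), i3 1 (by decide), i2 1 (by decide), n1]
  · rw [m4 a (by simp at ha ⊢; omega), hin a ha]
  · have : (paramBlock.exec σ₃).1.mem 13 0 0 = σ₃.mem 0 0 0 / σ₃.mem 13 0 0 := by
      simp [paramBlock, block, Prog.exec, RAMState.get, RAMState.mem_set, ArithOp.eval, b3.1]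
    rw [this, hin 0 (by decide), m3 13 (by decide), a13', n0]
    simp [hσ₀, inputState]
  · rw [m4 19 (by decide), a19', i2 1 (by decide), n1]
  · have : (paramBlock.exec σ₃).1.mem 20 0 0 = σ₃.mem 0 0 2 / 2 := by
      simp [paramBlock, block, Prog.exec, RAMState.get, RAMState.mem_set, ArithOp.eval, b3.1, b3.3]
    rw [this, hin 0 (by decide)]
    simp [hσ₀, inputState]

end Ready

/-! ### The memory follows the iterates -/

/-- The memory holds the weights `w`, and `0` at the vertex `u` itself. -/
structure Weights {n : ℕ} (u : Fin n) (w : Coord u → ℝ) (σ : RAMState) : Prop where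
  pos : ∀ j : Others u, σ.mem 5 0 j = w (.pos j)
  neg : ∀ j : Others u, σ.mem 6 0 j = w (.neg j)
  pos_self : σ.mem 5 0 u = 0
  neg_self : σ.mem 6 0 u = 0

/-- Replace the factor at `i` by `1`; both sides are then the product over all indices. The factor
of `u` stands apart because the estimator's product omits it. -/
lemma prod_range_mul_prod_Ico {n : ℕ} {u : Fin n} (f : ℕ → ℝ) (i : Others u) :
    (∏ k ∈ Finset.range i, f k) * ∏ k ∈ Finset.Ico ((i : ℕ) + 1) n, f k =
      f u * ∏ j ∈ Finset.univ.erase i, f (j : Others u) := by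
  set f' := Function.update f (i : ℕ) 1 with hf'
  have hne : ∀ k, k ≠ (i : ℕ) → f' k = f k := fun k hk => by simp [hf', hk]
  have hi : f' i = 1 := by simp [hf']
  have h1 : ∏ k ∈ Finset.range n, f' k =
      (∏ k ∈ Finset.range i, f k) * ∏ k ∈ Finset.Ico ((i : ℕ) + 1) n, f k := by
    rw [← Finset.prod_range_mul_prod_Ico f' i.1.2.le,
      Finset.prod_eq_prod_Ico_succ_bot i.1.2, hi, one_mul]
    congr 1
    · exact Finset.prod_congr rfl fun k hk => hne k (Finset.mem_range.1 hk).ne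
    · exact Finset.prod_congr rfl fun k hk => hne k (by have := Finset.mem_Ico.1 hk; omega)
  have h2 := prod_univ_eq_mul_mul_prod_erase (fun k : Fin n => f' k) i
  rw [← h1, ← Fin.prod_univ_eq_prod_range f' n, h2, hi, mul_one,
    hne u fun e => i.2 (Fin.ext e.symm)]
  congr 1
  refine Finset.prod_congr rfl fun j hj => hne j fun e => ?_
  exact Finset.ne_of_mem_erase hj (Subtype.ext (Fin.ext e))

section

variable {n T : ℕ} {p : Fin n → ℝ} {lam η β : ℝ} {X : Fin T → Fin n → Entry} {σ τ : RAMState}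
  {u : Fin n} {t : Fin T} {w : Coord u → ℝ}

lemma gradOf_eq (h : Ready p lam η β X σ) (hu : σ.idx 3 = u) (ht : σ.idx 4 = t)
    (hw : Weights u w σ) (i : Others u) : gradOf σ i = gMiss p w (X t) i := by
  have he : ∀ j : Others u, expAt σ j =
      Real.exp (-(simplexToBall w j) * entryVal (X t u) * entryVal (X t j)) := fun j => by
    rw [expAt, hu, ht, h.sample_eq t u, h.sample_eq t j, hw.pos, hw.neg, simplexToBall]
  have ho : ∀ j : Others u, otherFactor σ j =
      (Real.exp (-(simplexToBall w j) * entryVal (X t u) * entryVal (X t j)) - p j) /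
        (1 - p j) := fun j => by
    rw [otherFactor, he, h.p_eq]
  rw [gradOf, gMiss, h.idx_zero, prod_range_mul_prod_Ico, coordFactor, he, hu, ht,
    h.sample_eq t u, h.sample_eq t i, h.p_eq u, h.p_eq i]
  simp_rw [ho]
  -- The program's product contains an extra factor for `u`. Zero weights there make it
  -- $(1-p_u)/(1-p_u)=1$; if `p u = 1`, division by zero makes the head factor, and so both sides,
  -- vanish.
  by_cases hp : 1 - p u = 0
  · simp [hp]
  · have : otherFactor σ u = 1 := by
      rw [otherFactor, expAt, hw.pos_self, hw.neg_self, h.p_eq]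
      simp [div_self hp]
    rw [this, one_mul]

/-- The slack coordinate has zero gradient, so its weight need not be stored; the vertex `u` drops
out because its weights are zero. -/
lemma innerOf_eq (h : Ready p lam η β X σ) (hu : σ.idx 3 = u) (ht : σ.idx 4 = t)
    (hw : Weights u w σ) : innerOf σ = ∑ d, w d * GMiss p w (X t) d := by
  rw [sum_mul_GMiss, innerOf, h.idx_zero,
    ← Fin.sum_univ_eq_sum_range (fun i => σ.mem 5 0 i * gradOf σ i - σ.mem 6 0 i * gradOf σ i),
    ← sum_others (u := u) (fun i : Fin n => σ.mem 5 0 i * gradOf σ i - σ.mem 6 0 i * gradOf σ i)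
      (by simp [hw.pos_self, hw.neg_self])]
  refine Finset.sum_congr rfl fun i _ => ?_
  rw [gradOf_eq h hu ht hw, hw.pos, hw.neg, simplexToBall, sub_mul]

lemma stepProg_weights (h : Ready p lam η β X σ) (hu : σ.idx 3 = u) (ht : σ.idx 4 = t)
    (hw : Weights u w σ) :
    Weights u (smgStep p lam η w (X t)) (stepProg.exec σ).1 ∧
    ∀ j : Others u, (stepProg.exec σ).1.mem 7 0 j = σ.mem 7 0 j + simplexToBall w j := by
  have hs : ∀ j : Fin n, _ := fun j =>
    stepProg_exec h.base (j := j) (by rw [h.idx_zero]; exact j.2)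
  refine ⟨⟨fun j => ?_, fun j => ?_, ?_, ?_⟩, fun j => ?_⟩
  · rw [(hs j).2.1, h.eta_eq, h.lam_eq, innerOf_eq h hu ht hw, gradOf_eq h hu ht hw, hw.pos]
    rfl
  · rw [(hs j).2.2, h.eta_eq, h.lam_eq, innerOf_eq h hu ht hw, gradOf_eq h hu ht hw, hw.neg,
      smgStep, GMiss]
    ring
  · rw [(hs u).2.1, hw.pos_self, zero_mul]
  · rw [(hs u).2.2, hw.neg_self, zero_mul]
  · rw [(hs j).1, hw.pos, hw.neg, simplexToBall]

/-- Each round adds the current iterate before updating it, so the sum covers iterates `0` to `T -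
1`, as the average requires. -/
lemma sample_loop (h : Ready p lam η β X σ) (hu : σ.idx 3 = u)
    (hw : Weights u (fun _ => lam / (2 * (n : ℝ) - 1)) σ)
    (h7 : ∀ j : Others u, σ.mem 7 0 j = 0) (j : Others u) :
    ((Prog.loop 4 1 stepProg).exec σ).1.mem 7 0 j =
      ∑ s ∈ Finset.range T, simplexToBall (smgIter u p lam η X s) j := by
  have key := (loop_induction (r := 4) (s := 1) (P := stepProg) (σ := σ)
    (fun k τ => Weights u (smgIter u p lam η X k) τ ∧ ∀ j : Others u, τ.mem 7 0 j =
      ∑ s ∈ Finset.range k, simplexToBall (smgIter u p lam η X s) j)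
    ⟨hw, by simpa using h7⟩ ?_).2 j
  · rwa [h.idx_one] at key
  intro k hk τ hmem hidx ⟨hI1, hI2⟩
  rw [h.idx_one] at hk
  have hr : Ready p lam η β X (τ.setIdx 4 k) := by
    refine h.congr (fun r hr => ?_) fun a ha => ?_
    · rw [RAMState.idx_setIdx, if_neg (by rintro rfl; simp at hr), hidx r (by revert r; decide)]
    · rw [RAMState.mem_setIdx, hmem a (by revert a; decide)]
  have hu' : (τ.setIdx 4 k).idx 3 = u := by
    rw [RAMState.idx_setIdx, if_neg (by decide), hidx 3 (by decide), hu]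
  have ht' : (τ.setIdx 4 k).idx 4 = (⟨k, hk⟩ : Fin T) := by
    rw [RAMState.idx_setIdx, if_pos rfl]
  have hw' : Weights u (smgIter u p lam η X k) (τ.setIdx 4 k) := ⟨hI1.1, hI1.2, hI1.3, hI1.4⟩
  obtain ⟨s1, s2⟩ := stepProg_weights hr hu' ht' hw'
  refine ⟨?_, fun j => ?_⟩
  · rwa [smgIter_succ u p lam η X ⟨k, hk⟩]
  · rw [s2, RAMState.mem_setIdx, hI2, Finset.sum_range_succ]

/-! #### Initialization and thresholding -/

lemma init_loop (h : Ready p lam η β X σ) :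
    ∀ j < n, ((Prog.loop 5 0 initBody).exec σ).1.mem 5 0 j = lam / (2 * (n : ℝ) - 1) ∧
      ((Prog.loop 5 0 initBody).exec σ).1.mem 6 0 j = lam / (2 * (n : ℝ) - 1) ∧
      ((Prog.loop 5 0 initBody).exec σ).1.mem 7 0 j = 0 := by
  have key := loop_induction (r := 5) (s := 0) (P := initBody) (σ := σ)
    (fun k τ => ∀ j < k, τ.mem 5 0 j = lam / (2 * (n : ℝ) - 1) ∧
      τ.mem 6 0 j = lam / (2 * (n : ℝ) - 1) ∧ τ.mem 7 0 j = 0) (by simp) ?_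
  · rwa [h.idx_zero] at key
  intro k _ τ hmem hidx hI j hj
  have h2 : τ.idx 2 = 0 := by rw [hidx 2 (by decide), h.base.1]
  have h13 : τ.mem 13 0 0 = lam / (2 * (n : ℝ) - 1) := by rw [hmem 13 (by decide), h.start]
  simp only [initBody, block, Prog.exec, RAMState.get, RAMState.mem_set, RAMState.idx_set,
    RAMState.idx_setIdx, RAMState.mem_setIdx]
  by_cases hjk : j = k
  · simp [h2, h13, hjk]
  · simpa [h2, hjk] using hI j (by omega)

lemma initFix_exec (h : Base σ) :
    (∀ j, (initFix.exec σ).1.mem 5 0 j = if j = σ.idx 3 then 0 else σ.mem 5 0 j) ∧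
    ∀ j, (initFix.exec σ).1.mem 6 0 j = if j = σ.idx 3 then 0 else σ.mem 6 0 j := by
  constructor <;> intro j <;> simp [initFix, block, Prog.exec, RAMState.mem_set, h.1]

lemma thresholdBody_exec (h : Base σ) (i j : ℕ) :
    (thresholdBody.exec σ).1.mem 3 i j = if i = σ.idx 3 ∧ j = σ.idx 5 then
      (if σ.mem 20 0 0 ≤ |σ.mem 7 0 j / σ.mem 19 0 0| then 1 else 0) else σ.mem 3 i j := by
  obtain ⟨h2, h7, h8, h4, h21⟩ := h
  simp only [thresholdBody, block, Prog.exec, RAMState.get, RAMState.mem_set, RAMState.idx_set,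
    ArithOp.eval]
  simp only [h2, le_abs]
  by_cases hij : i = σ.idx 3 ∧ j = σ.idx 5
  · obtain ⟨rfl, rfl⟩ := hij
    by_cases c1 : σ.mem 20 0 0 ≤ σ.mem 7 0 (σ.idx 5) / σ.mem 19 0 0
    · simp [c1, RAMState.mem_set]
    · by_cases c2 : σ.mem 20 0 0 ≤ -(σ.mem 7 0 (σ.idx 5) / σ.mem 19 0 0)
      · simp [c1, c2, h21, RAMState.mem_set]
      · simp [c1, c2, h21, RAMState.mem_set]
  · rw [if_neg hij]
    split_ifs <;> simp [RAMState.mem_set, hij]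

lemma threshold_loop (h : Ready p lam η β X σ) :
    (∀ j < n, ((Prog.loop 5 0 thresholdBody).exec σ).1.mem 3 (σ.idx 3) j =
      if β / 2 ≤ |σ.mem 7 0 j / T| then 1 else 0) ∧
    ∀ i ≠ σ.idx 3, ∀ j, ((Prog.loop 5 0 thresholdBody).exec σ).1.mem 3 i j = σ.mem 3 i j := by
  have key := loop_induction (r := 5) (s := 0) (P := thresholdBody) (σ := σ)
    (fun k τ => (∀ j < k, τ.mem 3 (σ.idx 3) j = if β / 2 ≤ |σ.mem 7 0 j / T| then 1 else 0) ∧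
      ∀ i ≠ σ.idx 3, ∀ j, τ.mem 3 i j = σ.mem 3 i j) (by simp) ?_
  · rwa [h.idx_zero] at key
  intro k _ τ hmem hidx ⟨hI1, hI2⟩
  have hr : Ready p lam η β X (τ.setIdx 5 k) := by
    refine h.congr (fun r hr => ?_) fun a ha => ?_
    · rw [RAMState.idx_setIdx, if_neg (by rintro rfl; simp at hr), hidx r (by revert r; decide)]
    · rw [RAMState.mem_setIdx, hmem a (by revert a; decide)]
  have hb := thresholdBody_exec hr.base
  rw [hr.threshold, hr.count] at hb
  have h3 : (τ.setIdx 5 k).idx 3 = σ.idx 3 := by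
    rw [RAMState.idx_setIdx, if_neg (by decide), hidx 3 (by decide)]
  have h5 : (τ.setIdx 5 k).idx 5 = k := by rw [RAMState.idx_setIdx, if_pos rfl]
  have m7 : τ.mem 7 = σ.mem 7 := hmem 7 (by decide)
  rw [h3, h5, RAMState.mem_setIdx, m7] at hb
  refine ⟨fun j hj => ?_, fun i hi j => ?_⟩
  · rw [hb]
    by_cases hjk : j = k
    · simp [hjk]
    · rw [if_neg (by simp [hjk])]
      exact hI1 j (by omega)
  · rw [hb, if_neg (by simp [hi]), hI2 i hi j]

/-! #### Correctness and running time -/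

lemma vertexProg_exec (h : Ready p lam η β X σ) (hu : σ.idx 3 = u) :
    (∀ i : Fin n, (vertexProg.exec σ).1.mem 3 u i =
      (estNeighbors p lam η β X u).indicator (fun _ => (1 : ℝ)) i) ∧
    ∀ r ≠ (u : ℕ), ∀ j, (vertexProg.exec σ).1.mem 3 r j = σ.mem 3 r j := by
  simp only [vertexProg, exec_block_cons, exec_block_nil]
  have l1 := init_loop h
  have r1 : Ready p lam η β X ((Prog.loop 5 0 initBody).exec σ).1 :=
    h.exec (by decide) (by decide)
  have u1 : ((Prog.loop 5 0 initBody).exec σ).1.idx 3 = u := by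
    rw [exec_idx_of_notMem (by decide), hu]
  have o1 : ((Prog.loop 5 0 initBody).exec σ).1.mem 3 = σ.mem 3 :=
    exec_mem_of_notMem (by decide) σ
  generalize ((Prog.loop 5 0 initBody).exec σ).1 = σ₁ at *
  obtain ⟨l2, l2'⟩ := initFix_exec r1.base
  have r2 : Ready p lam η β X (initFix.exec σ₁).1 := r1.exec (by decide) (by decide)
  have u2 : (initFix.exec σ₁).1.idx 3 = u := by rw [exec_idx_of_notMem (by decide), u1]
  have o2 : (initFix.exec σ₁).1.mem 3 = σ₁.mem 3 := exec_mem_of_notMem (by decide) σ₁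
  have s2 : (initFix.exec σ₁).1.mem 7 = σ₁.mem 7 := exec_mem_of_notMem (by decide) σ₁
  generalize (initFix.exec σ₁).1 = σ₂ at *
  have hne : ∀ j : Others u, ((j : Fin n) : ℕ) ≠ u := fun j e => j.2 (Fin.ext e)
  have hw : Weights u (fun _ => lam / (2 * (n : ℝ) - 1)) σ₂ := by
    constructor
    · intro j; rw [l2, u1, if_neg (hne j), (l1 j j.1.2).1]
    · intro j; rw [l2', u1, if_neg (hne j), (l1 j j.1.2).2.1]
    · rw [l2, u1, if_pos rfl]
    · rw [l2', u1, if_pos rfl]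
  have l3 := sample_loop r2 u2 hw fun j => by rw [s2, (l1 j j.1.2).2.2]
  have r3 : Ready p lam η β X ((Prog.loop 4 1 stepProg).exec σ₂).1 :=
    r2.exec (by decide) (by decide)
  have u3 : ((Prog.loop 4 1 stepProg).exec σ₂).1.idx 3 = u := by
    rw [exec_idx_of_notMem (by decide), u2]
  have o3 : ((Prog.loop 4 1 stepProg).exec σ₂).1.mem 3 = σ₂.mem 3 :=
    exec_mem_of_notMem (by decide) σ₂
  generalize ((Prog.loop 4 1 stepProg).exec σ₂).1 = σ₃ at *
  obtain ⟨l4, l4'⟩ := threshold_loop r3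
  have u4 : ((Prog.loop 5 0 thresholdBody).exec σ₃).1.idx 3 = u := by
    rw [exec_idx_of_notMem (by decide), u3]
  rw [u3] at l4 l4'
  generalize ((Prog.loop 5 0 thresholdBody).exec σ₃).1 = σ₄ at *
  have l5 : ∀ r j, ((Prog.const ⟨3, 3, 3⟩ 0).exec σ₄).1.mem 3 r j =
      if r = (u : ℕ) ∧ j = (u : ℕ) then 0 else σ₄.mem 3 r j := fun r j => by
    simp [Prog.exec, RAMState.mem_set, u4]
  refine ⟨fun i => ?_, fun r hr j => ?_⟩
  · rw [l5]
    -- The diagonal entry is overwritten because `β` is arbitrary here: for `β ≤ 0` thresholding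
    -- would set it to `1`.
    by_cases hi : i = u
    · rw [if_pos ⟨rfl, congrArg Fin.val hi⟩, Set.indicator_of_notMem]
      rintro ⟨hne, -⟩
      exact hne hi
    · rw [if_neg (fun e => hi (Fin.ext e.2)), l4 i i.2, l3 ⟨i, hi⟩]
      have hout : (∑ s ∈ Finset.range T, simplexToBall (smgIter u p lam η X s) ⟨i, hi⟩) / (T : ℝ) =
          simplexToBall (smgOutput u p lam η X) ⟨i, hi⟩ := by
        rw [simplexToBall_smgOutput,
          Fin.sum_univ_eq_sum_range fun t => simplexToBall (smgIter u p lam η X t) ⟨i, hi⟩]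
      rw [hout]
      by_cases hb : β / 2 ≤ |simplexToBall (smgOutput u p lam η X) ⟨i, hi⟩|
      · rw [if_pos hb, Set.indicator_of_mem]
        exact ⟨hi, hb⟩
      · rw [if_neg hb, Set.indicator_of_notMem]
        rintro ⟨_, hb'⟩
        exact hb hb'
  · rw [l5, if_neg (fun e => hr e.1), l4' r hr, o3, o2, o1]

theorem mainProg_output (p : Fin n → ℝ) (lam η β : ℝ) (X : Fin T → Fin n → Entry) (u i : Fin n) :
    mainProg.output p lam η β X u i =
      (estNeighbors p lam η β X u).indicator (fun _ => (1 : ℝ)) i := by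
  have h := setupProg_exec p lam η β X
  simp only [Prog.output, mainProg, exec_block_cons, exec_block_nil]
  generalize (setupProg.exec (inputState p lam η β X)).1 = σ at *
  have key := loop_induction (r := 3) (s := 0) (P := vertexProg) (σ := σ)
    (fun k τ => ∀ u : Fin n, (u : ℕ) < k → ∀ i : Fin n, τ.mem 3 u i =
      (estNeighbors p lam η β X u).indicator (fun _ => (1 : ℝ)) i) (by simp) ?_
  · exact key u (by rw [h.idx_zero]; exact u.2) i
  intro k hk τ hmem hidx hI u hu i
  rw [h.idx_zero] at hk
  have hr : Ready p lam η β X (τ.setIdx 3 k) := by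
    refine h.congr (fun r hr => ?_) fun a ha => ?_
    · rw [RAMState.idx_setIdx, if_neg (by rintro rfl; simp at hr), hidx r (by revert r; decide)]
    · rw [RAMState.mem_setIdx, hmem a (by revert a; decide)]
  obtain ⟨v1, v2⟩ := vertexProg_exec (u := ⟨k, hk⟩) hr (by rw [RAMState.idx_setIdx, if_pos rfl])
  by_cases huk : (u : ℕ) = k
  · obtain rfl : u = ⟨k, hk⟩ := Fin.ext huk
    exact v1 i
  · rw [v2 u huk, RAMState.mem_setIdx]
    exact hI u (by omega) i

end

/-- For `n, T ≥ 1` every monomial of the exact cost is at most `n ^ 2 * T`, and the coefficients add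
up to 102. -/
lemma cost_mainProg_le {n T : ℕ} (hn : 1 ≤ n) (hT : 1 ≤ T) :
    mainProg.cost n T ≤ 102 * (n ^ 2 * T) := by
  have h1 : n ≤ n ^ 2 := Nat.le_self_pow two_ne_zero n
  have h2 : n ^ 2 ≤ n ^ 2 * T := Nat.le_mul_of_pos_right _ hT
  have h3 : n * T ≤ n ^ 2 * T := Nat.mul_le_mul_right T h1
  have h4 : T ≤ n * T := Nat.le_mul_of_pos_left _ hn
  have h5 : mainProg.cost n T =
      16 + 13 * n + 2 * T + 18 * (n * T) + 15 * n ^ 2 + 38 * (n ^ 2 * T) := by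
    simp only [mainProg, setupProg, constBlock, sizeBody, countBody, paramBlock, vertexProg,
      initBody, initFix, stepProg, headBlock, forwardBody, suffixInit, backwardBody, gradBody,
      scaleBlock, updateBody, thresholdBody, block, cost]
    simp only [if_true, one_ne_zero, if_false]
    ring
  rw [h5]
  linarith

theorem mainProg_steps_le {n T : ℕ} (hn : 1 ≤ n) (hT : 1 ≤ T) (p : Fin n → ℝ) (lam η β : ℝ)
    (X : Fin T → Fin n → Entry) :
    (mainProg.steps p lam η β X : ℝ) ≤ 102 * (n : ℝ) ^ 2 * T := by
  have hs : mainProg.SimpleLoops := by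
    simp [mainProg, setupProg, constBlock, sizeBody, countBody, paramBlock, vertexProg,
      initBody, initFix, stepProg, headBlock, forwardBody, suffixInit, backwardBody, gradBody,
      scaleBlock, updateBody, thresholdBody, block, SimpleLoops]
  have h : mainProg.steps p lam η β X ≤ mainProg.cost n T :=
    exec_snd_le_cost (by decide) (by decide) hs (inputState p lam η β X)
  rw [mul_assoc]
  exact_mod_cast h.trans (cost_mainProg_le hn hT)

end Prog

/-- With `T` as prescribed, `n² T` is of the order `n² log (n / δ)`. -/
lemma exists_sq_mul_ceil_le {C lam ε : ℝ} (hlam : 0 < lam) (hε : 0 < ε) (R : ℝ) (hR : 0 < R) :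
    ∃ M : ℝ, 0 < M ∧ ∀ (n : ℕ) (δ : ℝ), 2 ≤ n → 0 < δ → δ < 1 →
      1 ≤ ⌈sampleBound C lam (Real.log ((n : ℝ) ^ 2 / δ)) ε⌉₊ ∧
      R * (n : ℝ) ^ 2 * (⌈sampleBound C lam (Real.log ((n : ℝ) ^ 2 / δ)) ε⌉₊ : ℝ) ≤
        M * (n : ℝ) ^ 2 * Real.log (n / δ) := by
  set c := lam ^ 4 * Real.exp (C * lam) * (ε ^ 4)⁻¹ with hc
  have hc0 : 0 < c := by positivity
  have hlog2 : 0 < Real.log 2 := Real.log_pos one_lt_two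
  -- The 2 comes from $\log(n^2/\delta)\le2\log(n/\delta)$; the other summand absorbs the rounding,
  -- as $\log(n/\delta)\ge\log2$ for `n ≥ 2`.
  refine ⟨R * (2 * c + 1 / Real.log 2), by positivity, fun n δ hn hδ0 hδ1 => ?_⟩
  have hn' : (2 : ℝ) ≤ n := by exact_mod_cast hn
  have hnδ : (n : ℝ) ≤ n / δ := le_div_self (by positivity) hδ0 hδ1.le
  have hδinv : 1 ≤ 1 / δ := (one_le_div hδ0).2 hδ1.le
  have hL2 : Real.log 2 ≤ Real.log (n / δ) := Real.log_le_log two_pos (hn'.trans hnδ)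
  have hsq : (n : ℝ) ^ 2 / δ ≤ (n / δ) ^ 2 := by
    rw [div_pow]
    exact div_le_div_of_nonneg_left (by positivity) (by positivity) (by nlinarith)
  have hL : Real.log ((n : ℝ) ^ 2 / δ) ≤ 2 * Real.log (n / δ) := by
    refine (Real.log_le_log (by positivity) hsq).trans_eq ?_
    rw [Real.log_pow]; norm_num
  have hLpos : 0 < Real.log ((n : ℝ) ^ 2 / δ) :=
    Real.log_pos ((one_lt_div hδ0).2 (by nlinarith))
  have hsb : sampleBound C lam (Real.log ((n : ℝ) ^ 2 / δ)) ε =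
      c * Real.log ((n : ℝ) ^ 2 / δ) := by rw [sampleBound, hc]; ring
  rw [hsb]
  have hpos : 0 < c * Real.log ((n : ℝ) ^ 2 / δ) := by positivity
  refine ⟨Nat.one_le_iff_ne_zero.2 (Nat.ceil_pos.2 hpos).ne', ?_⟩
  have hceil := (Nat.ceil_lt_add_one hpos.le).le
  have h1 : 1 ≤ 1 / Real.log 2 * Real.log (n / δ) := by
    rw [one_div_mul_eq_div, one_le_div hlog2]; exact hL2
  have h2 : c * Real.log ((n : ℝ) ^ 2 / δ) ≤ c * (2 * Real.log (n / δ)) :=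
    mul_le_mul_of_nonneg_left hL hc0.le
  calc R * (n : ℝ) ^ 2 * (⌈c * Real.log ((n : ℝ) ^ 2 / δ)⌉₊ : ℝ)
      ≤ R * (n : ℝ) ^ 2 * ((2 * c + 1 / Real.log 2) * Real.log (n / δ)) :=
        mul_le_mul_of_nonneg_left (by linarith) (by positivity)
    _ = _ := by ring

end IsingMissing

end

/-! ### The main theorem -/

theorem mainTheorem1 :
    ∃ (K R : ℝ) (P : Prog), 0 < K ∧ 0 < R ∧
      -- One fixed program runs the algorithm for every vertex on the same samples, thresholds the
      -- results, and takes at most `R n² T` steps.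
      (∀ (n T : ℕ) (p : Fin n → ℝ) (lam η β : ℝ) (X : Fin T → Fin n → Entry), 1 ≤ n → 1 ≤ T →
        (∀ u i, P.output p lam η β X u i =
          (estNeighbors p lam η β X u).indicator (fun _ => (1 : ℝ)) i) ∧
        (P.steps p lam η β X : ℝ) ≤ R * (n : ℝ) ^ 2 * T) ∧
      ∀ q lam₀ : ℝ, 0 ≤ q → q < 1 → 0 < lam₀ → ∃ C : ℝ, 0 < C ∧
        (∀ (n T : ℕ) (A : Matrix (Fin n) (Fin n) ℝ) (p : Fin n → ℝ) (lam δ : ℝ),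
          A.IsSymm → (∀ i, A i i = 0) → 0 < lam → (∀ i, ∑ j, |A i j| ≤ lam) →
          (∀ i, 0 ≤ p i ∧ p i ≤ q) → 0 < δ → δ < 1 →
          -- Recovery of the weights at one vertex.
          (∀ (u : Fin n) (ε : ℝ), 0 < ε →
            (explicitBound K q lam (Real.log (n / δ)) ε ≤ T ∨
              (lam₀ ≤ lam ∧ sampleBound C lam (Real.log (n / δ)) ε ≤ T)) →
            1 - δ ≤ (sampleLaw A 0 p T).real
              {X | ∀ i : Others u,
                |simplexToBall (smgOutput u p lam (stepSize q lam n T) X) i - A u i| ≤ ε}) ∧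
          -- Recovery of the whole graph.
          (∀ β : ℝ, 0 < β → (∀ i j, A i j ≠ 0 → β ≤ |A i j|) →
            (explicitBound K q lam (Real.log ((n : ℝ) ^ 2 / δ)) (β / 2) ≤ T ∨
              (lam₀ ≤ lam ∧ sampleBound C lam (Real.log ((n : ℝ) ^ 2 / δ)) (β / 2) ≤ T)) →
            1 - δ ≤ (sampleLaw A 0 p T).real
              {X | ∀ u, estNeighbors p lam (stepSize q lam n T) β X u =
                (depGraph A).neighborSet u})) ∧
        -- With the stated number of samples, the program recovers the whole graph in
        -- `O(n² log (n / δ))` steps, for fixed `q, lam, β`.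
        (∀ lam β : ℝ, lam₀ ≤ lam → 0 < β → ∃ M : ℝ, 0 < M ∧
          ∀ (n T : ℕ) (A : Matrix (Fin n) (Fin n) ℝ) (p : Fin n → ℝ) (δ : ℝ),
            2 ≤ n → A.IsSymm → (∀ i, A i i = 0) → (∀ i, ∑ j, |A i j| ≤ lam) →
            (∀ i, 0 ≤ p i ∧ p i ≤ q) → 0 < δ → δ < 1 →
            (∀ i j, A i j ≠ 0 → β ≤ |A i j|) →
            T = ⌈sampleBound C lam (Real.log ((n : ℝ) ^ 2 / δ)) (β / 2)⌉₊ →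
            1 - δ ≤ (sampleLaw A 0 p T).real
              {X | ∀ u i, P.output p lam (stepSize q lam n T) β X u i =
                ((depGraph A).neighborSet u).indicator (fun _ => (1 : ℝ)) i} ∧
            ∀ X : Fin T → Fin n → Entry,
              (P.steps p lam (stepSize q lam n T) β X : ℝ) ≤
                M * (n : ℝ) ^ 2 * Real.log (n / δ)) := by
  refine ⟨1024, 102, Prog.mainProg, by norm_num, by norm_num, ?_, ?_⟩
  · intro n T p lam η β X hn hT
    exact ⟨Prog.mainProg_output p lam η β X, Prog.mainProg_steps_le hn hT p lam η β X⟩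
  intro q lam₀ hq0 hq hlam₀
  obtain ⟨C, hC0, hC⟩ := exists_explicitBound_le_sampleBound 1024 hq hlam₀
  have hlog : ∀ (n : ℕ) (δ : ℝ), 0 < δ → δ < 1 → 0 ≤ Real.log ((n : ℝ) ^ 2 / δ) := by
    intro n δ hδ0 hδ1
    rcases Nat.eq_zero_or_pos n with rfl | hn
    -- For `n = 0` the argument is `0`, and `Real.log 0 = 0`.
    · simp
    · have hn' : (1 : ℝ) ≤ n := by exact_mod_cast hn
      exact Real.log_nonneg ((one_le_div hδ0).2 (by nlinarith))
  refine ⟨C, hC0, ?_, ?_⟩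
  · intro n T A p lam δ hA hd hlam hl hp hδ0 hδ1
    constructor
    · intro u ε hε hTb
      have hn' : (1 : ℝ) ≤ n := by exact_mod_cast Nat.one_le_of_lt u.2
      -- By the choice of `C`, either sufficient condition implies the explicit one.
      have hT : explicitBound 1024 q lam (Real.log (n / δ)) ε ≤ T :=
        hTb.elim id fun h => (hC lam _ ε h.1
          (Real.log_nonneg ((one_le_div hδ0).2 (by linarith)))).trans h.2
      have := isProbabilityMeasure_sampleLaw A (fun i => ⟨(hp i).1, (hp i).2.trans hq.le⟩) T
      exact one_sub_le_measureReal (Set.toFinite _).measurableSet (fun X hX i => (hX i).le)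
        (recovery_at_vertex hA hd hq0 hq hlam hl hp hδ0 hδ1 hε u hT)
    · intro β hβ hAβ hTb
      exact graph_recovery hA hd hq0 hq hlam hl hp hδ0 hδ1 hβ hAβ
        (hTb.elim id fun h => (hC lam _ _ h.1 (hlog n δ hδ0 hδ1)).trans h.2)
  · intro lam β hlam hβ
    have hlam0 : 0 < lam := hlam₀.trans_le hlam
    obtain ⟨M, hM0, hM⟩ := exists_sq_mul_ceil_le (C := C) hlam0 (half_pos hβ) 102 (by norm_num)
    refine ⟨M, hM0, ?_⟩
    intro n T A p δ hn hA hd hl hp hδ0 hδ1 hAβ hT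
    obtain ⟨hT1, hTM⟩ := hM n δ hn hδ0 hδ1
    rw [← hT] at hT1 hTM
    refine ⟨?_, fun X => (Prog.mainProg_steps_le (by omega) hT1 _ _ _ _ X).trans hTM⟩
    have := isProbabilityMeasure_sampleLaw A (fun i => ⟨(hp i).1, (hp i).2.trans hq.le⟩) T
    have hTb : explicitBound 1024 q lam (Real.log ((n : ℝ) ^ 2 / δ)) (β / 2) ≤ T :=
      (hC lam _ _ hlam (hlog n δ hδ0 hδ1)).trans (by rw [hT]; exact Nat.le_ceil _)
    refine (graph_recovery hA hd hq0 hq hlam0 hl hp hδ0 hδ1 hβ hAβ hTb).trans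
      (measureReal_mono fun X hX u i => ?_)
    rw [Prog.mainProg_output, hX u]
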